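/- **Definitions.** A *simple arc* in $\mathbf R^2$ is the image of a continuous injective map $[0,1]\to\mathbf R^2$; a curve is *$C^2$-regular* if it has a $C^2$ parametrization with nowhere vanishing derivative, and an *inflection* of such a curve is a point where its curvature vanishes. A *spiral* with *vortex* $o$ is a simple arc $\Gamma\subset\mathbf R^2$ having $o$ as an end point, which is $C^2$-regular and has no inflections in the complement of $o$, lies in a closed ball $B$ centered at $o$, and meets $\partial B$ only at its other end point (no regularity is assumed at $o$). A *double spiral* with vortex $o$ is the union $\Gamma$ of two spirals which lie in the same ball $B$ and intersect only at their common vortex $o$, the center of $B$. A *side* of $\Gamma$ is the closure of a connected component of $B\setminus\Gamma$. A side $S$ is *proper* if it contains no line segment having $o$ in its relative interior. The *principal normal* $N$ along $\Gamma\setminus\{o\}$ is the unit normal with respect to which the curvature of $\Gamma$ is positive. If $N$ points into one and the same side $S$ of $\Gamma$ at all points of $\Gamma$ other than $o$ and the end points of $\Gamma$, then $\Gamma$ is called *convex* when that side is proper and *concave* when it is not; if there is no such side, then $\Gamma$ is *semiconvex*. **Proposition 5.3.** Let $\Gamma\subset\mathbf R^2$ be a double spiral with vortex $o$, and let $S$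 be a proper side of $\Gamma$. Then there exists a simple $C^2$-regular arc $\widetilde\Gamma\subset S\setminus\{o\}$ which has the same end points as $\Gamma$, coincides with $\Gamma$ near these end points, and has at most two inflections. Furthermore, if $\Gamma$ is semiconvex, then $\widetilde\Gamma$ may be chosen to have precisely one inflection, and if $\Gamma$ is convex, then $\widetilde\Gamma$ may be chosen to have no inflections. -/

import Mathlib

open Set Filter Topology

/-- The Euclidean plane. -/
abbrev Plane : Type := EuclideanSpace ℝ (Fin 2)

noncomputable section

/-- The left unit normal of a regular planar curve `γ : I → ℝ²` at the parameter `t`, i.e. the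
unit tangent `T = γ' / ‖γ'‖` rotated by `π / 2`.  Derivatives are taken within `I`, hence are
one-sided at end points of `I`. -/
def leftNormal (γ : ℝ → Plane) (I : Set ℝ) (t : ℝ) : Plane :=
  ‖derivWithin γ I t‖⁻¹ • !₂[-(derivWithin γ I t 1), derivWithin γ I t 0]

/-- The curvature `k = ⟨∇_T T, N⟩` of a regular `C²` curve `γ : I → ℝ²` at `t` with respect to a
unit normal `N` of the curve at `t`.  Since `∇_T T = γ'' / ‖γ'‖² + (a multiple of γ')` in any
regular parametrization, it equals `⟨γ'', N⟩ / ‖γ'‖²`. -/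
def geodesicCurvature (γ : ℝ → Plane) (I : Set ℝ) (N : Plane) (t : ℝ) : ℝ :=
  inner ℝ (derivWithin (derivWithin γ I) I t) N / ‖derivWithin γ I t‖ ^ 2

/-- The parameter `t` gives an inflection if the curvature vanishes there (the choice of the unit
normal only affects the sign). -/
def IsInflection (γ : ℝ → Plane) (I : Set ℝ) (t : ℝ) : Prop :=
  geodesicCurvature γ I (leftNormal γ I t) t = 0

/-- The set of inflections, as points of the curve `γ '' I`. -/
def inflections (γ : ℝ → Plane) (I : Set ℝ) : Set Plane :=
  γ '' {t ∈ I | IsInflection γ I t}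

/-- The principal normal: the unit normal with respect to which the curvature is positive (away
from inflections). -/
def principalNormal (γ : ℝ → Plane) (I : Set ℝ) (t : ℝ) : Plane :=
  Real.sign (geodesicCurvature γ I (leftNormal γ I t) t) • leftNormal γ I t

/-- `γ : I → ℝ²` is a `C²`-regular curve. -/
structure IsC2Regular (γ : ℝ → Plane) (I : Set ℝ) : Prop where
  contDiffOn : ContDiffOn ℝ 2 γ I
  deriv_ne_zero : ∀ t ∈ I, derivWithin γ I t ≠ 0

/-- `γ : [0,1] → ℝ²` parametrizes a simple `C²`-regular arc. -/
structure IsSimpleC2RegularArc (γ : ℝ → Plane) : Prop where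
  injOn : InjOn γ (Icc 0 1)
  regular : IsC2Regular γ (Icc 0 1)

/-- `γ : [0,1] → ℝ²` parametrizes a spiral with vortex `o = γ 0` in the closed ball of radius `R`
centered at `o`: a simple arc, `C²`-regular and free of inflections in the complement of `o`,
which lies in the ball and meets the bounding circle only at its other end point `γ 1`. No
regularity is assumed at `o` beyond continuity. -/
structure IsSpiral (γ : ℝ → Plane) (o : Plane) (R : ℝ) : Prop where
  continuousOn : ContinuousOn γ (Icc 0 1)
  injOn : InjOn γ (Icc 0 1)
  map_zero : γ 0 = o
  regular : IsC2Regular γ (Ioc 0 1)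
  no_inflection : ∀ t ∈ Ioc (0 : ℝ) 1, ¬ IsInflection γ (Ioc 0 1) t
  mem_ball : ∀ t ∈ Icc (0 : ℝ) 1, γ t ∈ Metric.closedBall o R
  mem_sphere_iff : ∀ t ∈ Icc (0 : ℝ) 1, γ t ∈ Metric.sphere o R ↔ t = 1

/-- A (parametrized) double spiral: two spirals in the same ball, the arms, with a common vortex
at the center of the ball, which is the only point that they share. -/
structure DoubleSpiral where
  vortex : Plane
  radius : ℝ
  arm₁ : ℝ → Plane
  arm₂ : ℝ → Plane
  spiral₁ : IsSpiral arm₁ vortex radius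
  spiral₂ : IsSpiral arm₂ vortex radius
  inter_arms : (arm₁ '' Icc 0 1) ∩ (arm₂ '' Icc 0 1) = {vortex}

namespace DoubleSpiral

/-- The underlying set of points of a double spiral. -/
def carrier (Γ : DoubleSpiral) : Set Plane :=
  (Γ.arm₁ '' Icc 0 1) ∪ (Γ.arm₂ '' Icc 0 1)

/-- The closed ball that is associated to a double spiral. -/
def ball (Γ : DoubleSpiral) : Set Plane :=
  Metric.closedBall Γ.vortex Γ.radius

/-- A side of `Γ` is the closure of a connected component of `B - Γ`. -/
def IsSide (Γ : DoubleSpiral) (S : Set Plane) : Prop :=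
  ∃ x ∈ Γ.ball \ Γ.carrier, S = closure (connectedComponentIn (Γ.ball \ Γ.carrier) x)

/-- A side is proper if it contains no line segment passing through the vortex, i.e. having the
vortex in its relative interior. -/
def IsProperSide (Γ : DoubleSpiral) (S : Set Plane) : Prop :=
  Γ.IsSide S ∧
    ¬ ∃ x y : Plane, x ≠ y ∧ Γ.vortex ∈ openSegment ℝ x y ∧ segment ℝ x y ⊆ S

/-- The principal normals of `Γ` point only into `S`.  At the two end points of `Γ`, which lie on
the boundary of the ball, a normal may point out of the ball, so nothing is asked there. -/
def NormalsPointInto (Γ : DoubleSpiral) (S : Set Plane) : Prop :=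
  (∀ t ∈ Ioo (0 : ℝ) 1, ∀ᶠ s : ℝ in 𝓝[>] 0,
      Γ.arm₁ t + s • principalNormal Γ.arm₁ (Ioc 0 1) t ∈ S) ∧
  (∀ t ∈ Ioo (0 : ℝ) 1, ∀ᶠ s : ℝ in 𝓝[>] 0,
      Γ.arm₂ t + s • principalNormal Γ.arm₂ (Ioc 0 1) t ∈ S)

/-- The principal normals point into a single side of `Γ`, and that side is proper. -/
def IsConvex (Γ : DoubleSpiral) : Prop :=
  ∃ S, Γ.IsSide S ∧ Γ.NormalsPointInto S ∧ Γ.IsProperSide S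

/-- There is no single side of `Γ` into which all principal normals point. -/
def IsSemiconvex (Γ : DoubleSpiral) : Prop :=
  ¬ ∃ S, Γ.IsSide S ∧ Γ.NormalsPointInto S

end DoubleSpiral

end

/-! Identify the plane with ℂ and the vortex with 0, let both arms run outwards, and let s = ±1 be
the sign of the curvature of an arm. A side of an arm is recorded by a sign σ: a vector w at `g t`
points to it when σ * cross (v t) w > 0. The principal normal points to the side s.

Tangent lines. The part of an arm that precedes a point lies strictly to one side of the tangent
line there (`Arm.secant_pos`). The strict inequality cannot be lost as the earlier point moves
inwards: nonzero curvature forbids it, except for one kind of tangency at the outer end, which the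
ball forbids. With the vortex as the earlier point, the polar angle is strictly monotone along the
arm (`Arm.cross_pos`).

Sides. Each side of an arm that touches a component of the complement does so along the whole arm.
Every component has some side of some arm, and two components that share a side coincide. A
component with all four sides is dense in the ball, so it is not proper.

Chords. The heart of the matter is a chord of a proper component U: an open segment in U from a
point p of A to a point q of B, transversal to both arms, that leaves A on its side σ and reaches B
on its side -σ (`Arm.exists_chord`). If one arm winds infinitely often, the arms rotate in the same
sense, as they would meet otherwise; some ray meets B inside of A, another meets A inside of B, and
pieces of these rays are chords on the two sides. If neither arm does, then near the vortex the arms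
are polar graphs θ₁ < θ₂ < θ₁ + 2π over the radius. Were θ₂ r' - θ₁ r ≥ π for all small r and r', a
segment through the vortex would fit in between; so in a proper side some points of the arms subtend
an angle less than π, and a piece of the segment that joins them is a chord. It can be made
transversal because only countably many tangent lines of an arm pass through a given point away from
it.

The arc. Follow A inwards from its outer end, leave it near p, run along a slightly curved path
close to the chord, join B near q and follow it outwards. The path starts and ends as a parabola. In
a suitable affine frame at p the arm is a steeply descending graph that crosses the parabola, and
the two are joined by a smoothed maximum (`exists_join`). A maximum of convex functions is convex,
so no inflection arises if A curves towards U, that is, if s = σ. Otherwise the graph is concave,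
and bending it to a convex one beforehand costs exactly one inflection. The same holds at q with -σ,
so the number of inflections is the number of arms that curve away from U (`Arm.exists_arc`); it is
at most two.

Counting. Another component V has the two remaining sides. If both arms curve towards U there are no
inflections; if they curve towards different components there is one. If both curve towards V, the
angle of U at the vortex is so small that V is not proper (`Arm.HasChord.count`). -/

/-! ### The cross product and one-variable calculus. -/

/-- The planar cross product. -/
def cross (z w : ℂ) : ℝ := z.re * w.im - z.im * w.re

lemma cross_self_eq_zero (z : ℂ) : cross z z = 0 := by simp [cross, mul_comm]
lemma cross_swap (z w : ℂ) : cross z w = -cross w z := by simp [cross]; ring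
lemma cross_add_left (z z' w : ℂ) : cross (z + z') w = cross z w + cross z' w := by
  simp [cross]; ring
lemma cross_add_right (z w w' : ℂ) : cross z (w + w') = cross z w + cross z w' := by
  simp [cross]; ring
lemma cross_sub_left (z z' w : ℂ) : cross (z - z') w = cross z w - cross z' w := by
  simp [cross]; ring
lemma cross_sub_right (z w w' : ℂ) : cross z (w - w') = cross z w - cross z w' := by
  simp [cross]; ring
lemma cross_neg_left (z w : ℂ) : cross (-z) w = -cross z w := by simp [cross]; ring
lemma cross_neg_right (z w : ℂ) : cross z (-w) = -cross z w := by simp [cross]; ring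
lemma cross_real_mul_left (c : ℝ) (z w : ℂ) : cross ((c : ℂ) * z) w = c * cross z w := by
  simp [cross]; ring
lemma cross_real_mul_right (c : ℝ) (z w : ℂ) : cross z ((c : ℂ) * w) = c * cross z w := by
  simp [cross]; ring
lemma cross_zero_left (w : ℂ) : cross 0 w = 0 := by simp [cross]
lemma cross_zero_right (w : ℂ) : cross w 0 = 0 := by simp [cross]

lemma abs_cross_le (z w : ℂ) : |cross z w| ≤ ‖z‖ * ‖w‖ := by
  have h1 := Complex.sq_norm z
  have h2 := Complex.sq_norm w
  rw [Complex.normSq_apply] at h1 h2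
  apply abs_le_of_sq_le_sq _ (by positivity)
  rw [mul_pow, h1, h2, cross]
  nlinarith [sq_nonneg (z.re * w.re + z.im * w.im)]

@[fun_prop]
lemma Continuous.cross {X : Type*} [TopologicalSpace X] {f g : X → ℂ} (hf : Continuous f)
    (hg : Continuous g) : Continuous fun x => cross (f x) (g x) := by
  unfold _root_.cross; fun_prop

lemma continuous_cross : Continuous fun p : ℂ × ℂ => cross p.1 p.2 := by
  unfold cross; fun_prop

@[fun_prop]
lemma ContinuousOn.cross {X : Type*} [TopologicalSpace X] {f g : X → ℂ} {s : Set X}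
    (hf : ContinuousOn f s) (hg : ContinuousOn g s) :
    ContinuousOn (fun x => cross (f x) (g x)) s :=
  continuous_cross.comp_continuousOn (hf.prodMk hg)

@[fun_prop]
lemma ContinuousAt.cross {X : Type*} [TopologicalSpace X] {f g : X → ℂ} {x : X}
    (hf : ContinuousAt f x) (hg : ContinuousAt g x) :
    ContinuousAt (fun x => cross (f x) (g x)) x :=
  continuous_cross.continuousAt.comp (hf.prodMk hg)

lemma HasDerivAt.re_comp {f : ℝ → ℂ} {f' : ℂ} {t : ℝ} (hf : HasDerivAt f f' t) :
    HasDerivAt (fun u => (f u).re) f'.re t :=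
  (Complex.reCLM.hasFDerivAt.comp_hasDerivAt t hf)

lemma HasDerivAt.im_comp {f : ℝ → ℂ} {f' : ℂ} {t : ℝ} (hf : HasDerivAt f f' t) :
    HasDerivAt (fun u => (f u).im) f'.im t :=
  (Complex.imCLM.hasFDerivAt.comp_hasDerivAt t hf)

lemma HasDerivAt.cross {f g : ℝ → ℂ} {f' g' : ℂ} {t : ℝ} (hf : HasDerivAt f f' t)
    (hg : HasDerivAt g g' t) :
    HasDerivAt (fun u => cross (f u) (g u)) (cross f' (g t) + cross (f t) g') t := by
  have := (hf.re_comp.mul hg.im_comp).sub (hf.im_comp.mul hg.re_comp)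
  refine this.congr_deriv ?_
  simp [_root_.cross]; ring

lemma HasDerivAt.cross_const {f : ℝ → ℂ} {f' : ℂ} {t : ℝ} (hf : HasDerivAt f f' t) (w : ℂ) :
    HasDerivAt (fun u => _root_.cross (f u) w) (_root_.cross f' w) t := by
  have := hf.cross (hasDerivAt_const t w)
  simpa [cross_zero_right] using this

lemma HasDerivAt.const_cross {f : ℝ → ℂ} {f' : ℂ} {t : ℝ} (hf : HasDerivAt f f' t) (w : ℂ) :
    HasDerivAt (fun u => _root_.cross w (f u)) (_root_.cross w f') t := by
  have := (hasDerivAt_const t w).cross hf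
  simpa [cross_zero_left] using this

/-- Cramer's rule. -/
lemma cross_smul_eq (z d e : ℂ) :
    ((cross d e : ℝ) : ℂ) * z = (cross z e : ℂ) * d + (cross d z : ℂ) * e := by
  apply Complex.ext <;> simp [cross] <;> ring

lemma eq_of_cross_eq_zero {z d : ℂ} (hd : d ≠ 0) (h : cross d z = 0) : ∃ c : ℝ, z = c * d := by
  refine ⟨(z / d).re, ?_⟩
  have hn : d.re * d.re + d.im * d.im ≠ 0 := by
    rw [← Complex.normSq_apply]; exact fun h => hd (Complex.normSq_eq_zero.1 h)
  have : (z / d).im = 0 := by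
    rw [Complex.div_im, ← sub_div]
    unfold cross at h
    have e : z.im * d.re = z.re * d.im := by linarith
    rw [e, sub_self, zero_div]
  have h2 : z / d = ((z / d).re : ℂ) := Complex.ext (by simp) (by simpa using this)
  rw [← h2]; field_simp

lemma lt_of_hasDerivAt_pos {f f' : ℝ → ℝ} {a b : ℝ} (hab : a < b)
    (hc : ContinuousOn f (Icc a b)) (hf : ∀ t ∈ Ioo a b, HasDerivAt f (f' t) t)
    (hpos : ∀ t ∈ Ioo a b, 0 < f' t) : f a < f b := by
  obtain ⟨c, hc, h⟩ := exists_hasDerivAt_eq_slope f f' hab hc hf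
  have := hpos c hc
  rw [h] at this
  have := (div_pos_iff_of_pos_right (sub_pos.2 hab)).1 this
  linarith

lemma le_of_hasDerivAt_nonneg {f f' : ℝ → ℝ} {a b : ℝ} (hab : a ≤ b)
    (hc : ContinuousOn f (Icc a b)) (hf : ∀ t ∈ Ioo a b, HasDerivAt f (f' t) t)
    (hpos : ∀ t ∈ Ioo a b, 0 ≤ f' t) : f a ≤ f b := by
  rcases hab.eq_or_lt with rfl | hab
  · rfl
  obtain ⟨c, hc, h⟩ := exists_hasDerivAt_eq_slope f f' hab hc hf
  have := hpos c hc
  rw [h] at this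
  have := (le_div_iff₀ (sub_pos.2 hab)).1 this
  linarith

/-- A positive derivative at a zero makes the function negative just to the left. -/
lemma HasDerivAt.eventually_neg_left {f : ℝ → ℝ} {f' t : ℝ} (hf : HasDerivAt f f' t)
    (h0 : f t = 0) (hf' : 0 < f') : ∀ᶠ u in 𝓝[<] t, f u < 0 := by
  have h := (hasDerivAt_iff_tendsto_slope.1 hf).mono_left
    (nhdsWithin_mono t (fun x (hx : x < t) => hx.ne) : 𝓝[<] t ≤ 𝓝[≠] t)
  filter_upwards [h.eventually (lt_mem_nhds hf'), self_mem_nhdsWithin] with u hu hut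
  rw [slope_def_field, h0, sub_zero] at hu
  by_contra! hcon
  have : f u / (u - t) ≤ 0 := div_nonpos_of_nonneg_of_nonpos hcon (sub_nonpos.2 (le_of_lt hut))
  linarith

lemma HasDerivAt.eventually_neg_right {f : ℝ → ℝ} {f' t : ℝ} (hf : HasDerivAt f f' t)
    (h0 : f t = 0) (hf' : f' < 0) : ∀ᶠ u in 𝓝[>] t, f u < 0 := by
  have h := (hasDerivAt_iff_tendsto_slope.1 hf).mono_left
    (nhdsWithin_mono t (fun x (hx : t < x) => hx.ne') : 𝓝[>] t ≤ 𝓝[≠] t)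
  filter_upwards [h.eventually (gt_mem_nhds hf'), self_mem_nhdsWithin] with u hu hut
  rw [slope_def_field, h0, sub_zero] at hu
  by_contra! hcon
  have : 0 ≤ f u / (u - t) := div_nonneg hcon (sub_nonneg.2 (le_of_lt hut))
  linarith

/-! ### Spirals and their tangent lines. -/

/-- A spiral in the complex plane with vortex `0`, extended slightly beyond its end point at the
parameter `1`, together with its first and second derivative and the sign of its curvature. -/
structure Arm (R : ℝ) where
  g : ℝ → ℂ
  v : ℝ → ℂ
  a : ℝ → ℂ
  s : ℝ
  -- The interval reaches beyond 1 so that derivatives at the outer end are two-sided; injectivity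
  -- and the bounds on the norm are only required up to 1.
  b : ℝ
  one_lt : 1 < b
  hasDerivAt : ∀ t ∈ Ioo 0 b, HasDerivAt g (v t) t
  hasDerivAt_v : ∀ t ∈ Ioo 0 b, HasDerivAt v (a t) t
  cont_a : ContinuousOn a (Ioo 0 b)
  cont : ContinuousOn g (Icc 0 1)
  zero : g 0 = 0
  inj : InjOn g (Icc 0 1)
  sign : s = 1 ∨ s = -1
  curv : ∀ t ∈ Ioo 0 b, 0 < s * cross (v t) (a t)
  norm_lt : ∀ t ∈ Ico (0 : ℝ) 1, ‖g t‖ < R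
  norm_one : ‖g 1‖ = R

namespace Arm
variable {R : ℝ} (A : Arm R)

lemma mem_of_Ioc {t : ℝ} (ht : t ∈ Ioc (0 : ℝ) 1) : t ∈ Ioo 0 A.b :=
  ⟨ht.1, ht.2.trans_lt A.one_lt⟩

lemma mem_of_Ioo {t : ℝ} (ht : t ∈ Ioo (0 : ℝ) 1) : t ∈ Ioo 0 A.b :=
  ⟨ht.1, ht.2.trans A.one_lt⟩

lemma continuousOn_g : ContinuousOn A.g (Ioo 0 A.b) :=
  fun t ht => (A.hasDerivAt t ht).continuousAt.continuousWithinAt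

lemma cont_v : ContinuousOn A.v (Ioo 0 A.b) :=
  fun t ht => (A.hasDerivAt_v t ht).continuousAt.continuousWithinAt

lemma s_mul_s : A.s * A.s = 1 := by rcases A.sign with h | h <;> simp [h]

lemma v_ne_zero {t : ℝ} (ht : t ∈ Ioo 0 A.b) : A.v t ≠ 0 := by
  intro h
  have := A.curv t ht
  simp [h, cross_zero_left] at this

lemma g_ne_zero {t : ℝ} (ht : t ∈ Ioc (0 : ℝ) 1) : A.g t ≠ 0 := by
  intro h
  have := A.inj ⟨ht.1.le, ht.2⟩ (left_mem_Icc.2 zero_le_one) (h.trans A.zero.symm)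
  exact ht.1.ne' this


lemma R_pos (A : Arm R) : 0 < R := by
  rw [← A.norm_one]; exact norm_pos_iff.2 (A.g_ne_zero ⟨one_pos, le_rfl⟩)

lemma hasDerivAt_secant (r : ℝ) {t : ℝ} (ht : t ∈ Ioo 0 A.b) :
    HasDerivAt (fun u => A.s * cross (A.g u - A.g r) (A.v u))
      (A.s * cross (A.g t - A.g r) (A.a t)) t := by
  have := (((A.hasDerivAt t ht).sub_const (A.g r)).cross (A.hasDerivAt_v t ht)).const_mul A.s
  simpa [cross_self_eq_zero] using this

/-- Near t₀ the product cross (v x) (a y) has the sign of the curvature even for x ≠ y, by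
continuity. Integrating in y gives the sign of cross (v x) (v t), and integrating this in x gives
that of the secant. -/
lemma secant_near {t₀ : ℝ} (ht₀ : t₀ ∈ Ioo 0 A.b) :
    ∃ δ > 0, ∀ r t, |r - t₀| < δ → |t - t₀| < δ → r < t →
      0 < A.s * cross (A.g t - A.g r) (A.v t) := by
  have hc : ContinuousAt (fun p : ℝ × ℝ => A.s * cross (A.v p.1) (A.a p.2)) (t₀, t₀) := by
    have h1 : ContinuousAt A.v t₀ := A.cont_v.continuousAt (Ioo_mem_nhds ht₀.1 ht₀.2)
    have h2 : ContinuousAt A.a t₀ := A.cont_a.continuousAt (Ioo_mem_nhds ht₀.1 ht₀.2)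
    have h1' : ContinuousAt (fun p : ℝ × ℝ => A.v p.1) (t₀, t₀) :=
      ContinuousAt.comp (f := Prod.fst) (x := (t₀, t₀)) h1 continuousAt_fst
    have h2' : ContinuousAt (fun p : ℝ × ℝ => A.a p.2) (t₀, t₀) :=
      ContinuousAt.comp (f := Prod.snd) (x := (t₀, t₀)) h2 continuousAt_snd
    exact continuousAt_const.mul (h1'.cross h2')
  have hpos := hc.eventually (lt_mem_nhds (A.curv t₀ ht₀))
  have hmem : ∀ᶠ p : ℝ × ℝ in 𝓝 (t₀, t₀), p.1 ∈ Ioo 0 A.b ∧ p.2 ∈ Ioo 0 A.b := by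
    rw [nhds_prod_eq]
    have h : ∀ᶠ x in 𝓝 t₀, x ∈ Ioo 0 A.b := Ioo_mem_nhds ht₀.1 ht₀.2
    exact h.prod_mk h
  obtain ⟨δ, hδ, H⟩ := Metric.eventually_nhds_iff.1 (hpos.and hmem)
  refine ⟨δ, hδ, fun r t hr ht hrt => ?_⟩
  have key : ∀ x y, |x - t₀| < δ → |y - t₀| < δ →
      0 < A.s * cross (A.v x) (A.a y) ∧ x ∈ Ioo 0 A.b ∧ y ∈ Ioo 0 A.b := by
    intro x y hx hy
    exact H (y := (x, y)) (by simp [Prod.dist_eq, Real.dist_eq, hx, hy])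
  have hbt : ∀ x ∈ Icc r t, |x - t₀| < δ := by
    intro x hx; rw [abs_lt] at *; constructor <;> linarith [hx.1, hx.2]
  have hbIoo : ∀ x ∈ Icc r t, x ∈ Ioo 0 A.b := fun x hx => (key x x (hbt x hx) (hbt x hx)).2.1
  have hv : ∀ x ∈ Ico r t, 0 < A.s * cross (A.v x) (A.v t) := by
    intro x hx
    have := lt_of_hasDerivAt_pos (f := fun y => A.s * cross (A.v x) (A.v y))
      (f' := fun y => A.s * cross (A.v x) (A.a y)) hx.2
      (by
        have : ContinuousOn A.v (Icc x t) :=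
          A.cont_v.mono fun y hy => hbIoo y ⟨hx.1.trans hy.1, hy.2⟩
        fun_prop)
      (fun y hy => ((A.hasDerivAt_v y (hbIoo y ⟨hx.1.trans hy.1.le, hy.2.le⟩)).const_cross
        _).const_mul _)
      (fun y hy => (key x y (hbt x ⟨hx.1, hx.2.le⟩)
        (hbt y ⟨hx.1.trans hy.1.le, hy.2.le⟩)).1)
    simpa [cross_self_eq_zero] using this
  have := lt_of_hasDerivAt_pos (f := fun y => A.s * cross (A.g y - A.g t) (A.v t))
      (f' := fun y => A.s * cross (A.v y) (A.v t)) hrt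
      (by
        have : ContinuousOn A.g (Icc r t) := A.continuousOn_g.mono hbIoo
        fun_prop)
      (fun y hy => (((A.hasDerivAt y (hbIoo y ⟨hy.1.le, hy.2.le⟩)).sub_const _).cross_const
        _).const_mul _)
      (fun y hy => hv y ⟨hy.1.le, hy.2⟩)
  simp only [sub_self, cross_zero_left, mul_zero] at this
  have e : cross (A.g t - A.g r) (A.v t) = - cross (A.g r - A.g t) (A.v t) := by
    rw [← cross_neg_left]; simp
  rw [e]; linarith

/-- The norm is largest at the outer end, so `v 1` does not point inwards there, whereas `g 1 - g r`
has positive inner product with `g 1` because ‖g r‖ < R. Hence the two vectors cannot be opposite.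
-/
lemma inner_end {r c : ℝ} (hr : r ∈ Ico (0 : ℝ) 1) (h : A.g 1 - A.g r = c * A.v 1) : 0 < c := by
  have h1 : (1 : ℝ) ∈ Ioo 0 A.b := ⟨one_pos, A.one_lt⟩
  set q : ℂ → ℂ → ℝ := fun z w => z.re * w.re + z.im * w.im with hq
  have hd : HasDerivAt (fun u => q (A.g u) (A.g u)) (2 * q (A.v 1) (A.g 1)) 1 := by
    have hg := A.hasDerivAt 1 h1
    refine ((hg.re_comp.mul hg.re_comp).add (hg.im_comp.mul hg.im_comp)).congr_deriv ?_
    simp [hq]; ring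
  have hqn : ∀ z, q z z = ‖z‖ ^ 2 := fun z => by
    rw [Complex.sq_norm, Complex.normSq_apply]
  have hnn : 0 ≤ q (A.v 1) (A.g 1) := by
    by_contra! hneg
    have hd' : HasDerivAt (fun u => q (A.g 1) (A.g 1) - q (A.g u) (A.g u))
        (-(2 * q (A.v 1) (A.g 1))) 1 := hd.const_sub _
    have := hd'.eventually_neg_left (by simp) (by linarith)
    have h2 : ∀ᶠ u : ℝ in 𝓝[<] 1, u ∈ Ioo (0 : ℝ) 1 := Ioo_mem_nhdsLT one_pos
    obtain ⟨u, hu, hu'⟩ := (this.and h2).exists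
    simp only [hqn, A.norm_one] at hu
    have := A.norm_lt u ⟨hu'.1.le, hu'.2⟩
    nlinarith [norm_nonneg (A.g u)]
  have hpos : 0 < q (A.g 1 - A.g r) (A.g 1) := by
    have e : q (A.g 1 - A.g r) (A.g 1) = q (A.g 1) (A.g 1) - q (A.g r) (A.g 1) := by
      simp [hq]; ring
    have hcs : q (A.g r) (A.g 1) ≤ ‖A.g r‖ * ‖A.g 1‖ := by
      apply le_of_sq_le_sq _ (by positivity)
      rw [mul_pow, ← hqn, ← hqn]
      simp only [hq]
      nlinarith [sq_nonneg ((A.g r).re * (A.g 1).im - (A.g r).im * (A.g 1).re)]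
    rw [e, hqn, A.norm_one]
    rw [A.norm_one] at hcs
    have := A.norm_lt r hr
    nlinarith [A.R_pos]
  have : q (A.g 1 - A.g r) (A.g 1) = c * q (A.v 1) (A.g 1) := by
    rw [h]; simp [hq]; ring
  rw [this] at hpos
  exact pos_of_mul_pos_left hpos hnn

/-- At a zero the secant is a multiple c ≠ 0 of the velocity, and the derivative in t is c times the
positive curvature term. So the expression is negative just before t if c > 0 and just after t if c
< 0. At t = 1 there is no room after t, but there `inner_end` gives c > 0. -/
lemma secant_pos_of_nonneg {r : ℝ} (hr : r ∈ Ico (0 : ℝ) 1)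
    (h : ∀ t ∈ Ioc r 1, 0 ≤ A.s * cross (A.g t - A.g r) (A.v t)) :
    ∀ t ∈ Ioc r 1, 0 < A.s * cross (A.g t - A.g r) (A.v t) := by
  intro t ht
  refine lt_of_le_of_ne (h t ht) fun h0 => ?_
  have htb : t ∈ Ioo 0 A.b := ⟨hr.1.trans_lt ht.1, ht.2.trans_lt A.one_lt⟩
  have hs : A.s ≠ 0 := by rcases A.sign with h | h <;> simp [h]
  have hz : cross (A.v t) (A.g t - A.g r) = 0 := by
    rw [cross_swap]
    rcases mul_eq_zero.1 h0.symm with h | h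
    · exact absurd h hs
    · simp [h]
  obtain ⟨c, hc⟩ := eq_of_cross_eq_zero (A.v_ne_zero htb) hz
  have hc0 : c ≠ 0 := by
    rintro rfl
    have : A.g t = A.g r := by simpa [sub_eq_zero] using hc
    have := A.inj ⟨hr.1.trans ht.1.le, ht.2⟩ ⟨hr.1, hr.2.le⟩ this
    exact ht.1.ne' this
  have hd := A.hasDerivAt_secant r htb
  rw [hc, cross_real_mul_left, mul_left_comm] at hd
  have hκ := A.curv t htb
  rcases lt_or_gt_of_ne hc0 with hneg | hpos
  · rcases ht.2.eq_or_lt with rfl | ht1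
    · exact absurd (A.inner_end hr hc) (not_lt.2 hneg.le)
    · have h1 := hd.eventually_neg_right h0.symm (mul_neg_of_neg_of_pos hneg hκ)
      have h2 : ∀ᶠ u in 𝓝[>] t, u ∈ Ioo t 1 := Ioo_mem_nhdsGT ht1
      obtain ⟨u, hu, hu'⟩ := (h1.and h2).exists
      exact absurd (h u ⟨ht.1.trans hu'.1, hu'.2.le⟩) (not_le.2 hu)
  · have h1 := hd.eventually_neg_left h0.symm (mul_pos hpos hκ)
    have h2 : ∀ᶠ u in 𝓝[<] t, u ∈ Ioo r t := Ioo_mem_nhdsLT ht.1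
    obtain ⟨u, hu, hu'⟩ := (h1.and h2).exists
    exact absurd (h u ⟨hu'.1, hu'.2.le.trans ht.2⟩) (not_le.2 hu)

/-- The part of a spiral that precedes a point lies strictly on one side of its tangent line
there. -/
theorem secant_pos {r t : ℝ} (hr : 0 ≤ r) (hrt : r < t) (ht : t ≤ 1) :
    0 < A.s * cross (A.g t - A.g r) (A.v t) := by
  -- The set of good earlier parameters contains a left neighbourhood of 1 and is open and closed in
  -- (0, 1), hence all of it; the parameter 0 is then reached as a limit.
  set G : Set ℝ := {r | ∀ t ∈ Ioc r 1, 0 < A.s * cross (A.g t - A.g r) (A.v t)} with hG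
  -- limits
  have hlim : ∀ r ∈ Ico (0 : ℝ) 1, (∃ᶠ r' in 𝓝[Icc 0 1] r, r' ∈ G) → r ∈ G := by
    intro r hr hfreq
    apply A.secant_pos_of_nonneg hr
    intro t ht
    by_contra! hneg
    have hc : ContinuousWithinAt (fun r' => A.s * cross (A.g t - A.g r') (A.v t)) (Icc 0 1) r := by
      have : ContinuousOn (fun r' => A.s * cross (A.g t - A.g r') (A.v t)) (Icc 0 1) := by
        have := A.cont
        fun_prop
      exact this r ⟨hr.1, hr.2.le⟩
    have h1 := hc.eventually (gt_mem_nhds hneg)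
    have h2 : ∀ᶠ r' in 𝓝[Icc 0 1] r, r' < t := mem_nhdsWithin_of_mem_nhds (gt_mem_nhds ht.1)
    obtain ⟨r', hr', h3, h4⟩ := (hfreq.and_eventually (h1.and h2)).exists
    exact absurd (hr' t ⟨h4, ht.2⟩) (not_lt.2 h3.le)
  -- openness
  have hopen : ∀ r ∈ Ioo (0 : ℝ) 1, r ∈ G → ∀ᶠ r' in 𝓝 r, r' ∈ G := by
    intro r hr hrG
    obtain ⟨δ, hδ, H⟩ := A.secant_near (A.mem_of_Ioo hr)
    -- Strict positivity degenerates at t = r. Close to this diagonal `secant_near` applies, and the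
    -- other parameters t form a compact set on which positivity is stable.
    set K : Set ℝ := Icc (r + δ / 2) 1
    have hKc : IsCompact K := isCompact_Icc
    have hKs : K ⊆ Ioo 0 A.b := fun x hx =>
      ⟨by linarith [hr.1, hx.1], hx.2.trans_lt A.one_lt⟩
    have hfar : ∀ᶠ r' in 𝓝 r, ∀ t ∈ K, 0 < A.s * cross (A.g t - A.g r') (A.v t) := by
      apply hKc.eventually_forall_of_forall_eventually
      intro t ht
      have hpos := hrG t ⟨by linarith [ht.1], ht.2⟩
      have hgr : ContinuousAt A.g r := (A.hasDerivAt r (A.mem_of_Ioo hr)).continuousAt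
      have hgt : ContinuousAt A.g t := (A.hasDerivAt t (hKs ht)).continuousAt
      have hvt : ContinuousAt A.v t := (A.hasDerivAt_v t (hKs ht)).continuousAt
      have h1 : ContinuousAt (fun p : ℝ × ℝ => A.g p.1) (r, t) :=
        ContinuousAt.comp (f := Prod.fst) (x := (r, t)) hgr continuousAt_fst
      have h2 : ContinuousAt (fun p : ℝ × ℝ => A.g p.2) (r, t) :=
        ContinuousAt.comp (f := Prod.snd) (x := (r, t)) hgt continuousAt_snd
      have h3 : ContinuousAt (fun p : ℝ × ℝ => A.v p.2) (r, t) :=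
        ContinuousAt.comp (f := Prod.snd) (x := (r, t)) hvt continuousAt_snd
      have hc : ContinuousAt (fun p : ℝ × ℝ => A.s * cross (A.g p.2 - A.g p.1) (A.v p.2))
          (r, t) := continuousAt_const.mul ((h2.sub h1).cross h3)
      have := hc.eventually (lt_mem_nhds hpos)
      exact this
    have hnear : ∀ᶠ r' in 𝓝 r, |r' - r| < δ := by
      have := Metric.ball_mem_nhds r hδ
      filter_upwards [this] with x hx using hx
    filter_upwards [hfar, hnear] with r' h1 h2 t ht
    by_cases htK : t ∈ K
    · exact h1 t htK
    · have : t < r + δ / 2 := by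
        by_contra! h
        exact htK ⟨h, ht.2⟩
      refine H r' t h2 ?_ ht.1
      rw [abs_lt] at *
      constructor <;> linarith [ht.1]
  -- start
  obtain ⟨δ, hδ, H⟩ := A.secant_near (t₀ := 1) ⟨one_pos, A.one_lt⟩
  have hstart : ∀ r ∈ Ioo (max 0 (1 - δ)) 1, r ∈ G := by
    intro r hr t ht
    have h1 : 1 - δ < r := (le_max_right _ _).trans_lt hr.1
    have h2 : r < 1 := hr.2
    refine H r t ?_ ?_ ht.1 <;> rw [abs_lt] <;> constructor <;> linarith [ht.1, ht.2]
  have hIoo : Ioo (0 : ℝ) 1 ⊆ G := by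
    have hpre : IsPreconnected (Ioo (0 : ℝ) 1) := isPreconnected_Ioo
    set u : Set ℝ := interior G
    have huo : IsOpen u := isOpen_interior
    have hsub : Ioo (0 : ℝ) 1 ∩ G ⊆ u := fun r hr => mem_interior_iff_mem_nhds.2 (hopen r hr.1 hr.2)
    have : Ioo (0 : ℝ) 1 ⊆ u := by
      apply hpre.subset_of_closure_inter_subset huo
      · have hm : max 0 (1 - δ) < 1 := max_lt one_pos (by linarith)
        obtain ⟨x, hx⟩ := exists_between hm
        have hx0 : x ∈ Ioo (0 : ℝ) 1 := ⟨(le_max_left _ _).trans_lt hx.1, hx.2⟩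
        exact ⟨x, hx0, hsub ⟨hx0, hstart x hx⟩⟩
      · rintro r ⟨hr1, hr2⟩
        apply hsub
        refine ⟨hr2, hlim r ⟨hr2.1.le, hr2.2⟩ ?_⟩
        have : ∃ᶠ x in 𝓝 r, x ∈ u := mem_closure_iff_frequently.1 hr1
        have h3 : 𝓝[Icc 0 1] r = 𝓝 r := nhdsWithin_eq_nhds.2 (Icc_mem_nhds hr2.1 hr2.2)
        rw [h3]
        exact this.mono fun x hx => interior_subset hx
    exact this.trans interior_subset
  have hmem : r ∈ G := by
    rcases hr.eq_or_lt with rfl | hr0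
    · apply hlim 0 ⟨le_rfl, one_pos⟩
      have h0 : ∀ᶠ x in 𝓝[>] (0 : ℝ), x ∈ Ioo (0 : ℝ) 1 := Ioo_mem_nhdsGT one_pos
      have h1 : ∃ᶠ x : ℝ in 𝓝[>] 0, x ∈ Ioo (0 : ℝ) 1 := h0.frequently
      have h2 : ∃ᶠ x : ℝ in 𝓝[Ioo 0 1] 0, x ∈ G := by
        rw [nhdsWithin_Ioo_eq_nhdsGT one_pos]
        exact h1.mono fun x hx => hIoo hx
      exact h2.filter_mono (nhdsWithin_mono _ Ioo_subset_Icc_self)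
    · exact hIoo ⟨hr0, hrt.trans_le ht⟩
  exact hmem t ⟨hrt, ht⟩

/-- The polar angle of a spiral about its vortex is strictly monotone. -/
theorem cross_pos {t : ℝ} (ht : t ∈ Ioc (0 : ℝ) 1) : 0 < A.s * cross (A.g t) (A.v t) := by
  simpa [A.zero] using A.secant_pos le_rfl ht.1 ht.2

end Arm

/-! ### Components of the complement and the sides of the arms. -/

/-- `U` is a connected component of `Ω`. -/
structure IsComp (Ω U : Set ℂ) : Prop where
  nonempty : U.Nonempty
  preconn : IsPreconnected U
  sub : U ⊆ Ω
  maximal : ∀ C, IsPreconnected C → C ⊆ Ω → (C ∩ U).Nonempty → C ⊆ U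

lemma IsComp.eq {Ω U V : Set ℂ} (hU : IsComp Ω U) (hV : IsComp Ω V) (h : (U ∩ V).Nonempty) :
    U = V :=
  (hV.maximal U hU.preconn hU.sub h).antisymm
    (hU.maximal V hV.preconn hV.sub (by rwa [inter_comm]))

lemma isComp_connectedComponentIn {Ω : Set ℂ} {x : ℂ} (hx : x ∈ Ω) :
    IsComp Ω (connectedComponentIn Ω x) where
  nonempty := ⟨x, mem_connectedComponentIn hx⟩
  preconn := isPreconnected_connectedComponentIn
  sub := connectedComponentIn_subset _ _
  maximal := by
    rintro C hC hCΩ ⟨y, hyC, hyU⟩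
    rw [connectedComponentIn_eq hyU]
    exact hC.subset_connectedComponentIn hyC hCΩ

lemma cross_I_mul (z v : ℂ) : cross z (Complex.I * v) = z.re * v.re + z.im * v.im := by
  simp [cross]

lemma cross_I_mul_self (v : ℂ) : cross v (Complex.I * v) = ‖v‖ ^ 2 := by
  rw [cross_I_mul, Complex.sq_norm, Complex.normSq_apply]

namespace Arm
variable {R : ℝ}

/-- The complement of two spirals in the ball. -/
def region (A B : Arm R) : Set ℂ :=
  Metric.closedBall 0 R \ (A.g '' Icc 0 1 ∪ B.g '' Icc 0 1)

lemma region_comm (A B : Arm R) : region A B = region B A := by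
  unfold region; rw [union_comm]

/-- The points that are reached from the arm near `g t` by vectors on the side `σ` of the
tangent line, within a cone of aperture determined by `c`. -/
def sideSet (A : Arm R) (t σ c ε : ℝ) : Set ℂ :=
  {z | ∃ t' w, |t' - t| < ε ∧ ‖w‖ < ε ∧ c * ‖w‖ < σ * cross (A.v t) w ∧ z = A.g t' + w}

/-- The set `U` contains the side `σ` of the arm near `g t`. -/
def SideIn (A : Arm R) (σ t : ℝ) (U : Set ℂ) : Prop :=
  ∀ c > 0, ∃ ε > 0, A.sideSet t σ c ε ⊆ U

lemma sideSet_mono (A : Arm R) {t σ c c' ε ε' : ℝ} (hc : c' ≤ c) (hε : ε ≤ ε') :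
    A.sideSet t σ c ε ⊆ A.sideSet t σ c' ε' := by
  rintro z ⟨t', w, h1, h2, h3, rfl⟩
  exact ⟨t', w, h1.trans_le hε, h2.trans_le hε,
    (mul_le_mul_of_nonneg_right hc (norm_nonneg _)).trans_lt h3, rfl⟩

lemma isCompact_image (A : Arm R) {K : Set ℝ} (hK : IsCompact K) (hs : K ⊆ Icc 0 1) :
    IsCompact (A.g '' K) := hK.image_of_continuousOn (A.cont.mono hs)

lemma isClosed_image (A : Arm R) : IsClosed (A.g '' Icc 0 1) :=
  (A.isCompact_image isCompact_Icc le_rfl).isClosed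

/-- The arms only meet at the vortex. -/
def Apart (A B : Arm R) : Prop := A.g '' Icc 0 1 ∩ B.g '' Icc 0 1 = {0}

lemma Apart.symm {A B : Arm R} (h : Apart A B) : Apart B A := by
  unfold Apart at *; rw [inter_comm]; exact h

lemma Apart.ne {A B : Arm R} (h : Apart A B) {t t' : ℝ} (ht : t ∈ Ioc (0 : ℝ) 1)
    (ht' : t' ∈ Icc (0 : ℝ) 1) : A.g t ≠ B.g t' := by
  intro he
  have : A.g t ∈ ({0} : Set ℂ) := by
    rw [← h]; exact ⟨⟨t, ⟨ht.1.le, ht.2⟩, rfl⟩, ⟨t', ht', he.symm⟩⟩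
  exact A.g_ne_zero ht this

/-- Short chords of the arm near `g t` are almost parallel to `v t` by strict differentiability, so
a vector w in the cone is never such a chord and `g t' + w` is off this part of the arm. The rest of
the arm, the other arm and the boundary circle are at a positive distance. The set is connected as
the image of an interval times a convex cone. -/
lemma exists_sideSet_subset_region {A B : Arm R} (h : Apart A B) {t : ℝ} (ht : t ∈ Ioo (0 : ℝ) 1) {c : ℝ}
    (hc : 0 < c) : ∃ ε > 0, ∀ σ : ℝ, (σ = 1 ∨ σ = -1) → A.sideSet t σ c ε ⊆ region A B ∧
      IsPreconnected (A.sideSet t σ c ε) := by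
  have htb := A.mem_of_Ioo ht
  have hv : 0 < ‖A.v t‖ := norm_pos_iff.2 (A.v_ne_zero htb)
  have hstrict : HasStrictDerivAt A.g (A.v t) t := by
    apply hasStrictDerivAt_of_hasDerivAt_of_continuousAt
      (f' := A.v) _ (A.hasDerivAt_v t htb).continuousAt
    filter_upwards [Ioo_mem_nhds htb.1 htb.2] with x hx using A.hasDerivAt x hx
  -- If w = g x - g t', the first bound gives ‖w‖ ≥ ‖v‖ |x - t'| / 2 and the second |cross v w| ≤
  -- ‖v‖ c |x - t'| / 2, which contradicts c ‖w‖ < σ * cross v w.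
  set η := min (‖A.v t‖ / 2) (c / 2) with hη
  have hη0 : 0 < η := by positivity
  have hlo := hstrict.isLittleO.def hη0
  rw [nhds_prod_eq] at hlo
  obtain ⟨ε₀, hε₀, H₀⟩ : ∃ ε₀ > 0, ∀ x y, |x - t| < ε₀ → |y - t| < ε₀ →
      ‖A.g x - A.g y - (x - y : ℝ) * A.v t‖ ≤ η * |x - y| := by
    rw [← nhds_prod_eq] at hlo
    obtain ⟨ε₀, hε₀, H⟩ := Metric.eventually_nhds_iff.1 hlo
    refine ⟨ε₀, hε₀, fun x y hx hy => ?_⟩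
    have := H (y := (x, y)) (by simp [Prod.dist_eq, Real.dist_eq, hx, hy])
    simpa using this
  set F : Set ℂ := A.g '' (Icc 0 1 \ Metric.ball t ε₀) ∪ B.g '' Icc 0 1 with hF
  have hFc : IsClosed F := by
    apply IsClosed.union _ B.isClosed_image
    exact (A.isCompact_image (isCompact_Icc.diff Metric.isOpen_ball) sdiff_subset).isClosed
  have hgF : A.g t ∉ F := by
    rintro (⟨x, hx, hxe⟩ | ⟨x, hx, hxe⟩)
    · have := A.inj hx.1 ⟨ht.1.le, ht.2.le⟩ hxe
      subst this
      exact hx.2 (Metric.mem_ball_self hε₀)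
    · exact h.ne ⟨ht.1, ht.2.le⟩ hx hxe.symm
  have hnb : Fᶜ ∩ Metric.ball 0 R ∈ 𝓝 (A.g t) :=
    inter_mem (hFc.isOpen_compl.mem_nhds hgF)
      (Metric.isOpen_ball.mem_nhds (by simpa using A.norm_lt t ⟨ht.1.le, ht.2⟩))
  obtain ⟨ρ, hρ, Hρ⟩ := Metric.mem_nhds_iff.1 hnb
  have hcont : ContinuousAt A.g t := (A.hasDerivAt t htb).continuousAt
  obtain ⟨ε₁, hε₁, H₁⟩ := Metric.continuousAt_iff.1 hcont (ρ / 2) (by positivity)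
  obtain ⟨ε₂, hε₂, H₂⟩ := Metric.mem_nhds_iff.1 (Ioo_mem_nhds ht.1 ht.2)
  set ε := min (min ε₀ ε₁) (min ε₂ (ρ / 2)) with hε
  have hle0 : ε ≤ ε₀ := (min_le_left _ _).trans (min_le_left _ _)
  have hle1 : ε ≤ ε₁ := (min_le_left _ _).trans (min_le_right _ _)
  have hle2 : ε ≤ ε₂ := (min_le_right _ _).trans (min_le_left _ _)
  have hle3 : ε ≤ ρ / 2 := (min_le_right _ _).trans (min_le_right _ _)
  refine ⟨ε, by positivity, fun σ hσ => ⟨?_, ?_⟩⟩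
  · rintro z ⟨t', w, ht', hw, hcw, rfl⟩
    have hd : dist (A.g t') (A.g t) < ρ / 2 := H₁ (by rw [Real.dist_eq]; linarith)
    have hball : A.g t' + w ∈ Metric.ball (A.g t) ρ := by
      rw [Metric.mem_ball, dist_eq_norm]
      rw [dist_eq_norm] at hd
      calc ‖A.g t' + w - A.g t‖ = ‖(A.g t' - A.g t) + w‖ := by ring_nf
        _ ≤ ‖A.g t' - A.g t‖ + ‖w‖ := norm_add_le _ _
        _ < ρ := by linarith
    obtain ⟨hnF, hR⟩ := Hρ hball
    refine ⟨Metric.ball_subset_closedBall hR, ?_⟩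
    rintro (⟨x, hx, hxe⟩ | hB)
    · by_cases hxb : x ∈ Metric.ball t ε₀
      · have key := H₀ x t' (by simpa [Real.dist_eq] using hxb) (ht'.trans_le hle0)
        have e : A.g x - A.g t' = w := by rw [hxe]; ring
        rw [e] at key
        have h1 : σ * cross (A.v t) w ≤ ‖A.v t‖ * (η * |x - t'|) := by
          have e2 : cross (A.v t) w = cross (A.v t) (w - (x - t' : ℝ) * A.v t) := by
            rw [cross_sub_right, cross_real_mul_right, cross_self_eq_zero]; ring
          have h3 : σ * cross (A.v t) w ≤ |cross (A.v t) w| := by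
            rcases hσ with rfl | rfl
            · rw [one_mul]; exact le_abs_self _
            · rw [neg_one_mul]; exact neg_le_abs _
          refine h3.trans ?_
          rw [e2]
          exact (abs_cross_le _ _).trans (mul_le_mul_of_nonneg_left key hv.le)
        have h2 : ‖A.v t‖ / 2 * |x - t'| ≤ ‖w‖ := by
          have h4 : ‖((x - t' : ℝ) : ℂ) * A.v t‖ = |x - t'| * ‖A.v t‖ := by
            rw [norm_mul, Complex.norm_real, Real.norm_eq_abs]
          have h5 : ‖((x - t' : ℝ) : ℂ) * A.v t‖ ≤ ‖w‖ + ‖w - (x - t' : ℝ) * A.v t‖ := by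
            calc _ = ‖w - (w - (x - t' : ℝ) * A.v t)‖ := by rw [sub_sub_cancel]
              _ ≤ _ := norm_sub_le _ _
          have h6 : η * |x - t'| ≤ ‖A.v t‖ / 2 * |x - t'| :=
            mul_le_mul_of_nonneg_right (min_le_left _ _) (abs_nonneg _)
          nlinarith
        have h7 : η * |x - t'| ≤ c / 2 * |x - t'| :=
            mul_le_mul_of_nonneg_right (min_le_right _ _) (abs_nonneg _)
        have h8 := mul_le_mul_of_nonneg_left h7 hv.le
        have h9 := mul_le_mul_of_nonneg_left h2 hc.le
        nlinarith
      · exact hnF (Or.inl ⟨x, ⟨hx, hxb⟩, hxe⟩)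
    · exact hnF (Or.inr hB)
  · set W : Set ℂ := {w | ‖w‖ < ε ∧ c * ‖w‖ < σ * cross (A.v t) w}
    have hW : Convex ℝ W := by
      rintro x ⟨hx1, hx2⟩ y ⟨hy1, hy2⟩ p q hp hq hpq
      have hn : ‖p • x + q • y‖ ≤ p * ‖x‖ + q * ‖y‖ := by
        refine (norm_add_le _ _).trans (le_of_eq ?_)
        rw [norm_smul, norm_smul, Real.norm_of_nonneg hp, Real.norm_of_nonneg hq]
      have hl : cross (A.v t) (p • x + q • y) = p * cross (A.v t) x + q * cross (A.v t) y := by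
        rw [Complex.real_smul, Complex.real_smul, cross_add_right, cross_real_mul_right,
          cross_real_mul_right]
      have hstr : ∀ {a b a' b' : ℝ}, a < a' → b < b' → p * a + q * b < p * a' + q * b' := by
        intro a b a' b' h1 h2
        rcases hp.eq_or_lt with rfl | hp
        · have : q = 1 := by linarith
          subst this; linarith
        · have := mul_lt_mul_of_pos_left h1 hp
          have := mul_le_mul_of_nonneg_left h2.le hq
          linarith
      refine ⟨hn.trans_lt ?_, ?_⟩
      · have := hstr hx1 hy1
        rw [← add_mul, hpq, one_mul] at this
        exact this
      · rw [hl]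
        have := hstr hx2 hy2
        have h3 := mul_le_mul_of_nonneg_left hn hc.le
        nlinarith
    have heq : A.sideSet t σ c ε = (fun p : ℝ × ℂ => A.g p.1 + p.2) ''
        (Metric.ball t ε ×ˢ W) := by
      ext z
      constructor
      · rintro ⟨t', w, h1, h2, h3, rfl⟩
        exact ⟨(t', w), ⟨by simpa [Real.dist_eq] using h1, h2, h3⟩, rfl⟩
      · rintro ⟨⟨t', w⟩, ⟨h1, h2, h3⟩, rfl⟩
        exact ⟨t', w, by simpa [Real.dist_eq] using h1, h2, h3, rfl⟩
    rw [heq]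
    apply IsPreconnected.image
    · exact ((convex_ball t ε).prod hW).isPreconnected
    · have : ContinuousOn (fun p : ℝ × ℂ => A.g p.1) (Metric.ball t ε ×ˢ W) := by
        apply A.continuousOn_g.comp continuousOn_fst
        rintro ⟨x, y⟩ ⟨hx, -⟩
        exact A.mem_of_Ioo (H₂ (Metric.ball_subset_ball hle2 hx))
      exact this.add continuousOn_snd

lemma sideSet_mem_eventually (A : Arm R) {t t' σ c ε : ℝ} {w : ℂ} (ht' : |t' - t| < ε)
    (hw : c * ‖w‖ < σ * cross (A.v t) w) :
    ∀ᶠ r : ℝ in 𝓝[>] 0, A.g t' + r * w ∈ A.sideSet t σ c ε := by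
  have hε : 0 < ε := (abs_nonneg _).trans_lt ht'
  have h1 : ∀ᶠ r : ℝ in 𝓝[>] 0, ‖(r : ℂ) * w‖ < ε := by
    have : Tendsto (fun r : ℝ => ‖(r : ℂ) * w‖) (𝓝 0) (𝓝 0) := by
      have : Continuous fun r : ℝ => ‖(r : ℂ) * w‖ := by fun_prop
      simpa using this.tendsto 0
    exact (this.mono_left nhdsWithin_le_nhds).eventually (gt_mem_nhds hε)
  filter_upwards [h1, self_mem_nhdsWithin] with r hr hr0
  refine ⟨t', r * w, ht', hr, ?_, rfl⟩
  have : (0 : ℝ) < r := hr0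
  rw [cross_real_mul_right, norm_mul, Complex.norm_real, Real.norm_of_nonneg this.le]
  nlinarith

lemma SideIn.eventually_mem {A : Arm R} {t σ : ℝ} {U : Set ℂ} (h : A.SideIn σ t U) {w : ℂ}
    (hw : 0 < σ * cross (A.v t) w) : ∀ᶠ r : ℝ in 𝓝[>] 0, A.g t + r * w ∈ U := by
  obtain ⟨ε, hε, H⟩ := h (σ * cross (A.v t) w / (‖w‖ + 1)) (by positivity)
  refine (A.sideSet_mem_eventually (t' := t) (by simpa using hε) ?_).mono fun r hr => H hr
  rw [div_mul_eq_mul_div, div_lt_iff₀ (by positivity)]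
  nlinarith [norm_nonneg w]

lemma SideIn.mem_closure {A : Arm R} {t σ : ℝ} {U : Set ℂ} (h : A.SideIn σ t U)
    (hσ : σ = 1 ∨ σ = -1) (ht : t ∈ Ioo (0 : ℝ) 1) : A.g t ∈ closure U := by
  have hv := A.v_ne_zero (A.mem_of_Ioo ht)
  have hw : 0 < σ * cross (A.v t) (σ * (Complex.I * A.v t)) := by
    rw [cross_real_mul_right, cross_I_mul_self]
    have : 0 < ‖A.v t‖ := norm_pos_iff.2 hv
    rcases hσ with rfl | rfl <;> simp <;> positivity
  have := h.eventually_mem hw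
  have hc : Tendsto (fun r : ℝ => A.g t + r * (σ * (Complex.I * A.v t))) (𝓝[>] 0)
      (𝓝 (A.g t)) := by
    have : Continuous fun r : ℝ => A.g t + r * (σ * (Complex.I * A.v t)) := by fun_prop
    have := this.tendsto 0
    simp only [Complex.ofReal_zero, zero_mul, add_zero] at this
    exact this.mono_left nhdsWithin_le_nhds
  exact mem_closure_of_tendsto hc this

/-- A cone that is wide enough to contain w yields a connected subset of the region. A single point
of U on it puts all of it into the component U. -/
lemma sideIn_of_frequently {A B : Arm R} (hAB : Apart A B) {U : Set ℂ}
    (hU : IsComp (region A B) U) {t σ : ℝ} (hσ : σ = 1 ∨ σ = -1) (ht : t ∈ Ioo (0 : ℝ) 1) {w : ℂ}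
    (hw : 0 < σ * cross (A.v t) w) (hf : ∃ᶠ r : ℝ in 𝓝[>] 0, A.g t + r * w ∈ U) :
    A.SideIn σ t U := by
  intro c hc
  set c' := min c (σ * cross (A.v t) w / (‖w‖ + 1))
  obtain ⟨ε, hε, H⟩ := exists_sideSet_subset_region hAB ht (c := c') (by positivity)
  obtain ⟨H1, H2⟩ := H σ hσ
  refine ⟨ε, hε, (A.sideSet_mono (min_le_left _ _) le_rfl).trans (hU.maximal _ H2 H1 ?_)⟩
  have hcw : c' * ‖w‖ < σ * cross (A.v t) w := by
    refine (mul_le_mul_of_nonneg_right (min_le_right _ _) (norm_nonneg _)).trans_lt ?_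
    rw [div_mul_eq_mul_div, div_lt_iff₀ (by positivity)]
    nlinarith [norm_nonneg w]
  obtain ⟨r, hr1, hr2⟩ := (hf.and_eventually
    (A.sideSet_mem_eventually (t' := t) (by simpa using hε) hcw)).exists
  exact ⟨_, hr2, hr1⟩

/-- One fixed vector, the normal at t, points to the side σ at all nearby parameters, so the
connected set at t links the cones at t and t'. -/
lemma sideIn_local {A B : Arm R} (hAB : Apart A B) {U : Set ℂ}
    (hU : IsComp (region A B) U) {t σ : ℝ} (hσ : σ = 1 ∨ σ = -1) (ht : t ∈ Ioo (0 : ℝ) 1) :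
    ∀ᶠ t' in 𝓝 t, (A.SideIn σ t U ↔ A.SideIn σ t' U) := by
  have htb := A.mem_of_Ioo ht
  have hv : 0 < ‖A.v t‖ := norm_pos_iff.2 (A.v_ne_zero htb)
  set w : ℂ := σ * (Complex.I * A.v t) with hw
  have hσσ : σ * σ = 1 := by rcases hσ with rfl | rfl <;> simp
  have hcw : ∀ z, σ * cross z w = cross z (Complex.I * A.v t) := fun z => by
    rw [hw, cross_real_mul_right, ← mul_assoc, hσσ, one_mul]
  have hwn : ‖w‖ = ‖A.v t‖ := by
    rw [hw, norm_mul, norm_mul, Complex.norm_I, one_mul, Complex.norm_real, Real.norm_eq_abs]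
    rcases hσ with rfl | rfl <;> simp
  obtain ⟨ε, hε, H⟩ := exists_sideSet_subset_region hAB ht (c := ‖A.v t‖ / 2) (by positivity)
  obtain ⟨H1, H2⟩ := H σ hσ
  have hwt : ‖A.v t‖ / 2 * ‖w‖ < σ * cross (A.v t) w := by
    rw [hcw, cross_I_mul_self, hwn]; nlinarith
  have hcont : ContinuousAt (fun t' => cross (A.v t') (Complex.I * A.v t)) t := by
    have := (A.hasDerivAt_v t htb).continuousAt
    fun_prop
  have hpos : 0 < cross (A.v t) (Complex.I * A.v t) := by rw [cross_I_mul_self]; positivity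
  filter_upwards [hcont.eventually (lt_mem_nhds hpos), Ioo_mem_nhds ht.1 ht.2,
    Metric.ball_mem_nhds t hε] with t' h1 h2 h3
  have h1' : 0 < σ * cross (A.v t') w := by rw [hcw]; exact h1
  have hin : ∀ᶠ r : ℝ in 𝓝[>] 0, A.g t' + r * w ∈ A.sideSet t σ (‖A.v t‖ / 2) ε :=
    A.sideSet_mem_eventually (by simpa [Real.dist_eq] using h3) hwt
  constructor
  · intro hs
    apply sideIn_of_frequently hAB hU hσ h2 h1'
    have hsub : A.sideSet t σ (‖A.v t‖ / 2) ε ⊆ U := by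
      apply hU.maximal _ H2 H1
      have e1 := hs.eventually_mem (w := w) (by rw [hcw]; exact hpos)
      obtain ⟨r, hr1, hr2⟩ := (e1.and (A.sideSet_mem_eventually (σ := σ) (t' := t) (by simpa using hε) hwt)).exists
      exact ⟨_, hr2, hr1⟩
    exact (hin.mono fun r hr => hsub hr).frequently
  · intro hs
    apply sideIn_of_frequently hAB hU hσ ht (w := w) (by rw [hcw]; exact hpos)
    have hsub : A.sideSet t σ (‖A.v t‖ / 2) ε ⊆ U := by
      apply hU.maximal _ H2 H1
      obtain ⟨r, hr1, hr2⟩ := ((hs.eventually_mem h1').and hin).exists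
      exact ⟨_, hr2, hr1⟩
    exact ((A.sideSet_mem_eventually (σ := σ) (t' := t) (by simpa using hε) hwt).mono fun r hr => hsub hr).frequently

lemma SideIn.const {A B : Arm R} (hAB : Apart A B) {U : Set ℂ} (hU : IsComp (region A B) U)
    {t t' σ : ℝ} (hσ : σ = 1 ∨ σ = -1) (ht : t ∈ Ioo (0 : ℝ) 1) (ht' : t' ∈ Ioo (0 : ℝ) 1)
    (h : A.SideIn σ t U) : A.SideIn σ t' U := by
  set G : Set ℝ := {x | A.SideIn σ x U}
  have hsub : Ioo (0 : ℝ) 1 ∩ G ⊆ interior G := fun x hx =>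
    mem_interior_iff_mem_nhds.2 ((sideIn_local hAB hU hσ hx.1).mono fun y hy => hy.1 hx.2)
  have : Ioo (0 : ℝ) 1 ⊆ interior G := by
    apply isPreconnected_Ioo.subset_of_closure_inter_subset isOpen_interior
    · exact ⟨t, ht, hsub ⟨ht, h⟩⟩
    · rintro x ⟨hx1, hx2⟩
      apply hsub
      refine ⟨hx2, ?_⟩
      have h1 := mem_closure_iff_frequently.1 hx1
      obtain ⟨y, hy1, hy2⟩ := (h1.and_eventually (sideIn_local hAB hU hσ hx2)).exists
      exact hy2.2 (interior_subset hy1)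
  exact interior_subset (this ht')

/-- A point z of U close to `g t` is projected onto the arm along the normal at t: by the
intermediate value theorem z = g x + c * (I * v t) for some x near t. Since z is off the arm, c ≠ 0,
and the sign of c is the side. -/
lemma sideIn_of_mem_closure {A B : Arm R} (hAB : Apart A B) {U : Set ℂ}
    (hU : IsComp (region A B) U) {t : ℝ} (ht : t ∈ Ioo (0 : ℝ) 1) (h : A.g t ∈ closure U) :
    ∃ σ : ℝ, (σ = 1 ∨ σ = -1) ∧ A.SideIn σ t U := by
  have htb := A.mem_of_Ioo ht
  have hv : 0 < ‖A.v t‖ := norm_pos_iff.2 (A.v_ne_zero htb)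
  obtain ⟨ε, hε, H⟩ := exists_sideSet_subset_region hAB ht (c := ‖A.v t‖ / 2) (by positivity)
  have hcont : ContinuousAt (fun t' => cross (A.v t') (Complex.I * A.v t)) t := by
    have := (A.hasDerivAt_v t htb).continuousAt
    fun_prop
  have hpos : 0 < cross (A.v t) (Complex.I * A.v t) := by rw [cross_I_mul_self]; positivity
  have hgc : ContinuousAt A.g t := (A.hasDerivAt t htb).continuousAt
  have hev : ∀ᶠ x in 𝓝 t, 0 < cross (A.v x) (Complex.I * A.v t) ∧ x ∈ Ioo (0 : ℝ) 1 ∧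
      |x - t| < ε ∧ dist (A.g x) (A.g t) < ε / 2 := by
    filter_upwards [hcont.eventually (lt_mem_nhds hpos), Ioo_mem_nhds ht.1 ht.2,
      Metric.ball_mem_nhds t hε, hgc (Metric.ball_mem_nhds _ (half_pos hε))] with x h1 h2 h3 h4
    exact ⟨h1, h2, by simpa [Real.dist_eq] using h3, h4⟩
  obtain ⟨δ, hδ, Hδ⟩ := Metric.eventually_nhds_iff.1 hev
  set l := t - δ / 2 with hl
  set r := t + δ / 2 with hr
  have hmem : ∀ x ∈ Icc l r, 0 < cross (A.v x) (Complex.I * A.v t) ∧ x ∈ Ioo (0 : ℝ) 1 ∧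
      |x - t| < ε ∧ dist (A.g x) (A.g t) < ε / 2 := by
    intro x hx
    apply Hδ
    rw [Real.dist_eq, abs_lt]
    constructor <;> linarith [hx.1, hx.2]
  have hmono : ∀ x y, l ≤ x → x < y → y ≤ r →
      cross (A.g x) (Complex.I * A.v t) < cross (A.g y) (Complex.I * A.v t) := by
    intro x y hx hxy hy
    refine lt_of_hasDerivAt_pos (f := fun x => cross (A.g x) (Complex.I * A.v t))
      (f' := fun x => cross (A.v x) (Complex.I * A.v t)) hxy ?_ ?_ ?_
    · have : ContinuousOn A.g (Icc x y) := A.cont.mono fun z hz =>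
        Ioo_subset_Icc_self (hmem z ⟨hx.trans hz.1, hz.2.trans hy⟩).2.1
      fun_prop
    · intro z hz
      exact (A.hasDerivAt z (A.mem_of_Ioo
        (hmem z ⟨hx.trans hz.1.le, hz.2.le.trans hy⟩).2.1)).cross_const _
    · intro z hz
      exact (hmem z ⟨hx.trans hz.1.le, hz.2.le.trans hy⟩).1
  have h1 := hmono l t le_rfl (by linarith) (by linarith)
  have h2 := hmono t r (by linarith) (by linarith) le_rfl
  have hzc : ContinuousAt (fun z : ℂ => cross z (Complex.I * A.v t)) (A.g t) := by fun_prop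
  have hfz : ∃ᶠ z in 𝓝 (A.g t), z ∈ U := mem_closure_iff_frequently.1 h
  obtain ⟨z, hzU, hz1, hz2, hz3⟩ := (hfz.and_eventually ((hzc.eventually (lt_mem_nhds h1)).and
    ((hzc.eventually (gt_mem_nhds h2)).and
      (Metric.ball_mem_nhds (A.g t) (half_pos hε))))).exists
  have hgcont : ContinuousOn (fun x => cross (A.g x) (Complex.I * A.v t)) (Icc l r) := by
    have : ContinuousOn A.g (Icc l r) := A.cont.mono fun z hz =>
        Ioo_subset_Icc_self (hmem z hz).2.1
    fun_prop
  obtain ⟨x, hx, hxe⟩ := intermediate_value_Icc (by linarith : l ≤ r) hgcont ⟨hz1.le, hz2.le⟩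
  obtain ⟨-, hx01, hxt, hxd⟩ := hmem x hx
  have hne : Complex.I * A.v t ≠ 0 := mul_ne_zero Complex.I_ne_zero (norm_pos_iff.1 hv)
  obtain ⟨c, hc⟩ := eq_of_cross_eq_zero (z := z - A.g x) hne (by
    simp only at hxe
    rw [cross_swap, cross_sub_left, hxe]; simp)
  have hc0 : c ≠ 0 := by
    rintro rfl
    have : z = A.g x := by simpa [sub_eq_zero] using hc
    exact (hU.sub hzU).2 (Or.inl ⟨x, Ioo_subset_Icc_self hx01, this.symm⟩)
  have hwn : ‖z - A.g x‖ < ε := by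
    have : dist z (A.g x) ≤ dist z (A.g t) + dist (A.g x) (A.g t) := dist_triangle_right _ _ _
    rw [← dist_eq_norm]
    have : dist z (A.g t) < ε / 2 := hz3
    linarith
  have hside : ∀ σ : ℝ, (σ = 1 ∨ σ = -1) → 0 < σ * c → A.SideIn σ t U := by
    intro σ hσ hσc
    have hσσ : σ * σ = 1 := by rcases hσ with rfl | rfl <;> simp
    have habs : |c| = σ * c := by
      rcases hσ with rfl | rfl
      · rw [one_mul] at *; exact abs_of_pos hσc
      · rw [neg_one_mul] at *; exact abs_of_neg (by linarith)
    have hmem : z ∈ A.sideSet t σ (‖A.v t‖ / 2) ε := by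
      refine ⟨x, z - A.g x, hxt, hwn, ?_, by ring⟩
      rw [hc, cross_real_mul_right, cross_I_mul_self, norm_mul, norm_mul, Complex.norm_I,
        Complex.norm_real, Real.norm_eq_abs, habs]
      have : 0 < σ * c * ‖A.v t‖ ^ 2 := by positivity
      nlinarith
    obtain ⟨H1, H2⟩ := H σ hσ
    have hsub := hU.maximal _ H2 H1 ⟨z, hmem, hzU⟩
    refine sideIn_of_frequently hAB hU hσ ht (w := σ * (Complex.I * A.v t)) ?_ ?_
    · rw [cross_real_mul_right, cross_I_mul_self, ← mul_assoc, hσσ]; positivity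
    · refine (Eventually.mono (A.sideSet_mem_eventually (t' := t) (by simpa using hε) ?_)
        fun r hr => hsub hr).frequently
      rw [cross_real_mul_right, cross_I_mul_self, ← mul_assoc σ, hσσ, norm_mul, norm_mul,
        Complex.norm_I, Complex.norm_real, Real.norm_eq_abs]
      have : |σ| = 1 := by rcases hσ with rfl | rfl <;> simp
      rw [this]
      nlinarith
  rcases lt_or_gt_of_ne hc0 with hneg | hpos
  · exact ⟨-1, Or.inr rfl, hside (-1) (Or.inr rfl) (by linarith)⟩
  · exact ⟨1, Or.inl rfl, hside 1 (Or.inl rfl) (by linarith)⟩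

/-- If the closure of U avoided all parameters in (0, 1), then U would be open and closed within the
punctured open disc. This disc is connected, so U would contain it, although it contains `g (1 /
2)`. -/
lemma exists_mem_closure {A B : Arm R} {U : Set ℂ} (hU : IsComp (region A B) U) :
    ∃ t ∈ Ioo (0 : ℝ) 1, A.g t ∈ closure U ∨ B.g t ∈ closure U := by
  by_contra! hcon
  have hK : IsClosed (A.g '' Icc 0 1 ∪ B.g '' Icc 0 1) := A.isClosed_image.union B.isClosed_image
  have hR := A.R_pos
  set V : Set ℂ := Metric.ball 0 R \ {0}
  have hVpre : IsPreconnected V := by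
    have : V = (fun p : ℝ × ℝ => (p.1 : ℂ) * Complex.exp (p.2 * Complex.I)) ''
        (Ioo 0 R ×ˢ univ) := by
      ext z
      constructor
      · rintro ⟨hz1, hz2⟩
        refine ⟨(‖z‖, Complex.arg z), ⟨⟨norm_pos_iff.2 hz2, by simpa using hz1⟩, trivial⟩, ?_⟩
        exact Complex.norm_mul_exp_arg_mul_I z
      · rintro ⟨⟨r, θ⟩, ⟨⟨h1, h2⟩, -⟩, rfl⟩
        simp only at h1 h2
        refine ⟨?_, ?_⟩
        · simp [Complex.norm_exp_ofReal_mul_I, abs_of_pos h1, h2]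
        · simp [h1.ne']
    rw [this]
    apply IsPreconnected.image
    · exact isPreconnected_Ioo.prod isPreconnected_univ
    · fun_prop
  have hcl : V ∩ closure U ⊆ interior U ∩ V := by
    rintro x ⟨⟨hx1, hx2⟩, hxU⟩
    have hxK : x ∉ A.g '' Icc 0 1 ∪ B.g '' Icc 0 1 := by
      have key : ∀ C : Arm R, ∀ t ∈ Icc (0 : ℝ) 1, C.g t = x → t ∈ Ioo (0 : ℝ) 1 := by
        intro C t ht hxt
        refine ⟨lt_of_le_of_ne ht.1 ?_, lt_of_le_of_ne ht.2 ?_⟩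
        · rintro rfl; exact hx2 (by rw [← hxt, C.zero]; rfl)
        · rintro rfl
          rw [← hxt, mem_ball_zero_iff, C.norm_one] at hx1
          exact lt_irrefl _ hx1
      rintro (⟨t, ht, hxt⟩ | ⟨t, ht, hxt⟩)
      · exact (hcon t (key A t ht hxt)).1 (hxt ▸ hxU)
      · exact (hcon t (key B t ht hxt)).2 (hxt ▸ hxU)
    have hnb : (A.g '' Icc 0 1 ∪ B.g '' Icc 0 1)ᶜ ∩ Metric.ball 0 R ∈ 𝓝 x :=
      inter_mem (hK.isOpen_compl.mem_nhds hxK) (Metric.isOpen_ball.mem_nhds hx1)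
    obtain ⟨ρ, hρ, Hρ⟩ := Metric.mem_nhds_iff.1 hnb
    refine ⟨mem_interior.2 ⟨Metric.ball x ρ, ?_, Metric.isOpen_ball, Metric.mem_ball_self hρ⟩,
      hx1, hx2⟩
    apply hU.maximal _ (convex_ball x ρ).isPreconnected
    · exact fun y hy => ⟨Metric.ball_subset_closedBall (Hρ hy).2, (Hρ hy).1⟩
    · exact mem_closure_iff_nhds.1 hxU _ (Metric.ball_mem_nhds x hρ)
  have hne : (V ∩ interior U).Nonempty := by
    obtain ⟨x, hx⟩ := hU.nonempty
    obtain ⟨hx1, hx2⟩ := hU.sub hx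
    obtain ⟨ρ, hρ, Hρ⟩ := Metric.mem_nhds_iff.1 (hK.isOpen_compl.mem_nhds hx2)
    have hx0 : x ≠ 0 := by
      rintro rfl
      exact hx2 (Or.inl ⟨0, by simp, A.zero⟩)
    have hsub : Metric.ball x ρ ∩ Metric.closedBall 0 R ⊆ U := by
      apply hU.maximal _ ((convex_ball x ρ).inter (convex_closedBall _ _)).isPreconnected
      · exact fun y hy => ⟨hy.2, Hρ hy.1⟩
      · exact ⟨x, ⟨Metric.mem_ball_self hρ, hx1⟩, hx⟩
    have hn : 0 < ‖x‖ := norm_pos_iff.2 hx0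
    have hxR : ‖x‖ ≤ R := by simpa using hx1
    -- A point of U may lie on the boundary circle; shrinking it slightly by the factor 1 - q moves
    -- it into the open disc without leaving U.
    obtain ⟨q, hq0, hq1⟩ : ∃ q : ℝ, 0 < q ∧ q < 1 ∧ q * ‖x‖ < ρ := by
      refine ⟨min (1 / 2) (ρ / (2 * ‖x‖)), by positivity,
        (min_le_left _ _).trans_lt (by norm_num), ?_⟩
      refine (mul_le_mul_of_nonneg_right (min_le_right _ _) hn.le).trans_lt ?_
      rw [div_mul_eq_mul_div, div_lt_iff₀ (by positivity)]
      nlinarith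
    have hynorm : ‖((1 - q : ℝ) : ℂ) * x‖ = (1 - q) * ‖x‖ := by
      rw [norm_mul, Complex.norm_real, Real.norm_of_nonneg (by linarith)]
    have hyV : ((1 - q : ℝ) : ℂ) * x ∈ V := by
      refine ⟨?_, ?_⟩
      · rw [mem_ball_zero_iff, hynorm]
        nlinarith
      · refine mul_ne_zero ?_ hx0
        exact_mod_cast (by linarith : (1 - q : ℝ) ≠ 0)
    have hyU : ((1 - q : ℝ) : ℂ) * x ∈ U := by
      apply hsub
      refine ⟨?_, ?_⟩
      · rw [Metric.mem_ball, dist_eq_norm]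
        have : ((1 - q : ℝ) : ℂ) * x - x = -((q : ℝ) * x) := by push_cast; ring
        rw [this, norm_neg, norm_mul, Complex.norm_real, Real.norm_of_nonneg hq0.le]
        exact hq1.2
      · exact Metric.ball_subset_closedBall hyV.1
    exact ⟨_, hyV, (hcl ⟨hyV, subset_closure hyU⟩).1⟩
  have hVU : V ⊆ interior U := by
    apply hVpre.subset_of_closure_inter_subset isOpen_interior hne
    rintro x ⟨hx1, hx2⟩
    exact (hcl ⟨hx2, closure_mono interior_subset hx1⟩).1
  have h12 : A.g (1 / 2) ∈ V := by
    refine ⟨?_, A.g_ne_zero ⟨by norm_num, by norm_num⟩⟩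
    rw [mem_ball_zero_iff]
    exact A.norm_lt _ ⟨by norm_num, by norm_num⟩
  exact (hU.sub (interior_subset (hVU h12))).2 (Or.inl ⟨1 / 2, by norm_num, rfl⟩)

/-- The side `σ` of the whole arm belongs to `U`. -/
def HasSide (A : Arm R) (σ : ℝ) (U : Set ℂ) : Prop := ∀ t ∈ Ioo (0 : ℝ) 1, A.SideIn σ t U

lemma exists_hasSide {A B : Arm R} (hAB : Apart A B) {U : Set ℂ} (hU : IsComp (region A B) U) :
    ∃ σ : ℝ, (σ = 1 ∨ σ = -1) ∧ (A.HasSide σ U ∨ B.HasSide σ U) := by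
  obtain ⟨t, ht, h | h⟩ := exists_mem_closure hU
  · obtain ⟨σ, hσ, hs⟩ := sideIn_of_mem_closure hAB hU ht h
    exact ⟨σ, hσ, Or.inl fun t' ht' => hs.const hAB hU hσ ht ht'⟩
  · have hU' : IsComp (region B A) U := by rwa [region_comm]
    obtain ⟨σ, hσ, hs⟩ := sideIn_of_mem_closure hAB.symm hU' ht h
    exact ⟨σ, hσ, Or.inr fun t' ht' => hs.const hAB.symm hU' hσ ht ht'⟩

lemma HasSide.eq {A B : Arm R} {U V : Set ℂ} (hU : IsComp (region A B) U)
    (hV : IsComp (region A B) V) {σ : ℝ} (hσ : σ = 1 ∨ σ = -1) (h1 : A.HasSide σ U)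
    (h2 : A.HasSide σ V) : U = V := by
  apply hU.eq hV
  have ht : (1 / 2 : ℝ) ∈ Ioo (0 : ℝ) 1 := by norm_num
  have hv := A.v_ne_zero (A.mem_of_Ioo ht)
  have hw : 0 < σ * cross (A.v (1 / 2)) (σ * (Complex.I * A.v (1 / 2))) := by
    have : 0 < ‖A.v (1 / 2)‖ := norm_pos_iff.2 hv
    have hσσ : σ * σ = 1 := by rcases hσ with rfl | rfl <;> simp
    rw [cross_real_mul_right, cross_I_mul_self, ← mul_assoc, hσσ]; positivity
  obtain ⟨r, hr1, hr2⟩ := (((h1 _ ht).eventually_mem hw).and ((h2 _ ht).eventually_mem hw)).exists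
  exact ⟨_, hr1, hr2⟩

lemma HasSide.mem_closure {A : Arm R} {U : Set ℂ} {σ : ℝ} (hσ : σ = 1 ∨ σ = -1)
    (h : A.HasSide σ U) {t : ℝ} (ht : t ∈ Icc (0 : ℝ) 1) : A.g t ∈ closure U := by
  have hsub : A.g '' Ioo 0 1 ⊆ closure U := by
    rintro _ ⟨t, ht, rfl⟩
    exact (h t ht).mem_closure hσ ht
  have h1 : ContinuousWithinAt A.g (Ioo 0 1) t := (A.cont t ht).mono Ioo_subset_Icc_self
  have h2 : t ∈ closure (Ioo (0 : ℝ) 1) := by rwa [closure_Ioo zero_ne_one]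
  exact closure_minimal hsub isClosed_closure (h1.mem_closure_image h2)

/-- The closure of `U` contains no segment through the vortex. -/
def Proper (U : Set ℂ) : Prop :=
  ¬ ∃ x y : ℂ, x ≠ y ∧ 0 ∈ openSegment ℝ x y ∧ segment ℝ x y ⊆ closure U

lemma not_proper_of_ball {U : Set ℂ} {ρ : ℝ} (hρ : 0 < ρ) (h : Metric.closedBall 0 ρ ⊆ closure U) :
    ¬ Proper U := by
  intro hp
  refine hp ⟨-ρ, ρ, ?_, ⟨1 / 2, 1 / 2, by norm_num, by norm_num, by norm_num, by simp⟩, ?_⟩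
  · intro he
    have := congrArg Complex.re he
    simp at this
    linarith
  · refine (Convex.segment_subset (convex_closedBall _ _) ?_ ?_).trans h <;>
      simp [abs_of_pos hρ]

/-- Any component has a side of one of the arms, which already belongs to U, so it equals U. Thus
the closure of U is the whole ball. -/
lemma not_proper_of_all_sides {A B : Arm R} (hAB : Apart A B) {U : Set ℂ}
    (hU : IsComp (region A B) U) (hA : ∀ σ : ℝ, (σ = 1 ∨ σ = -1) → A.HasSide σ U)
    (hB : ∀ σ : ℝ, (σ = 1 ∨ σ = -1) → B.HasSide σ U) : ¬ Proper U := by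
  apply not_proper_of_ball A.R_pos
  intro z hz
  by_cases hK : z ∈ A.g '' Icc 0 1 ∪ B.g '' Icc 0 1
  · rcases hK with ⟨t, ht, rfl⟩ | ⟨t, ht, rfl⟩
    · exact (hA 1 (Or.inl rfl)).mem_closure (Or.inl rfl) ht
    · exact (hB 1 (Or.inl rfl)).mem_closure (Or.inl rfl) ht
  · have hzΩ : z ∈ region A B := ⟨hz, hK⟩
    have hV := isComp_connectedComponentIn hzΩ
    have : U = connectedComponentIn (region A B) z := by
      obtain ⟨σ, hσ, h | h⟩ := exists_hasSide hAB hV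
      · exact (hA σ hσ).eq hU hV hσ h
      · exact HasSide.eq (region_comm A B ▸ hU) (region_comm B A ▸ hV) hσ (hB σ hσ) h
    rw [this]
    exact subset_closure (mem_connectedComponentIn hzΩ)

end Arm

/-! ### Primitives, monotone inverses and adjacent points of compact sets. -/

lemma exists_primitive {E : Type*} [NormedAddCommGroup E] [NormedSpace ℝ E] [CompleteSpace E]
    {f : ℝ → E} {l r : ℝ} (hf : ContinuousOn f (Ioo l r)) {t₀ : ℝ} (ht₀ : t₀ ∈ Ioo l r) (y : E) :
    ∃ F : ℝ → E, F t₀ = y ∧ ∀ t ∈ Ioo l r, HasDerivAt F (f t) t := by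
  refine ⟨fun t => y + ∫ u in t₀..t, f u, by simp, fun t ht => ?_⟩
  have hsub : uIcc t₀ t ⊆ Ioo l r := by
    intro x hx
    rw [mem_uIcc] at hx
    rcases hx with hx | hx
    · exact ⟨ht₀.1.trans_le hx.1, hx.2.trans_lt ht.2⟩
    · exact ⟨ht.1.trans_le hx.1, hx.2.trans_lt ht₀.2⟩
  apply HasDerivAt.const_add
  apply intervalIntegral.integral_hasDerivAt_right
  · exact (hf.mono hsub).intervalIntegrable
  · exact hf.stronglyMeasurableAtFilter isOpen_Ioo t ht
  · exact hf.continuousAt (Ioo_mem_nhds ht.1 ht.2)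

lemma eq_of_hasDerivAt_eq {E : Type*} [NormedAddCommGroup E] [NormedSpace ℝ E]
    {f g f' : ℝ → E} {l r : ℝ} (hf : ∀ t ∈ Ioo l r, HasDerivAt f (f' t) t)
    (hg : ∀ t ∈ Ioo l r, HasDerivAt g (f' t) t) {t₀ : ℝ} (ht₀ : t₀ ∈ Ioo l r) (h : f t₀ = g t₀)
    {t : ℝ} (ht : t ∈ Ioo l r) : f t = g t := by
  have hd : ∀ t ∈ Ioo l r, HasDerivAt (f - g) 0 t := fun t ht => by
    simpa using (hf t ht).sub (hg t ht)
  have := isOpen_Ioo.is_const_of_deriv_eq_zero (𝕜 := ℝ) isPreconnected_Ioo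
    (fun t ht => (hd t ht).differentiableAt.differentiableWithinAt)
    (fun t ht => (hd t ht).deriv) ht ht₀
  simpa [h, sub_eq_zero] using this

/-- Source and image are order-connected, and an order isomorphism between such sets is a
homeomorphism. -/
lemma StrictMonoOn.exists_continuousOn_inverse {f : ℝ → ℝ} {s : Set ℝ} (hs : s.OrdConnected)
    (hf : ContinuousOn f s) (hm : StrictMonoOn f s) :
    ∃ T : ℝ → ℝ, ContinuousOn T (f '' s) ∧ ∀ t ∈ s, T (f t) = t := by
  have hJ : (f '' s).OrdConnected := (hs.isPreconnected.image f hf).ordConnected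
  set e := hm.orderIso f s
  classical
  refine ⟨fun y => if h : y ∈ f '' s then (e.symm ⟨y, h⟩ : ℝ) else 0, ?_, ?_⟩
  · rw [continuousOn_iff_continuous_domRestrict]
    have h1 : Continuous (fun y : f '' s => ((e.symm y : s) : ℝ)) :=
      continuous_subtype_val.comp e.symm.continuous
    convert h1 using 1
    ext y
    exact dif_pos y.2
  · intro t ht
    have h : f t ∈ f '' s := ⟨t, ht, rfl⟩
    simp only [h, dif_pos]
    have : e ⟨t, ht⟩ = ⟨f t, h⟩ := rfl
    rw [← this, e.symm_apply_apply]

/-- Minimise x - y over the compact set of pairs with y ≤ x inside the given bounds. This cuts a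
chord out of a longer segment: an end in each of two disjoint sets, and neither of them in between.
-/
lemma exists_adjacent {a b : Set ℝ} (ha : IsCompact a) (hb : IsCompact b) {x₀ y₀ : ℝ} (hx₀ : x₀ ∈ a)
    (hy₀ : y₀ ∈ b) (hd : Disjoint a b) (h : y₀ ≤ x₀) :
    ∃ x ∈ a, ∃ y ∈ b, y < x ∧ x ≤ x₀ ∧ y₀ ≤ y ∧ ∀ z ∈ Ioo y x, z ∉ a ∧ z ∉ b := by
  have hc : IsCompact ((a ×ˢ b) ∩ ({p : ℝ × ℝ | p.2 ≤ p.1} ∩ {p : ℝ × ℝ | p.1 ≤ x₀ ∧ y₀ ≤ p.2})) := by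
    apply (ha.prod hb).inter_right
    apply (isClosed_le continuous_snd continuous_fst).inter
    exact (isClosed_le continuous_fst continuous_const).inter
      (isClosed_le continuous_const continuous_snd)
  obtain ⟨⟨x, y⟩, ⟨⟨hx, hy⟩, hyx, hxx, hyy⟩, hmin⟩ := hc.exists_isMinOn
    ⟨(x₀, y₀), ⟨hx₀, hy₀⟩, h, le_rfl, le_rfl⟩
    ((continuous_fst.sub continuous_snd).continuousOn)
  simp only at hx hy hyx hxx hyy
  have hne : y ≠ x := fun he => (disjoint_left.1 hd) hx (he ▸ hy)
  refine ⟨x, hx, y, hy, lt_of_le_of_ne hyx hne, hxx, hyy, fun z hz => ⟨fun hza => ?_, fun hzb => ?_⟩⟩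
  · have := hmin (show (z, y) ∈ _ from ⟨⟨hza, hy⟩, hz.1.le, hz.2.le.trans hxx, hyy⟩)
    simp only [mem_ofPred_eq, Pi.sub_apply] at this
    linarith [hz.2]
  · have := hmin (show (x, z) ∈ _ from ⟨⟨hx, hzb⟩, hz.2.le, hxx, hyy.trans hz.1.le⟩)
    simp only [mem_ofPred_eq, Pi.sub_apply] at this
    linarith [hz.1]

/-! ### The polar angle of an arm, and chords along rays. -/

namespace Arm
variable {R : ℝ}

lemma mem_Ioo_of_norm (A : Arm R) {t : ℝ} (ht : t ∈ Icc (0 : ℝ) 1) (h0 : A.g t ≠ 0)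
    (hR : ‖A.g t‖ < R) : t ∈ Ioo (0 : ℝ) 1 := by
  refine ⟨lt_of_le_of_ne ht.1 ?_, lt_of_le_of_ne ht.2 ?_⟩
  · rintro rfl; exact h0 A.zero
  · rintro rfl; rw [A.norm_one] at hR; exact lt_irrefl _ hR

lemma tendsto_norm (A : Arm R) : Tendsto (fun t => ‖A.g t‖) (𝓝[>] 0) (𝓝 0) := by
  have h : ContinuousWithinAt A.g (Ioc 0 1) 0 :=
    (A.cont 0 (left_mem_Icc.2 zero_le_one)).mono Ioc_subset_Icc_self
  have : Tendsto A.g (𝓝[>] 0) (𝓝 (A.g 0)) := by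
    rw [← nhdsWithin_Ioc_eq_nhdsGT one_pos]; exact h
  rw [A.zero] at this
  simpa using this.norm

/-- A polar angle along the arm. -/
structure IsLift (A : Arm R) (φ : ℝ → ℝ) : Prop where
  cont : ContinuousOn φ (Ioc 0 1)
  eq : ∀ t ∈ Ioc (0 : ℝ) 1, A.g t = ‖A.g t‖ * Complex.exp (φ t * Complex.I)
  mono : StrictMonoOn (fun t => A.s * φ t) (Ioc 0 1)

/-- A primitive of v / g is a logarithm of g up to a constant. Its imaginary part is the polar
angle, whose derivative cross g v / ‖g‖² has the sign s by `cross_pos`. -/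
lemma exists_lift (A : Arm R) : ∃ φ, A.IsLift φ := by
  have h1 : (1 : ℝ) ∈ Ioo 0 A.b := ⟨one_pos, A.one_lt⟩
  have hc1 : ContinuousAt A.g 1 := (A.hasDerivAt 1 h1).continuousAt
  have hne1 : ∀ᶠ t in 𝓝 1, A.g t ≠ 0 := hc1.eventually_ne (A.g_ne_zero ⟨one_pos, le_rfl⟩)
  obtain ⟨δ, hδ, Hδ⟩ := Metric.eventually_nhds_iff.1 hne1
  -- Working slightly beyond 1, where g is still nonzero, makes 1 an interior parameter for the
  -- primitive.
  set b := min A.b (1 + δ) with hb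
  have hb1 : 1 < b := lt_min A.one_lt (by linarith)
  have hbb : Ioo 0 b ⊆ Ioo 0 A.b := Ioo_subset_Ioo_right (min_le_left _ _)
  have hne : ∀ t ∈ Ioo 0 b, A.g t ≠ 0 := by
    intro t ht
    rcases le_or_gt t 1 with h | h
    · exact A.g_ne_zero ⟨ht.1, h⟩
    · apply Hδ
      rw [Real.dist_eq, abs_of_pos (by linarith)]
      linarith [ht.2.trans_le (min_le_right A.b (1 + δ))]
  have hfc : ContinuousOn (fun t => A.v t / A.g t) (Ioo 0 b) :=
    (A.cont_v.mono hbb).div (A.continuousOn_g.mono hbb) hne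
  obtain ⟨L, hL1, hL⟩ := exists_primitive hfc (⟨one_pos, hb1⟩ : (1 : ℝ) ∈ Ioo 0 b) 0
  have hconst : ∀ t ∈ Ioo 0 b, A.g t * Complex.exp (-L t) = A.g 1 := by
    intro t ht
    have := eq_of_hasDerivAt_eq (f := fun t => A.g t * Complex.exp (-L t)) (g := fun _ => A.g 1)
      (f' := fun _ => 0) (l := 0) (r := b) ?_ (fun t _ => hasDerivAt_const t _)
      (⟨one_pos, hb1⟩ : (1 : ℝ) ∈ Ioo 0 b) (by simp [hL1]) ht
    · exact this
    · intro t ht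
      have h2 := (A.hasDerivAt t (hbb ht)).mul ((hL t ht).neg.cexp)
      refine h2.congr_deriv ?_
      have := hne t ht
      field_simp
      ring
  set φ : ℝ → ℝ := fun t => (A.g 1).arg + (L t).im
  have hg : ∀ t ∈ Ioo 0 b, A.g t = ‖A.g t‖ * Complex.exp (φ t * Complex.I) := by
    intro t ht
    have h3 : A.g t = A.g 1 * Complex.exp (L t) := by
      rw [← hconst t ht, mul_assoc, ← Complex.exp_add]; simp
    have h4 : ‖A.g t‖ = ‖A.g 1‖ * Real.exp (L t).re := by
      rw [h3, norm_mul, Complex.norm_exp]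
    rw [h4]
    have h5 : Complex.exp (L t) = Complex.exp (L t).re * Complex.exp ((L t).im * Complex.I) := by
      rw [← Complex.exp_add, Complex.re_add_im]
    have h6 := Complex.norm_mul_exp_arg_mul_I (A.g 1)
    conv_lhs => rw [h3, ← h6, h5]
    simp only [φ]
    push_cast
    rw [add_mul, Complex.exp_add]
    ring
  have hIoc : Ioc (0 : ℝ) 1 ⊆ Ioo 0 b := fun t ht => ⟨ht.1, ht.2.trans_lt hb1⟩
  have hφd : ∀ t ∈ Ioo 0 b, HasDerivAt φ (A.v t / A.g t).im t := fun t ht =>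
    ((hL t ht).im_comp).const_add _
  have hφc : ContinuousOn φ (Ioo 0 b) := fun t ht => (hφd t ht).continuousAt.continuousWithinAt
  refine ⟨φ, hφc.mono hIoc, fun t ht => hg t (hIoc ht), ?_⟩
  intro x hx y hy hxy
  refine lt_of_hasDerivAt_pos (f := fun t => A.s * φ t)
    (f' := fun t => A.s * (A.v t / A.g t).im) hxy ?_ ?_ ?_
  · have : ContinuousOn φ (Icc x y) := hφc.mono fun t ht =>
      hIoc ⟨hx.1.trans_le ht.1, ht.2.trans hy.2⟩
    fun_prop
  · exact fun t ht => (hφd t (hIoc ⟨hx.1.trans ht.1, ht.2.le.trans hy.2⟩)).const_mul _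
  · intro t ht
    have ht' : t ∈ Ioc (0 : ℝ) 1 := ⟨hx.1.trans ht.1, ht.2.le.trans hy.2⟩
    have h1 := A.cross_pos ht'
    have hn : 0 < Complex.normSq (A.g t) := Complex.normSq_pos.2 (A.g_ne_zero ht')
    have e : A.s * (A.v t / A.g t).im = A.s * cross (A.g t) (A.v t) / Complex.normSq (A.g t) := by
      rw [Complex.div_im, cross]; field_simp
    rw [e]
    positivity

/-- The open segment is connected and hence lies in one component; the directions in which it leaves
its two ends show which sides that component has. -/
lemma connect {A B : Arm R} {σ tp tq : ℝ} (hAB : Apart A B)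
    (hσ : σ = 1 ∨ σ = -1) (hp : tp ∈ Ioo (0 : ℝ) 1) (hq : tq ∈ Ioo (0 : ℝ) 1)
    (hseg : openSegment ℝ (A.g tp) (B.g tq) ⊆ region A B)
    (h1 : 0 < σ * cross (A.v tp) (B.g tq - A.g tp))
    (h2 : 0 < σ * cross (B.v tq) (B.g tq - A.g tp)) :
    ∃ V, IsComp (region A B) V ∧ openSegment ℝ (A.g tp) (B.g tq) ⊆ V ∧ A.HasSide σ V ∧
      B.HasSide (-σ) V := by
  have hmem : ∀ r : ℝ, 0 < r → r < 1 →
      A.g tp + r * (B.g tq - A.g tp) ∈ openSegment ℝ (A.g tp) (B.g tq) := by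
    intro r hr0 hr1
    refine ⟨1 - r, r, by linarith, hr0, by ring, ?_⟩
    simp only [Complex.real_smul]
    push_cast; ring
  have hx := hmem (1 / 2) (by norm_num) (by norm_num)
  set x := A.g tp + ((1 / 2 : ℝ) : ℂ) * (B.g tq - A.g tp)
  have hV := isComp_connectedComponentIn (hseg hx)
  set V := connectedComponentIn (region A B) x
  have hsub : openSegment ℝ (A.g tp) (B.g tq) ⊆ V :=
    (convex_openSegment _ _).isPreconnected.subset_connectedComponentIn hx hseg
  have hsmall : ∀ᶠ r : ℝ in 𝓝[>] 0, 0 < r ∧ r < 1 := Ioo_mem_nhdsGT one_pos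
  refine ⟨V, hV, hsub, ?_, ?_⟩
  · have : A.SideIn σ tp V := sideIn_of_frequently hAB hV hσ hp h1
      (hsmall.mono fun r hr => hsub (hmem r hr.1 hr.2)).frequently
    exact fun t ht => this.const hAB hV hσ hp ht
  · have hσ' : -σ = 1 ∨ -σ = -1 := by rcases hσ with rfl | rfl <;> simp
    have hV' : IsComp (region B A) V := region_comm A B ▸ hV
    have : B.SideIn (-σ) tq V := by
      refine sideIn_of_frequently hAB.symm hV' hσ' hq (w := -(B.g tq - A.g tp)) ?_
        (hsmall.mono fun r hr => hsub ?_).frequently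
      · rw [cross_neg_right]; linarith
      · convert hmem (1 - r) (by linarith [hr.2]) (by linarith [hr.1]) using 1
        push_cast; ring
    exact fun t ht => this.const hAB.symm hV' hσ' hq ht

/-- A point of `B` that lies strictly between the vortex and a point of `A` yields a radial
chord. -/
lemma radial_chord {A B : Arm R} (hAB : Apart A B) (hs : A.s = B.s) {t₀ t₁ c : ℝ}
    (h₀ : t₀ ∈ Ioo (0 : ℝ) 1) (h₁ : t₁ ∈ Icc (0 : ℝ) 1) (hc0 : 0 < c) (hc1 : c < 1)
    (he : B.g t₁ = c * A.g t₀) :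
    ∃ tp ∈ Ioo (0 : ℝ) 1, ∃ tq ∈ Ioo (0 : ℝ) 1,
      openSegment ℝ (A.g tp) (B.g tq) ⊆ region A B ∧
      0 < A.s * cross (A.v tp) (B.g tq - A.g tp) ∧ 0 < A.s * cross (B.v tq) (B.g tq - A.g tp) := by
  set P := A.g t₀ with hP
  have hP0 : P ≠ 0 := A.g_ne_zero ⟨h₀.1, h₀.2.le⟩
  have hPn : 0 < ‖P‖ := norm_pos_iff.2 hP0
  have hPR : ‖P‖ < R := A.norm_lt _ ⟨h₀.1.le, h₀.2⟩
  have hcont : Continuous fun x : ℝ => (x : ℂ) * P := by fun_prop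
  set a : Set ℝ := Icc c 1 ∩ (fun x : ℝ => (x : ℂ) * P) ⁻¹' (A.g '' Icc 0 1)
  set b : Set ℝ := Icc c 1 ∩ (fun x : ℝ => (x : ℂ) * P) ⁻¹' (B.g '' Icc 0 1)
  have hac : IsCompact a := isCompact_Icc.inter_right (A.isClosed_image.preimage hcont)
  have hbc : IsCompact b := isCompact_Icc.inter_right (B.isClosed_image.preimage hcont)
  have hne : ∀ x ∈ Icc c 1, (x : ℂ) * P ≠ 0 := fun x hx =>
    mul_ne_zero (by exact_mod_cast (hc0.trans_le hx.1).ne') hP0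
  have hnorm : ∀ x ∈ Icc c 1, ‖(x : ℂ) * P‖ < R := by
    intro x hx
    rw [norm_mul, Complex.norm_real, Real.norm_of_nonneg (hc0.le.trans hx.1)]
    nlinarith [hx.2]
  have hd : Disjoint a b := by
    rw [disjoint_left]
    rintro x ⟨hx, hxa⟩ ⟨-, hxb⟩
    have : (x : ℂ) * P ∈ ({0} : Set ℂ) := by rw [← hAB]; exact ⟨hxa, hxb⟩
    exact hne x hx this
  -- The ray meets both arms, so it contains adjacent points of A (outside) and B (inside). The
  -- chord between them is a negative multiple of the position vector at either end, and `cross_pos`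
  -- determines both signs.
  obtain ⟨x, ⟨hx, tp, htp, htpe⟩, y, ⟨hy, tq, htq, htqe⟩, hyx, -, -, hbetween⟩ :=
    exists_adjacent hac hbc (x₀ := 1) (y₀ := c) ⟨⟨hc1.le, le_rfl⟩, by
      refine ⟨t₀, ⟨h₀.1.le, h₀.2.le⟩, ?_⟩; simp [hP]⟩ ⟨⟨le_rfl, hc1.le⟩, t₁, h₁, he⟩ hd hc1.le
  simp only at htpe htqe
  have htp' : tp ∈ Ioo (0 : ℝ) 1 := A.mem_Ioo_of_norm htp (htpe ▸ hne x hx) (htpe ▸ hnorm x hx)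
  have htq' : tq ∈ Ioo (0 : ℝ) 1 := B.mem_Ioo_of_norm htq (htqe ▸ hne y hy) (htqe ▸ hnorm y hy)
  have hx0 : 0 < x := hc0.trans_le hx.1
  have hy0 : 0 < y := hc0.trans_le hy.1
  refine ⟨tp, htp', tq, htq', ?_, ?_, ?_⟩
  · rintro _ ⟨p, q, hp, hq, hpq, rfl⟩
    rw [htpe, htqe]
    have e : p • ((x : ℂ) * P) + q • ((y : ℂ) * P) = ((p * x + q * y : ℝ) : ℂ) * P := by
      simp only [Complex.real_smul]; push_cast; ring
    rw [e]
    have hz : p * x + q * y ∈ Ioo y x := by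
      have : p = 1 - q := by linarith
      subst this
      constructor <;> nlinarith
    have hz' : p * x + q * y ∈ Icc c 1 := ⟨hy.1.trans hz.1.le, hz.2.le.trans hx.2⟩
    obtain ⟨h3, h4⟩ := hbetween _ hz
    refine ⟨by simpa using (hnorm _ hz').le, ?_⟩
    rintro (h | h)
    · exact h3 ⟨hz', h⟩
    · exact h4 ⟨hz', h⟩
  · have e : B.g tq - A.g tp = ((-((x - y) / x) : ℝ) : ℂ) * A.g tp := by
      rw [htpe, htqe]
      have : (x : ℂ) ≠ 0 := by exact_mod_cast hx0.ne'
      push_cast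
      field_simp
      ring
    rw [e, cross_real_mul_right, cross_swap]
    have := A.cross_pos ⟨htp'.1, htp'.2.le⟩
    have h5 : 0 < (x - y) / x := div_pos (by linarith) hx0
    nlinarith [mul_pos this h5]
  · have e : B.g tq - A.g tp = ((-((x - y) / y) : ℝ) : ℂ) * B.g tq := by
      rw [htpe, htqe]
      have : (y : ℂ) ≠ 0 := by exact_mod_cast hy0.ne'
      push_cast
      field_simp
      ring
    rw [e, cross_real_mul_right, cross_swap, hs]
    have := B.cross_pos ⟨htq'.1, htq'.2.le⟩
    have h5 : 0 < (x - y) / y := div_pos (by linarith) hy0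
    nlinarith [mul_pos this h5]

end Arm

/-! ### Arms that wind infinitely often. -/

/-- Two curves in polar coordinates that run from the centre of a disc to its boundary in opposite
senses of rotation meet if the first one winds infinitely often. -/
lemma exists_polar_eq {φ₁ φ₂ r₁ r₂ : ℝ → ℝ} {R : ℝ} (hφ₁ : ContinuousOn φ₁ (Ioc 0 1))
    (hφ₂ : ContinuousOn φ₂ (Ioc 0 1)) (hr₁ : ContinuousOn r₁ (Ioc 0 1))
    (hr₂ : ContinuousOn r₂ (Ioc 0 1)) (hm₁ : StrictMonoOn φ₁ (Ioc 0 1))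
    (hm₂ : AntitoneOn φ₂ (Ioc 0 1)) (hpos : ∀ t ∈ Ioc (0 : ℝ) 1, 0 < r₁ t)
    (hlt₁ : ∀ t ∈ Ioo (0 : ℝ) 1, r₁ t < R) (hlt₂ : ∀ t ∈ Ioo (0 : ℝ) 1, r₂ t < R)
    (h₁ : r₁ 1 = R) (h₂ : r₂ 1 = R) (hlim : Tendsto r₂ (𝓝[>] 0) (𝓝 0))
    (hunb : ∀ M, ∃ t ∈ Ioc (0 : ℝ) 1, φ₁ t < M) :
    ∃ t ∈ Ioc (0 : ℝ) 1, ∃ t' ∈ Ioc (0 : ℝ) 1, ∃ n : ℤ,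
      φ₁ t = φ₂ t' + n * (2 * Real.pi) ∧ r₁ t = r₂ t' := by
  have h11 : (1 : ℝ) ∈ Ioc (0 : ℝ) 1 := ⟨one_pos, le_rfl⟩
  -- After a shift by full turns the second curve ends below the final angle of the first, so at its
  -- end it can be compared with the first curve written as a radius over the angle.
  obtain ⟨n, hn⟩ : ∃ n : ℤ, φ₂ 1 + n * (2 * Real.pi) < φ₁ 1 := by
    obtain ⟨n, hn⟩ := exists_int_lt ((φ₁ 1 - φ₂ 1) / (2 * Real.pi))
    refine ⟨n, ?_⟩
    rw [lt_div_iff₀ (by positivity)] at hn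
    linarith
  set ψ : ℝ → ℝ := fun t => φ₂ t + n * (2 * Real.pi) with hψ
  have hψc : ContinuousOn ψ (Ioc 0 1) := hφ₂.add continuousOn_const
  have hψm : AntitoneOn ψ (Ioc 0 1) := fun x hx y hy hxy => by
    have := hm₂ hx hy hxy
    simp only [hψ]; linarith
  obtain ⟨T, hTc, hT⟩ := hm₁.exists_continuousOn_inverse ordConnected_Ioc hφ₁
  have himg : φ₁ '' Ioc 0 1 = Iic (φ₁ 1) := by
    apply Subset.antisymm
    · rintro _ ⟨t, ht, rfl⟩
      exact hm₁.monotoneOn ht h11 ht.2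
    · intro y hy
      obtain ⟨t, ht, hty⟩ := hunb y
      have hsub : Icc t 1 ⊆ Ioc 0 1 := fun x hx => ⟨ht.1.trans_le hx.1, hx.2⟩
      obtain ⟨x, hx, hxe⟩ := intermediate_value_Icc ht.2 (hφ₁.mono hsub) ⟨hty.le, hy⟩
      exact ⟨x, hsub hx, hxe⟩
  rw [himg] at hTc
  have hTmem : ∀ y ∈ Iic (φ₁ 1), T y ∈ Ioc (0 : ℝ) 1 ∧ φ₁ (T y) = y := by
    intro y hy
    rw [← himg] at hy
    obtain ⟨t, ht, rfl⟩ := hy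
    rw [hT t ht]; exact ⟨ht, rfl⟩
  -- A parameter at which the second curve lies inside the first. If its angle reaches φ₁ 1, the
  -- first curve has radius R there. If not, its angles stay in a compact interval over which the
  -- radius of the first curve is bounded below, while r₂ tends to 0. At the outer end the order is
  -- reversed, and the curves meet in between.
  obtain ⟨l, hl, hl1, hll⟩ : ∃ l ∈ Ioo (0 : ℝ) 1, ψ l ≤ φ₁ 1 ∧ r₂ l < r₁ (T (ψ l)) := by
    by_cases hcase : ∃ l ∈ Ioc (0 : ℝ) 1, φ₁ 1 ≤ ψ l
    · obtain ⟨l, hl, hle⟩ := hcase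
      have hsub : Icc l 1 ⊆ Ioc 0 1 := fun x hx => ⟨hl.1.trans_le hx.1, hx.2⟩
      obtain ⟨x, hx, hxe⟩ := intermediate_value_Icc' hl.2 (hψc.mono hsub) ⟨hn.le, hle⟩
      have hx1 : x ≠ 1 := by
        rintro rfl
        simp only [hψ] at hxe
        linarith
      have hxx : x ∈ Ioo (0 : ℝ) 1 := ⟨(hsub hx).1, lt_of_le_of_ne hx.2 hx1⟩
      refine ⟨x, hxx, hxe.le, ?_⟩
      rw [hxe, hT 1 h11, h₁]
      exact hlt₂ x hxx
    · push Not at hcase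
      have hK : IsCompact (Icc (ψ 1) (φ₁ 1)) := isCompact_Icc
      have hrc : ContinuousOn (fun y => r₁ (T y)) (Icc (ψ 1) (φ₁ 1)) := by
        apply hr₁.comp (hTc.mono fun y hy => hy.2)
        exact fun y hy => (hTmem y hy.2).1
      obtain ⟨y, hy, hmin⟩ := hK.exists_isMinOn ⟨φ₁ 1, hn.le, le_rfl⟩ hrc
      have h3 := hpos _ (hTmem y hy.2).1
      have h4 := hlim.eventually (gt_mem_nhds h3)
      have h5 : ∀ᶠ x : ℝ in 𝓝[>] 0, x ∈ Ioo (0 : ℝ) 1 := Ioo_mem_nhdsGT one_pos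
      obtain ⟨x, hx1, hx2⟩ := (h4.and h5).exists
      have hx3 : x ∈ Ioc (0 : ℝ) 1 := ⟨hx2.1, hx2.2.le⟩
      refine ⟨x, hx2, (hcase x hx3).le, hx1.trans_le ?_⟩
      exact hmin ⟨hψm hx3 h11 hx2.2.le, (hcase x hx3).le⟩
  have hsub : Icc l 1 ⊆ Ioc 0 1 := fun x hx => ⟨hl.1.trans_le hx.1, hx.2⟩
  have hle : ∀ x ∈ Icc l 1, ψ x ≤ φ₁ 1 := fun x hx =>
    (hψm ⟨hl.1, hl.2.le⟩ (hsub hx) hx.1).trans hl1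
  have hdc : ContinuousOn (fun x => r₁ (T (ψ x)) - r₂ x) (Icc l 1) := by
    apply ContinuousOn.sub _ (hr₂.mono hsub)
    apply hr₁.comp (hTc.comp (hψc.mono hsub) hle)
    exact fun x hx => (hTmem _ (hle x hx)).1
  have hend : r₁ (T (ψ 1)) - r₂ 1 ≤ 0 := by
    rw [h₂]
    obtain ⟨h6, h7⟩ := hTmem (ψ 1) hn.le
    rcases h6.2.eq_or_lt with h8 | h8
    · rw [h8, h₁, sub_self]
    · linarith [hlt₁ _ ⟨h6.1, h8⟩]
  obtain ⟨x, hx, hxe⟩ := intermediate_value_Icc' hl.2.le hdc ⟨hend, by linarith⟩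
  obtain ⟨h6, h7⟩ := hTmem (ψ x) (hle x hx)
  exact ⟨T (ψ x), h6, x, hsub hx, n, h7, by simp only at hxe; linarith⟩

lemma exp_add_two_pi_int (x : ℝ) (n : ℤ) :
    Complex.exp (((x + n * (2 * Real.pi) : ℝ) : ℂ) * Complex.I) = Complex.exp (x * Complex.I) := by
  have : ((x + n * (2 * Real.pi) : ℝ) : ℂ) * Complex.I
      = x * Complex.I + n * (2 * Real.pi * Complex.I) := by push_cast; ring
  rw [this, Complex.exp_periodic.int_mul n]

namespace Arm
variable {R : ℝ}

lemma contNorm (A : Arm R) : ContinuousOn (fun t => ‖A.g t‖) (Ioc 0 1) :=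
  (A.cont.mono Ioc_subset_Icc_self).norm

/-- The arm winds infinitely often around its vortex. -/
def Winding (A : Arm R) (φ : ℝ → ℝ) : Prop := ∀ M, ∃ t ∈ Ioc (0 : ℝ) 1, A.s * φ t < M

/-- Arms with opposite senses of rotation would meet away from the vortex by `exists_polar_eq`. -/
lemma Winding.sign_eq {A B : Arm R} (hAB : Apart A B) {φ χ : ℝ → ℝ} (hφ : A.IsLift φ)
    (hχ : B.IsLift χ) (hw : A.Winding φ) : A.s = B.s := by
  by_contra hne
  have hBs : B.s = -A.s := by
    rcases A.sign with h | h <;> rcases B.sign with h' | h' <;> simp [h, h'] at hne ⊢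
  have hno : ∀ t ∈ Ioc (0 : ℝ) 1, 0 < ‖A.g t‖ := fun t ht => norm_pos_iff.2 (A.g_ne_zero ht)
  obtain ⟨t, ht, t', ht', n, h1, h2⟩ := exists_polar_eq (R := R)
    (φ₁ := fun t => A.s * φ t) (φ₂ := fun t => A.s * χ t)
    (r₁ := fun t => ‖A.g t‖) (r₂ := fun t => ‖B.g t‖) (continuousOn_const.mul hφ.cont)
    (continuousOn_const.mul hχ.cont) A.contNorm B.contNorm hφ.mono
    (fun x hx y hy hxy => by
      have := hχ.mono.monotoneOn hx hy hxy
      simp only [hBs] at this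
      linarith) hno (fun t ht => A.norm_lt t ⟨ht.1.le, ht.2⟩)
    (fun t ht => B.norm_lt t ⟨ht.1.le, ht.2⟩) A.norm_one B.norm_one B.tendsto_norm hw
  refine hAB.ne ht ⟨ht'.1.le, ht'.2⟩ ?_
  rw [hφ.eq t ht, hχ.eq t' ht', h2]
  obtain ⟨m, hm⟩ : ∃ m : ℤ, φ t = χ t' + m * (2 * Real.pi) := by
    rcases A.sign with h | h
    · exact ⟨n, by rw [h] at h1; linarith⟩
    · exact ⟨-n, by rw [h] at h1; push_cast; linarith⟩
  rw [hm, exp_add_two_pi_int]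

/-- The angle decreases without bound (up to the sign s) towards the vortex, so some interval of
parameters below t₀ covers a full turn and with it every direction. -/
lemma Winding.exists_on_ray {A : Arm R} {φ : ℝ → ℝ} (hφ : A.IsLift φ) (hw : A.Winding φ) {t₀ : ℝ}
    (ht₀ : t₀ ∈ Ioo (0 : ℝ) 1) :
    ∃ t₁ ∈ Ioo 0 t₀, (∀ θ : ℝ, ∃ t ∈ Icc t₁ t₀, A.g t = ‖A.g t‖ * Complex.exp (θ * Complex.I)) := by
  obtain ⟨t₁, ht₁, hlt⟩ := hw (A.s * φ t₀ - 2 * Real.pi)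
  have ht₁₀ : t₁ < t₀ := by
    by_contra! h
    have : A.s * φ t₀ ≤ A.s * φ t₁ := hφ.mono.monotoneOn ⟨ht₀.1, ht₀.2.le⟩ ht₁ h
    linarith [Real.pi_pos]
  refine ⟨t₁, ⟨ht₁.1, ht₁₀⟩, fun θ => ?_⟩
  have hsub : Icc t₁ t₀ ⊆ Ioc 0 1 := fun x hx => ⟨ht₁.1.trans_le hx.1, hx.2.trans ht₀.2.le⟩
  have hpi : (0 : ℝ) < 2 * Real.pi := by positivity
  set y := toIcoMod hpi (A.s * φ t₁) (A.s * θ)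
  have hy := toIcoMod_mem_Ico hpi (A.s * φ t₁) (A.s * θ)
  have hyθ : A.s * θ - toIcoDiv hpi (A.s * φ t₁) (A.s * θ) • (2 * Real.pi) = y := rfl
  obtain ⟨t, ht, hte⟩ := intermediate_value_Icc ht₁₀.le
    ((continuousOn_const.mul hφ.cont).mono hsub) (⟨hy.1, by linarith [hy.2]⟩ :
      y ∈ Icc (A.s * φ t₁) (A.s * φ t₀))
  replace hte : A.s * φ t = y := hte
  refine ⟨t, ht, ?_⟩
  rw [hφ.eq t (hsub ht)]
  obtain ⟨m, hm⟩ : ∃ m : ℤ, φ t = θ + m * (2 * Real.pi) := by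
    rw [zsmul_eq_mul] at hyθ
    rcases A.sign with h | h
    · refine ⟨-toIcoDiv hpi (A.s * φ t₁) (A.s * θ), ?_⟩
      push_cast
      rw [h] at hte hyθ ⊢
      linarith
    · refine ⟨toIcoDiv hpi (A.s * φ t₁) (A.s * θ), ?_⟩
      rw [h] at hte hyθ ⊢
      linarith
  rw [hm, exp_add_two_pi_int, norm_mul, Complex.norm_exp_ofReal_mul_I]
  simp

lemma eventually_norm_lt (A : Arm R) {ρ : ℝ} (hρ : 0 < ρ) :
    ∃ t₀ ∈ Ioo (0 : ℝ) 1, ∀ t ∈ Ioc 0 t₀, ‖A.g t‖ < ρ := by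
  have h := A.tendsto_norm.eventually (gt_mem_nhds hρ)
  obtain ⟨δ, hδ, H⟩ := mem_nhdsGT_iff_exists_Ioc_subset.1 h
  have hδ0 : (0 : ℝ) < δ := hδ
  refine ⟨min δ (1 / 2), ⟨by positivity, (min_le_right _ _).trans_lt (by norm_num)⟩, ?_⟩
  exact fun t ht => H ⟨ht.1, ht.2.trans (min_le_left _ _)⟩

lemma exists_norm_ge (A : Arm R) {t₀ : ℝ} (ht₀ : t₀ ∈ Ioc (0 : ℝ) 1) :
    ∃ ρ > 0, ∀ t ∈ Icc t₀ 1, ρ ≤ ‖A.g t‖ := by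
  have hsub : Icc t₀ 1 ⊆ Ioc 0 1 := fun x hx => ⟨ht₀.1.trans_le hx.1, hx.2⟩
  obtain ⟨t, ht, hmin⟩ := isCompact_Icc.exists_isMinOn ⟨t₀, le_rfl, ht₀.2⟩
    (A.contNorm.mono hsub)
  exact ⟨_, norm_pos_iff.2 (A.g_ne_zero (hsub ht)), fun x hx => hmin hx⟩

lemma ray_ratio {z w : ℂ} {θ : ℝ} (hz : z = ‖z‖ * Complex.exp (θ * Complex.I))
    (hw : w = ‖w‖ * Complex.exp (θ * Complex.I)) (hz0 : z ≠ 0) :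
    w = ((‖w‖ / ‖z‖ : ℝ) : ℂ) * z := by
  have : (‖z‖ : ℂ) ≠ 0 := by exact_mod_cast norm_ne_zero_iff.2 hz0
  conv_rhs => rw [hz]
  conv_lhs => rw [hw]
  push_cast
  rw [norm_mul, Complex.norm_exp_ofReal_mul_I]
  simp
  field_simp

/-- Below some parameter A is nearer to the vortex than the point of B at 1 / 2, and it still makes
a full turn there. -/
lemma Winding.exists_inner {A B : Arm R} {φ : ℝ → ℝ} (hφ : A.IsLift φ) (hw : A.Winding φ) :
    ∃ t₀ ∈ Ioo (0 : ℝ) 1, ∃ t₁ ∈ Icc (0 : ℝ) 1, ∃ c : ℝ, 0 < c ∧ c < 1 ∧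
      A.g t₁ = c * B.g t₀ := by
  have hB0 : B.g (1 / 2) ≠ 0 := B.g_ne_zero ⟨by norm_num, by norm_num⟩
  have hBn : 0 < ‖B.g (1 / 2)‖ := norm_pos_iff.2 hB0
  obtain ⟨t₀, ht₀, H⟩ := A.eventually_norm_lt hBn
  obtain ⟨t₁, ht₁, H₁⟩ := hw.exists_on_ray hφ ht₀
  obtain ⟨t, ht, hte⟩ := H₁ (B.g (1 / 2)).arg
  have ht0 : 0 < t := ht₁.1.trans_le ht.1
  have ht1 : t ≤ 1 := ht.2.trans ht₀.2.le
  refine ⟨1 / 2, by norm_num, t, ⟨ht0.le, ht1⟩, ‖A.g t‖ / ‖B.g (1 / 2)‖, ?_, ?_,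
    ray_ratio (Complex.norm_mul_exp_arg_mul_I _).symm hte hB0⟩
  · exact div_pos (norm_pos_iff.2 (A.g_ne_zero ⟨ht0, ht1⟩)) hBn
  · rw [div_lt_one hBn]; exact H t ⟨ht0, ht.2⟩

/-- A full turn of A away from the vortex keeps a positive distance from it, while B comes closer
than that. -/
lemma Winding.exists_outer {A B : Arm R} {φ : ℝ → ℝ} (hφ : A.IsLift φ) (hw : A.Winding φ) :
    ∃ t₀ ∈ Ioo (0 : ℝ) 1, ∃ t₁ ∈ Icc (0 : ℝ) 1, ∃ c : ℝ, 0 < c ∧ c < 1 ∧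
      B.g t₁ = c * A.g t₀ := by
  obtain ⟨t₁, ht₁, H₁⟩ := hw.exists_on_ray hφ (t₀ := 1 / 2) (by norm_num)
  obtain ⟨ρ, hρ, Hρ⟩ := A.exists_norm_ge (t₀ := t₁) ⟨ht₁.1, by linarith [ht₁.2]⟩
  obtain ⟨x, hx, Hx⟩ := B.eventually_norm_lt hρ
  have hB0 : B.g x ≠ 0 := B.g_ne_zero ⟨hx.1, hx.2.le⟩
  obtain ⟨t, ht, hte⟩ := H₁ (B.g x).arg
  have ht0 : 0 < t := ht₁.1.trans_le ht.1
  have ht1 : t < 1 := ht.2.trans_lt (by norm_num)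
  have hA0 : A.g t ≠ 0 := A.g_ne_zero ⟨ht0, ht1.le⟩
  have hAn : 0 < ‖A.g t‖ := norm_pos_iff.2 hA0
  refine ⟨t, ⟨ht0, ht1⟩, x, ⟨hx.1.le, hx.2.le⟩, ‖B.g x‖ / ‖A.g t‖, ?_, ?_,
    ray_ratio hte (Complex.norm_mul_exp_arg_mul_I _).symm hA0⟩
  · exact div_pos (norm_pos_iff.2 hB0) hAn
  · rw [div_lt_one hAn]; exact (Hx x ⟨hx.1, le_rfl⟩).trans_le (Hρ t ⟨ht.1, ht1.le⟩)

/-- A chord between the two arms inside of the component `U`, together with information about the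
component on the other side. -/
structure HasChord (A B : Arm R) (U : Set ℂ) (σ : ℝ) : Prop where
  sign : σ = 1 ∨ σ = -1
  chord : ∃ tp ∈ Ioo (0 : ℝ) 1, ∃ tq ∈ Ioo (0 : ℝ) 1, openSegment ℝ (A.g tp) (B.g tq) ⊆ U ∧
    0 < σ * cross (A.v tp) (B.g tq - A.g tp) ∧ 0 < σ * cross (B.v tq) (B.g tq - A.g tp)
  side₁ : A.HasSide σ U
  side₂ : B.HasSide (-σ) U
  -- V carries the two sides that U is not asserted to have. The last clause says that V is not
  -- proper if both arms curve towards it; this excludes a convex double spiral whose normals point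
  -- away from U.
  other : ∃ V, IsComp (region A B) V ∧ A.HasSide (-σ) V ∧ B.HasSide σ V ∧
    (A.s = -σ → B.s = σ → ¬ Proper V)

lemma HasChord.symm {A B : Arm R} {U : Set ℂ} {σ : ℝ} (h : HasChord A B U σ) :
    HasChord B A U (-σ) := by
  obtain ⟨hσ, ⟨tp, hp, tq, hq, hsub, h1, h2⟩, hs1, hs2, V, hV, hV1, hV2, hV3⟩ := h
  refine ⟨?_, ⟨tq, hq, tp, hp, ?_, ?_, ?_⟩, hs2, by rwa [neg_neg], V, region_comm A B ▸ hV,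
    by rwa [neg_neg], hV1, fun h1 h2 => hV3 h2 (by rw [h1, neg_neg])⟩
  · rcases hσ with rfl | rfl <;> simp
  · rwa [openSegment_symm]
  · rw [← neg_sub, cross_neg_right]; linarith
  · rw [← neg_sub, cross_neg_right]; linarith

/-- Rays give two chords, one with B inside of A and one with A inside of B, whose components carry
opposite pairs of sides. Together these are all four sides, so every component is one of the two. -/
lemma hasChord_of_winding {A B : Arm R} (hAB : Apart A B) {φ χ : ℝ → ℝ} (hφ : A.IsLift φ)
    (hχ : B.IsLift χ) (hw : A.Winding φ) {U : Set ℂ} (hU : IsComp (region A B) U) :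
    ∃ σ, HasChord A B U σ := by
  have hs : A.s = B.s := hw.sign_eq hAB hφ hχ
  have hBσ : B.s = 1 ∨ B.s = -1 := B.sign
  have hσ' : -B.s = 1 ∨ -B.s = -1 := by rcases hBσ with h | h <;> simp [h]
  -- chord from an outer point of `A`
  obtain ⟨t₀, h₀, t₁, h₁, c, hc0, hc1, he⟩ := hw.exists_outer (B := B) hφ
  obtain ⟨tp, hp, tq, hq, hseg, hx1, hx2⟩ := radial_chord hAB hs h₀ h₁ hc0 hc1 he
  rw [hs] at hx1 hx2
  obtain ⟨V, hV, hsV, hV1, hV2⟩ := connect hAB hBσ hp hq hseg hx1 hx2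
  -- chord from an outer point of `B`
  obtain ⟨t₀, h₀, t₁, h₁, c, hc0, hc1, he⟩ := hw.exists_inner (B := B) hφ
  obtain ⟨tq', hq', tp', hp', hseg', hy1, hy2⟩ := radial_chord hAB.symm hs.symm h₀ h₁ hc0 hc1 he
  rw [openSegment_symm, region_comm] at hseg'
  have hflip : A.g tp' - B.g tq' = -(B.g tq' - A.g tp') := by ring
  rw [hflip, cross_neg_right, mul_neg, ← neg_mul] at hy1 hy2
  obtain ⟨W, hW, hsW, hW1, hW2⟩ := connect hAB hσ' hp' hq' hseg' hy2 hy1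
  rw [neg_neg] at hW2
  -- The clause on properness of the other component is vacuous: the arms have the same sign, so
  -- they never curve towards a common component.
  have hcV : HasChord A B V B.s := ⟨hBσ, ⟨tp, hp, tq, hq, hsV, hx1, hx2⟩, hV1, hV2,
    W, hW, hW1, hW2, fun h => by
      rw [hs] at h
      rcases hBσ with h' | h' <;> rw [h'] at h <;> norm_num at h⟩
  have hcW : HasChord A B W (-B.s) := ⟨hσ', ⟨tp', hp', tq', hq', hsW, hy2, hy1⟩, hW1,
    by rwa [neg_neg], V, hV, by rwa [neg_neg], hV2, fun _ h => by
      rcases hBσ with h' | h' <;> rw [h'] at h <;> norm_num at h⟩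
  obtain ⟨σ, hσ, h⟩ := exists_hasSide hAB hU
  have hcases : σ = B.s ∨ σ = -B.s := by
    rcases hσ with rfl | rfl <;> rcases hBσ with h' | h' <;> rw [h'] <;> norm_num
  have hU' : IsComp (region B A) U := region_comm A B ▸ hU
  have hV' : IsComp (region B A) V := region_comm A B ▸ hV
  have hW' : IsComp (region B A) W := region_comm A B ▸ hW
  have : U = V ∨ U = W := by
    rcases h with h | h
    · rcases hcases with rfl | rfl
      · exact Or.inl (HasSide.eq hU hV hσ h hV1)
      · exact Or.inr (HasSide.eq hU hW hσ h hW1)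
    · rcases hcases with rfl | rfl
      · exact Or.inr (HasSide.eq hU' hW' hσ h hW2)
      · exact Or.inl (HasSide.eq hU' hV' hσ h hV2)
  rcases this with rfl | rfl
  · exact ⟨_, hcV⟩
  · exact ⟨_, hcW⟩

end Arm

/-! ### Arms with a limit direction: polar graphs near the vortex. -/

namespace Arm
variable {R : ℝ}

/-- The arm is given in polar coordinates near its vortex by the angle as a monotone function of
the radius. -/
structure IsTail (A : Arm R) (θ : ℝ → ℝ) (δ : ℝ) : Prop where
  cont : ContinuousOn θ (Ioo 0 δ)
  surj : ∀ r ∈ Ioo 0 δ, ∃ t ∈ Ioo (0 : ℝ) 1, ‖A.g t‖ = r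
  eq : ∀ t ∈ Icc (0 : ℝ) 1, ‖A.g t‖ ∈ Ioo 0 δ → A.g t = ‖A.g t‖ * Complex.exp (θ ‖A.g t‖ * Complex.I)
  mono : StrictMonoOn (fun r => A.s * θ r) (Ioo 0 δ)

lemma IsTail.anti {A : Arm R} {θ : ℝ → ℝ} {δ δ' : ℝ} (h : A.IsTail θ δ) (hδ : δ' ≤ δ) :
    A.IsTail θ δ' := by
  have hs : Ioo 0 δ' ⊆ Ioo 0 δ := Ioo_subset_Ioo_right hδ
  exact ⟨h.cont.mono hs, fun r hr => h.surj r (hs hr), fun t ht hr => h.eq t ht (hs hr),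
    h.mono.mono hs⟩

lemma IsTail.add_two_pi {A : Arm R} {θ : ℝ → ℝ} {δ : ℝ} (h : A.IsTail θ δ) (n : ℤ) :
    A.IsTail (fun r => θ r + n * (2 * Real.pi)) δ := by
  refine ⟨h.cont.add continuousOn_const, h.surj, fun t ht hr => ?_, ?_⟩
  · rw [exp_add_two_pi_int]; exact h.eq t ht hr
  · intro x hx y hy hxy
    have : A.s * θ x < A.s * θ y := h.mono hx hy hxy
    simp only [mul_add]
    linarith

/-- The angle times s decreases to a finite infimum m at the vortex, so after a rotation the arm
starts in an open quadrant along the real axis. Once Re v is positive near the vortex, monotonicity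
of the angle makes s * Im v positive too, and then ⟨g, v⟩ > 0: the distance from the vortex
increases. -/
lemma eventually_inner_pos (A : Arm R) {φ : ℝ → ℝ} (hφ : A.IsLift φ) (hw : ¬ A.Winding φ) :
    ∃ τ ∈ Ioo (0 : ℝ) 1, ∀ t ∈ Ioc 0 τ, 0 < cross (A.g t) (Complex.I * A.v t) := by
  unfold Winding at hw
  push Not at hw
  obtain ⟨M, hM⟩ := hw
  set I : Set ℝ := (fun t => A.s * φ t) '' Ioc 0 1
  have hbdd : BddBelow I := ⟨M, by rintro _ ⟨t, ht, rfl⟩; exact hM t ht⟩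
  set m := sInf I
  have hlow : ∀ t ∈ Ioc (0 : ℝ) 1, m < A.s * φ t := by
    intro t ht
    have ht2 : t / 2 ∈ Ioc (0 : ℝ) 1 := ⟨by linarith [ht.1], by linarith [ht.1, ht.2]⟩
    have h1 : m ≤ A.s * φ (t / 2) := csInf_le hbdd ⟨t / 2, ht2, rfl⟩
    have h2 : A.s * φ (t / 2) < A.s * φ t := hφ.mono ht2 ht (by linarith [ht.1])
    linarith
  obtain ⟨_, ⟨τ₀, hτ₀, rfl⟩, hτlt⟩ : ∃ y ∈ I, y < m + Real.pi / 2 :=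
    exists_lt_of_csInf_lt ⟨_, 1, ⟨one_pos, le_rfl⟩, rfl⟩ (by linarith [Real.pi_pos])
  have hup : ∀ t ∈ Ioc 0 τ₀, A.s * φ t < m + Real.pi / 2 := fun t ht =>
    (hφ.mono.monotoneOn ⟨ht.1, ht.2.trans hτ₀.2⟩ hτ₀ ht.2).trans_lt hτlt
  -- rotate the limit direction to the real axis
  set e : ℂ := Complex.exp (((-(A.s * m) : ℝ) : ℂ) * Complex.I) with he
  have hen : Complex.normSq e = 1 := by
    rw [Complex.normSq_eq_norm_sq, he, Complex.norm_exp_ofReal_mul_I]; norm_num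
  have hrot : ∀ z w : ℂ, cross (e * z) (e * w) = cross z w := by
    intro z w
    have : cross (e * z) (e * w) = Complex.normSq e * cross z w := by
      rw [Complex.normSq_apply]; simp [cross]; ring
    rw [this, hen, one_mul]
  have hss := A.s_mul_s
  have hG : ∀ t ∈ Ioc 0 τ₀, 0 < (e * A.g t).re ∧ 0 < A.s * (e * A.g t).im := by
    intro t ht
    have ht1 : t ∈ Ioc (0 : ℝ) 1 := ⟨ht.1, ht.2.trans hτ₀.2⟩
    have hn : 0 < ‖A.g t‖ := norm_pos_iff.2 (A.g_ne_zero ht1)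
    set α := A.s * φ t - m with hα
    have hα0 : 0 < α := by linarith [hlow t ht1]
    have hα1 : α < Real.pi / 2 := by linarith [hup t ht]
    have h1 : e * A.g t = ‖A.g t‖ * Complex.exp (((A.s * α : ℝ) : ℂ) * Complex.I) := by
      rw [hφ.eq t ht1, he]
      rw [norm_mul, Complex.norm_exp_ofReal_mul_I, mul_left_comm, ← Complex.exp_add]
      have h2 : ((-(A.s * m) : ℝ) : ℂ) * Complex.I + (φ t : ℂ) * Complex.I
          = ((A.s * α : ℝ) : ℂ) * Complex.I := by
        have h3 : A.s * α = -(A.s * m) + φ t := by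
          rw [hα, mul_sub, ← mul_assoc, hss]; ring
        rw [h3]; push_cast; ring
      rw [h2]; simp
    rw [h1]
    have hre : (‖A.g t‖ * Complex.exp (((A.s * α : ℝ) : ℂ) * Complex.I)).re
        = ‖A.g t‖ * Real.cos (A.s * α) := by
      rw [Complex.re_ofReal_mul, Complex.exp_ofReal_mul_I_re]
    have him : (‖A.g t‖ * Complex.exp (((A.s * α : ℝ) : ℂ) * Complex.I)).im
        = ‖A.g t‖ * Real.sin (A.s * α) := by
      rw [Complex.im_ofReal_mul, Complex.exp_ofReal_mul_I_im]
    rw [hre, him]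
    have hcos : 0 < Real.cos α := Real.cos_pos_of_mem_Ioo ⟨by linarith, hα1⟩
    have hsin : 0 < Real.sin α := Real.sin_pos_of_pos_of_lt_pi hα0 (by linarith)
    rcases A.sign with h | h
    · rw [h]; simp only [one_mul]; constructor <;> positivity
    · rw [h]; simp only [neg_one_mul, Real.cos_neg, Real.sin_neg]
      constructor
      · positivity
      · have : 0 < ‖A.g t‖ * Real.sin α := by positivity
        linarith
  have hcr : ∀ t ∈ Ioc (0 : ℝ) 1, 0 < A.s * cross (e * A.g t) (e * A.v t) := fun t ht => by
    rw [hrot]; exact A.cross_pos ht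
  have hcu : ∀ t ∈ Ioc (0 : ℝ) 1, 0 < A.s * cross (e * A.v t) (e * A.a t) := fun t ht => by
    rw [hrot]; exact A.curv t (A.mem_of_Ioc ht)
  have hvd : ∀ t ∈ Ioc (0 : ℝ) 1, HasDerivAt (fun t => (e * A.v t).re) (e * A.a t).re t :=
    fun t ht => ((A.hasDerivAt_v t (A.mem_of_Ioc ht)).const_mul e).re_comp
  have hgd : ∀ t ∈ Ioc (0 : ℝ) 1, HasDerivAt (fun t => (e * A.g t).re) (e * A.v t).re t :=
    fun t ht => ((A.hasDerivAt t (A.mem_of_Ioc ht)).const_mul e).re_comp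
  have hsub : Ioc 0 τ₀ ⊆ Ioc 0 1 := fun t ht => ⟨ht.1, ht.2.trans hτ₀.2⟩
  -- Re v cannot change from nonpositive to positive: at the last such parameter z, Re v = 0, the
  -- monotone angle forces s * Im v > 0, and the curvature then makes Re a < 0, so Re v is negative
  -- just after z.
  have hupward : ∀ x y, 0 < x → x < y → y ≤ τ₀ → (e * A.v x).re ≤ 0 → (e * A.v y).re ≤ 0 := by
    intro x y hx hxy hy hxv
    by_contra! hyv
    have hIcc : Icc x y ⊆ Ioc 0 τ₀ := fun z hz => ⟨hx.trans_le hz.1, hz.2.trans hy⟩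
    have hvc : ContinuousOn (fun t => (e * A.v t).re) (Icc x y) := fun z hz =>
      (hvd z (hsub (hIcc hz))).continuousAt.continuousWithinAt
    have hK : IsCompact (Icc x y ∩ (fun t => (e * A.v t).re) ⁻¹' Iic 0) :=
      isCompact_Icc.of_isClosed_subset
        (hvc.preimage_isClosed_of_isClosed isClosed_Icc isClosed_Iic) inter_subset_left
    obtain ⟨z, ⟨hz, hz0⟩, hzmax⟩ := hK.exists_isGreatest ⟨x, ⟨le_rfl, hxy.le⟩, hxv⟩
    simp only [mem_preimage, mem_Iic] at hz0
    have hzy : z < y := lt_of_le_of_ne hz.2 (by rintro rfl; linarith)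
    have hright : ∀ u ∈ Ioc z y, 0 < (e * A.v u).re := by
      intro u hu
      by_contra! h
      have := hzmax ⟨⟨hz.1.trans hu.1.le, hu.2⟩, h⟩
      linarith [hu.1]
    have hev : ∀ᶠ u in 𝓝[>] z, u ∈ Ioc z y := Ioc_mem_nhdsGT hzy
    have hz1 := hsub (hIcc hz)
    have hzge : 0 ≤ (e * A.v z).re := by
      have ht : Tendsto (fun t => (e * A.v t).re) (𝓝[>] z) (𝓝 (e * A.v z).re) :=
        (hvd z hz1).continuousAt.tendsto.mono_left nhdsWithin_le_nhds
      exact ge_of_tendsto ht (hev.mono fun u hu => (hright u hu).le)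
    have hzz : (e * A.v z).re = 0 := le_antisymm hz0 hzge
    have h1 := hcr z hz1
    have h2 := hcu z hz1
    have h3 := (hG z (hIcc hz)).1
    unfold cross at h1 h2
    rw [hzz] at h1 h2
    have h4 : 0 < A.s * (e * A.v z).im := by
      have : 0 < (e * A.g z).re * (A.s * (e * A.v z).im) := by linarith
      exact pos_of_mul_pos_right this h3.le
    have h5 : (e * A.a z).re < 0 := by
      have : 0 < (A.s * (e * A.v z).im) * (-(e * A.a z).re) := by linarith
      linarith [pos_of_mul_pos_right this h4.le]
    obtain ⟨u, hu1, hu2⟩ := (((hvd z hz1).eventually_neg_right hzz h5).and hev).exists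
    linarith [hright u hu2]
  -- Otherwise Re v ≤ 0 all the way from the vortex, and Re g, which is 0 there, could not become
  -- positive.
  obtain ⟨τ, hτ, hτpos⟩ : ∃ τ ∈ Ioo 0 τ₀, ∀ t ∈ Ioc 0 τ, 0 < (e * A.v t).re := by
    by_contra! hcon
    have hall : ∀ t ∈ Ioo 0 τ₀, (e * A.v t).re ≤ 0 := by
      intro t ht
      obtain ⟨x, hx, hxv⟩ := hcon t ht
      rcases hx.2.eq_or_lt with rfl | hlt
      · exact hxv
      · exact hupward x t hx.1 hlt ht.2.le hxv
    have hc : ContinuousOn (fun t => -(e * A.g t).re) (Icc 0 (τ₀ / 2)) := by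
      have h1 : ContinuousOn A.g (Icc 0 (τ₀ / 2)) := A.cont.mono
        (Icc_subset_Icc_right (by linarith [hτ₀.1, hτ₀.2]))
      exact (Complex.continuous_re.comp_continuousOn (continuousOn_const.mul h1)).neg
    have := le_of_hasDerivAt_nonneg (f := fun t => -(e * A.g t).re)
      (f' := fun t => -(e * A.v t).re) (by linarith [hτ₀.1] : (0 : ℝ) ≤ τ₀ / 2) hc
      (fun t ht => (hgd t ⟨ht.1, by linarith [ht.2, hτ₀.1, hτ₀.2]⟩).neg)
      (fun t ht => by linarith [hall t ⟨ht.1, by linarith [ht.2, hτ₀.1]⟩])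
    simp only [A.zero, mul_zero, Complex.zero_re, neg_zero] at this
    linarith [(hG (τ₀ / 2) ⟨by linarith [hτ₀.1], by linarith [hτ₀.1]⟩).1]
  refine ⟨τ, ⟨hτ.1, hτ.2.trans_le hτ₀.2⟩, fun t ht => ?_⟩
  have htm : t ∈ Ioc 0 τ₀ := ⟨ht.1, ht.2.trans hτ.2.le⟩
  obtain ⟨hx, hy⟩ := hG t htm
  have hxv := hτpos t ht
  have h1 := hcr t (hsub htm)
  have e1 : cross (A.g t) (Complex.I * A.v t)
      = (e * A.g t).re * (e * A.v t).re + (e * A.g t).im * (e * A.v t).im := by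
    rw [← hrot, mul_left_comm, cross_I_mul]
  rw [e1]
  unfold cross at h1
  have h4 : 0 < A.s * (e * A.v t).im := by
    have h6 : 0 < (A.s * (e * A.g t).im) * (e * A.v t).re := mul_pos hy hxv
    have h7 : 0 < (e * A.g t).re * (A.s * (e * A.v t).im) := by linarith
    exact pos_of_mul_pos_right h7 hx.le
  have h8 : (e * A.g t).im * (e * A.v t).im
      = (A.s * (e * A.g t).im) * (A.s * (e * A.v t).im) := by
    linear_combination (-(e * A.g t).im * (e * A.v t).im) * hss
  rw [h8]
  positivity

/-- The radius increases strictly near the vortex and can be inverted, which turns the monotone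
angle into a monotone function of the radius. -/
lemma exists_tail (A : Arm R) {φ : ℝ → ℝ} (hφ : A.IsLift φ) (hw : ¬ A.Winding φ) :
    ∃ θ δ, 0 < δ ∧ A.IsTail θ δ := by
  obtain ⟨τ, hτ, hpos⟩ := A.eventually_inner_pos hφ hw
  have hsub : Ioc 0 τ ⊆ Ioc 0 1 := fun t ht => ⟨ht.1, ht.2.trans hτ.2.le⟩
  have hrm : StrictMonoOn (fun t => ‖A.g t‖) (Ioc 0 τ) := by
    intro x hx y hy hxy
    have hIcc : Icc x y ⊆ Ioc 0 τ := fun z hz => ⟨hx.1.trans_le hz.1, hz.2.trans hy.2⟩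
    have := lt_of_hasDerivAt_pos (f := fun t => (A.g t).re * (A.g t).re + (A.g t).im * (A.g t).im)
      (f' := fun t => 2 * cross (A.g t) (Complex.I * A.v t)) hxy ?_ ?_ ?_
    · simp only [← Complex.normSq_apply, Complex.normSq_eq_norm_sq] at this
      exact lt_of_pow_lt_pow_left₀ 2 (norm_nonneg _) this
    · have : ContinuousOn A.g (Icc x y) := A.cont.mono fun z hz =>
        Ioc_subset_Icc_self (hsub (hIcc hz))
      have h1 := Complex.continuous_re.comp_continuousOn this
      have h2 := Complex.continuous_im.comp_continuousOn this
      exact (h1.mul h1).add (h2.mul h2)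
    · intro t ht
      have hg := A.hasDerivAt t (A.mem_of_Ioc (hsub (hIcc (Ioo_subset_Icc_self ht))))
      refine ((hg.re_comp.mul hg.re_comp).add (hg.im_comp.mul hg.im_comp)).congr_deriv ?_
      rw [cross_I_mul]; ring
    · intro t ht
      have := hpos t (hIcc (Ioo_subset_Icc_self ht))
      positivity
  obtain ⟨T, hTc, hT⟩ := hrm.exists_continuousOn_inverse ordConnected_Ioc (A.contNorm.mono hsub)
  -- The rest of the arm stays outside radius δ, so within this radius the arm is nothing but the
  -- polar graph.
  obtain ⟨δ, hδ, hδle⟩ := A.exists_norm_ge (t₀ := τ) ⟨hτ.1, hτ.2.le⟩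
  have hsurj : ∀ r ∈ Ioo 0 δ, ∃ t ∈ Ioo 0 τ, ‖A.g t‖ = r := by
    intro r hr
    obtain ⟨x, hx, Hx⟩ := A.eventually_norm_lt hr.1
    have h1 : ‖A.g (min x τ)‖ < r := Hx _ ⟨lt_min hx.1 hτ.1, min_le_left _ _⟩
    have h2 : r < ‖A.g τ‖ := hr.2.trans_le (hδle τ ⟨le_rfl, hτ.2.le⟩)
    have hIcc : Icc (min x τ) τ ⊆ Ioc 0 τ := fun z hz => ⟨(lt_min hx.1 hτ.1).trans_le hz.1, hz.2⟩
    obtain ⟨t, ht, hte⟩ := intermediate_value_Icc (min_le_right x τ)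
      ((A.contNorm.mono hsub).mono hIcc) ⟨h1.le, h2.le⟩
    simp only at hte
    refine ⟨t, ⟨(hIcc ht).1, lt_of_le_of_ne ht.2 ?_⟩, hte⟩
    rintro rfl
    linarith
  have himg : Ioo 0 δ ⊆ (fun t => ‖A.g t‖) '' Ioc 0 τ := fun r hr => by
    obtain ⟨t, ht, hte⟩ := hsurj r hr
    exact ⟨t, Ioo_subset_Ioc_self ht, hte⟩
  have hTmem : ∀ r ∈ Ioo 0 δ, T r ∈ Ioc 0 τ := by
    intro r hr
    obtain ⟨t, ht, rfl⟩ := himg hr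
    simp only
    rw [hT t ht]; exact ht
  refine ⟨fun r => φ (T r), δ, hδ, ?_, ?_, ?_, ?_⟩
  · apply (hφ.cont.mono hsub).comp (hTc.mono himg) hTmem
  · intro r hr
    obtain ⟨t, ht, hte⟩ := hsurj r hr
    exact ⟨t, ⟨ht.1, ht.2.trans hτ.2⟩, hte⟩
  · intro t ht hr
    have htτ : t ∈ Ioc 0 τ := by
      refine ⟨lt_of_le_of_ne ht.1 ?_, ?_⟩
      · rintro rfl
        rw [A.zero, norm_zero] at hr
        exact lt_irrefl _ hr.1
      · by_contra! h
        linarith [hδle t ⟨h.le, ht.2⟩, hr.2]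
    rw [hT t htτ]
    exact hφ.eq t (hsub htτ)
  · intro x hx y hy hxy
    obtain ⟨t, ht, rfl⟩ := himg hx
    obtain ⟨t', ht', rfl⟩ := himg hy
    simp only at hxy ⊢
    rw [hT t ht, hT t' ht']
    exact hφ.mono (hsub ht) (hsub ht') ((hrm.lt_iff_lt ht ht').1 hxy)

end Arm

/-! ### The sectors between two polar graphs. -/

/-- The sector between the polar curves `θ₁` and `θ₂`. -/
def sector (θ₁ θ₂ : ℝ → ℝ) (δ : ℝ) : Set ℂ :=
  {z | ∃ r ∈ Ioo 0 δ, ∃ θ ∈ Ioo (θ₁ r) (θ₂ r), z = r * Complex.exp (θ * Complex.I)}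

lemma exp_eq_iff_int {x y : ℝ}
    (h : Complex.exp (x * Complex.I) = Complex.exp (y * Complex.I)) :
    ∃ n : ℤ, x = y + n * (2 * Real.pi) := by
  obtain ⟨n, hn⟩ := Complex.exp_eq_exp_iff_exists_int.1 h
  refine ⟨n, ?_⟩
  have := congrArg Complex.im hn
  simpa using this

lemma polar_inj {r r' x y : ℝ} (hr : 0 < r) (hr' : 0 < r')
    (h : (r : ℂ) * Complex.exp (x * Complex.I) = r' * Complex.exp (y * Complex.I)) :
    r = r' ∧ ∃ n : ℤ, x = y + n * (2 * Real.pi) := by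
  have hn := congrArg norm h
  rw [norm_mul, norm_mul, Complex.norm_exp_ofReal_mul_I, Complex.norm_exp_ofReal_mul_I,
    Complex.norm_real, Complex.norm_real, Real.norm_of_nonneg hr.le, Real.norm_of_nonneg hr'.le,
    mul_one, mul_one] at hn
  subst hn
  refine ⟨rfl, exp_eq_iff_int (mul_left_cancel₀ ?_ h)⟩
  exact_mod_cast hr.ne'

namespace Arm
variable {R : ℝ}

/-- The polar curves near the vortex, in order. -/
structure Tails (A B : Arm R) (θ₁ θ₂ : ℝ → ℝ) (δ : ℝ) : Prop where
  pos : 0 < δ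
  leR : δ ≤ R
  tail₁ : A.IsTail θ₁ δ
  tail₂ : B.IsTail θ₂ δ
  lt : ∀ r ∈ Ioo 0 δ, θ₁ r < θ₂ r
  lt' : ∀ r ∈ Ioo 0 δ, θ₂ r < θ₁ r + 2 * Real.pi

lemma Tails.symm {A B : Arm R} {θ₁ θ₂ : ℝ → ℝ} {δ : ℝ} (h : Tails A B θ₁ θ₂ δ) :
    Tails B A θ₂ (fun r => θ₁ r + 2 * Real.pi) δ := by
  refine ⟨h.pos, h.leR, h.tail₂, ?_, h.lt', fun r hr => by have := h.lt r hr; linarith⟩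
  have := h.tail₁.add_two_pi 1
  simpa using this

/-- The arms are disjoint away from the vortex, so θ₁ and θ₂ never agree modulo 2π. Normalising θ₂
by full turns at one radius therefore fixes the order at all radii. -/
lemma exists_tails {A B : Arm R} (hAB : Apart A B) {θ₁ θ₂ : ℝ → ℝ} {δ₁ δ₂ : ℝ} (hδ₁ : 0 < δ₁)
    (hδ₂ : 0 < δ₂) (h₁ : A.IsTail θ₁ δ₁) (h₂ : B.IsTail θ₂ δ₂) :
    ∃ θ₁ θ₂ δ, Tails A B θ₁ θ₂ δ := by
  set δ := min (min δ₁ δ₂) R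
  have hδ : 0 < δ := lt_min (lt_min hδ₁ hδ₂) A.R_pos
  replace h₁ := h₁.anti (show δ ≤ δ₁ from (min_le_left _ _).trans (min_le_left _ _))
  replace h₂ := h₂.anti (show δ ≤ δ₂ from (min_le_left _ _).trans (min_le_right _ _))
  have hpi : (0 : ℝ) < 2 * Real.pi := by positivity
  have hne : ∀ r ∈ Ioo 0 δ, ∀ n : ℤ, θ₂ r + n * (2 * Real.pi) ≠ θ₁ r := by
    intro r hr n hn
    obtain ⟨t, ht, hte⟩ := h₁.surj r hr
    obtain ⟨t', ht', hte'⟩ := h₂.surj r hr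
    refine hAB.ne ⟨ht.1, ht.2.le⟩ (Ioo_subset_Icc_self ht') ?_
    rw [h₁.eq t (Ioo_subset_Icc_self ht) (by rwa [hte]),
      h₂.eq t' (Ioo_subset_Icc_self ht') (by rwa [hte']), hte, hte', ← hn, exp_add_two_pi_int]
  have hr₀ : δ / 2 ∈ Ioo 0 δ := ⟨by positivity, by linarith⟩
  set n := -toIcoDiv hpi (θ₁ (δ / 2)) (θ₂ (δ / 2)) with hn
  have hmem := toIcoMod_mem_Ico hpi (θ₁ (δ / 2)) (θ₂ (δ / 2))
  have heq : toIcoMod hpi (θ₁ (δ / 2)) (θ₂ (δ / 2)) = θ₂ (δ / 2) + n * (2 * Real.pi) := by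
    rw [toIcoMod, zsmul_eq_mul, hn]; push_cast; ring
  rw [heq] at hmem
  have hc : ContinuousOn (fun r => θ₂ r + n * (2 * Real.pi) - θ₁ r) (Ioo 0 δ) :=
    (h₂.cont.add continuousOn_const).sub h₁.cont
  have hlt : ∀ r ∈ Ioo 0 δ, θ₁ r < θ₂ r + n * (2 * Real.pi) := by
    intro r hr
    by_contra! h
    obtain ⟨x, hx, hxe⟩ := isPreconnected_Ioo.intermediate_value hr hr₀ hc
      (⟨by linarith, by linarith [hmem.1]⟩ : (0 : ℝ) ∈ Icc _ _)
    exact hne x hx n (by simp only at hxe; linarith)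
  refine ⟨θ₁, fun r => θ₂ r + n * (2 * Real.pi), δ, hδ, min_le_right _ _, h₁, h₂.add_two_pi n,
    hlt, ?_⟩
  intro r hr
  by_contra! h
  obtain ⟨x, hx, hxe⟩ := isPreconnected_Ioo.intermediate_value hr₀ hr hc
      (⟨by linarith [hmem.2], by linarith⟩ : 2 * Real.pi ∈ Icc _ _)
  refine hne x hx (n - 1) ?_
  push_cast
  simp only at hxe
  linarith

variable {A B : Arm R} {θ₁ θ₂ : ℝ → ℝ} {δ : ℝ}

lemma Tails.sector_subset (h : Tails A B θ₁ θ₂ δ) : sector θ₁ θ₂ δ ⊆ region A B := by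
  rintro z ⟨r, hr, θ, hθ, rfl⟩
  have hn : ‖(r : ℂ) * Complex.exp (θ * Complex.I)‖ = r := by
    rw [norm_mul, Complex.norm_exp_ofReal_mul_I, Complex.norm_real, Real.norm_of_nonneg hr.1.le,
      mul_one]
  have hlt := h.lt' r hr
  refine ⟨by rw [mem_closedBall_zero_iff, hn]; exact hr.2.le.trans h.leR, ?_⟩
  rintro (⟨t, ht, hte⟩ | ⟨t, ht, hte⟩)
  · have hnt : ‖A.g t‖ = r := by rw [hte, hn]
    have h1 := h.tail₁.eq t ht (by rwa [hnt])
    rw [hte, hn] at h1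
    obtain ⟨-, n, h2⟩ := polar_inj hr.1 hr.1 h1
    have h3 : (0 : ℝ) < n := by
      by_contra! hcon
      nlinarith [hθ.1, Real.pi_pos]
    have h4 : (n : ℝ) < 1 := by
      by_contra! hcon
      nlinarith [hθ.2, Real.pi_pos]
    have h5 : 0 < n := by exact_mod_cast h3
    have h6 : n < 1 := by exact_mod_cast h4
    omega
  · have hnt : ‖B.g t‖ = r := by rw [hte, hn]
    have h1 := h.tail₂.eq t ht (by rwa [hnt])
    rw [hte, hn] at h1
    obtain ⟨-, n, h2⟩ := polar_inj hr.1 hr.1 h1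
    have h3 : (n : ℝ) < 0 := by
      by_contra! hcon
      nlinarith [hθ.2, Real.pi_pos]
    have h4 : (-1 : ℝ) < n := by
      by_contra! hcon
      nlinarith [hθ.1, Real.pi_pos]
    have h5 : n < 0 := by exact_mod_cast h3
    have h6 : -1 < n := by exact_mod_cast h4
    omega

lemma Tails.isPreconnected_sector (h : Tails A B θ₁ θ₂ δ) : IsPreconnected (sector θ₁ θ₂ δ) := by
  have : sector θ₁ θ₂ δ = (fun p : ℝ × ℝ => (p.1 : ℂ) *
      Complex.exp ((((1 - p.2) * θ₁ p.1 + p.2 * θ₂ p.1 : ℝ) : ℂ) * Complex.I)) ''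
      (Ioo 0 δ ×ˢ Ioo 0 1) := by
    ext z
    constructor
    · rintro ⟨r, hr, θ, hθ, rfl⟩
      have hlt := h.lt r hr
      refine ⟨(r, (θ - θ₁ r) / (θ₂ r - θ₁ r)), ⟨hr, ?_, ?_⟩, ?_⟩
      · exact div_pos (by linarith [hθ.1]) (by linarith)
      · rw [div_lt_one (by linarith)]; linarith [hθ.2]
      · have : (1 - (θ - θ₁ r) / (θ₂ r - θ₁ r)) * θ₁ r + (θ - θ₁ r) / (θ₂ r - θ₁ r) * θ₂ r = θ := by
          have : θ₂ r - θ₁ r ≠ 0 := by linarith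
          field_simp
          ring
        simp only [this]
    · rintro ⟨⟨r, u⟩, ⟨hr, hu⟩, rfl⟩
      have hlt := h.lt r hr
      simp only at hu hr hlt
      refine ⟨r, hr, _, ⟨?_, ?_⟩, rfl⟩
      · nlinarith [hu.1]
      · nlinarith [hu.2]
  rw [this]
  apply (isPreconnected_Ioo.prod isPreconnected_Ioo).image
  have h1 : ContinuousOn (fun p : ℝ × ℝ => θ₁ p.1) (Ioo 0 δ ×ˢ Ioo (0 : ℝ) 1) :=
    h.tail₁.cont.comp continuousOn_fst fun p hp => hp.1
  have h2 : ContinuousOn (fun p : ℝ × ℝ => θ₂ p.1) (Ioo 0 δ ×ˢ Ioo (0 : ℝ) 1) :=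
    h.tail₂.cont.comp continuousOn_fst fun p hp => hp.1
  refine (Complex.continuous_ofReal.comp_continuousOn continuousOn_fst).mul
    (Complex.continuous_exp.comp_continuousOn
      ((Complex.continuous_ofReal.comp_continuousOn ?_).mul continuousOn_const))
  exact ((continuousOn_const.sub continuousOn_snd).mul h1).add (continuousOn_snd.mul h2)

lemma exists_radius (A : Arm R) {θ : ℝ → ℝ} {δ : ℝ} (hδ : 0 < δ) (h : A.IsTail θ δ) :
    ∃ t ∈ Ioo (0 : ℝ) 1, ∃ r ∈ Ioo 0 δ, ‖A.g t‖ = r ∧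
      A.g t = r * Complex.exp (θ r * Complex.I) := by
  have hr₀ : δ / 2 ∈ Ioo 0 δ := ⟨by positivity, by linarith⟩
  obtain ⟨t, ht, hte⟩ := h.surj _ hr₀
  refine ⟨t, ht, δ / 2, hr₀, hte, ?_⟩
  have := h.eq t (Ioo_subset_Icc_self ht) (by rwa [hte])
  rwa [hte] at this

/-- Since s * θ₁ increases with the radius, moving a point of A radially by a small multiple of -s *
g keeps its angle but lowers θ₁ at its radius, so it enters the sector. By `cross_pos` this
direction points to the side 1 of A. -/
lemma Tails.hasSide_left (hAB : Apart A B) (h : Tails A B θ₁ θ₂ δ) {V : Set ℂ}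
    (hV : IsComp (region A B) V) (hs : sector θ₁ θ₂ δ ⊆ V) : A.HasSide 1 V := by
  obtain ⟨t, ht, r, hr, hte, hte'⟩ := A.exists_radius h.pos h.tail₁
  suffices A.SideIn 1 t V from fun t' ht' => this.const hAB hV (Or.inl rfl) ht ht'
  refine sideIn_of_frequently hAB hV (Or.inl rfl) ht (w := ((-A.s : ℝ) : ℂ) * A.g t) ?_ ?_
  · rw [cross_real_mul_right, cross_swap, one_mul]
    have := A.cross_pos (Ioo_subset_Ioc_self ht)
    linarith
  have hc : ContinuousAt (fun x : ℝ => (1 - A.s * x) * r) 0 := by fun_prop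
  have h0 : (1 - A.s * 0) * r = r := by ring
  have e1 : ∀ᶠ x : ℝ in 𝓝 0, (1 - A.s * x) * r ∈ Ioo 0 δ := by
    apply hc.eventually
    beta_reduce
    rw [h0]; exact Ioo_mem_nhds hr.1 hr.2
  have hθc : ContinuousAt (fun x : ℝ => θ₂ ((1 - A.s * x) * r)) 0 := by
    apply ContinuousAt.comp (f := fun x : ℝ => (1 - A.s * x) * r) (x := 0) _ hc
    rw [h0]
    exact h.tail₂.cont.continuousAt (Ioo_mem_nhds hr.1 hr.2)
  have e2 : ∀ᶠ x : ℝ in 𝓝 0, θ₁ r < θ₂ ((1 - A.s * x) * r) := by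
    apply hθc.eventually
    beta_reduce
    rw [h0]
    exact lt_mem_nhds (h.lt r hr)
  have e3 : ∀ᶠ x : ℝ in 𝓝[>] 0, (1 - A.s * x) * r ∈ Ioo 0 δ ∧ θ₁ r < θ₂ ((1 - A.s * x) * r) ∧
      0 < x := by
    filter_upwards [(e1.and e2).filter_mono nhdsWithin_le_nhds, self_mem_nhdsWithin] with x hx hx0
    exact ⟨hx.1, hx.2, hx0⟩
  refine (e3.mono fun x hx => hs ⟨(1 - A.s * x) * r, hx.1, θ₁ r, ⟨?_, hx.2.1⟩, ?_⟩).frequently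
  · rcases A.sign with h' | h'
    · have h4 : A.s * θ₁ ((1 - A.s * x) * r) < A.s * θ₁ r := h.tail₁.mono hx.1 hr (by
        rw [h']; nlinarith [hx.2.2, hr.1])
      rw [h'] at h4 ⊢; linarith
    · have h4 : A.s * θ₁ r < A.s * θ₁ ((1 - A.s * x) * r) := h.tail₁.mono hr hx.1 (by
        rw [h']; nlinarith [hx.2.2, hr.1])
      rw [h'] at h4 ⊢; linarith
  · rw [hte']; push_cast; ring

lemma Tails.hasSide_right (hAB : Apart A B) (h : Tails A B θ₁ θ₂ δ) {V : Set ℂ}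
    (hV : IsComp (region A B) V) (hs : sector θ₁ θ₂ δ ⊆ V) : B.HasSide (-1) V := by
  have hV' : IsComp (region B A) V := region_comm A B ▸ hV
  obtain ⟨t, ht, r, hr, hte, hte'⟩ := B.exists_radius h.pos h.tail₂
  suffices B.SideIn (-1) t V from fun t' ht' => this.const hAB.symm hV' (Or.inr rfl) ht ht'
  refine sideIn_of_frequently hAB.symm hV' (Or.inr rfl) ht (w := (B.s : ℂ) * B.g t) ?_ ?_
  · rw [cross_real_mul_right, cross_swap]
    have := B.cross_pos (Ioo_subset_Ioc_self ht)
    linarith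
  have hc : ContinuousAt (fun x : ℝ => (1 + B.s * x) * r) 0 := by fun_prop
  have h0 : (1 + B.s * 0) * r = r := by ring
  have e1 : ∀ᶠ x : ℝ in 𝓝 0, (1 + B.s * x) * r ∈ Ioo 0 δ := by
    apply hc.eventually
    beta_reduce
    rw [h0]; exact Ioo_mem_nhds hr.1 hr.2
  have hθc : ContinuousAt (fun x : ℝ => θ₁ ((1 + B.s * x) * r)) 0 := by
    apply ContinuousAt.comp (f := fun x : ℝ => (1 + B.s * x) * r) (x := 0) _ hc
    rw [h0]
    exact h.tail₁.cont.continuousAt (Ioo_mem_nhds hr.1 hr.2)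
  have e2 : ∀ᶠ x : ℝ in 𝓝 0, θ₁ ((1 + B.s * x) * r) < θ₂ r := by
    refine hθc.eventually (p := fun y => y < θ₂ r) ?_
    beta_reduce
    rw [h0]
    exact gt_mem_nhds (h.lt r hr)
  have e3 : ∀ᶠ x : ℝ in 𝓝[>] 0, (1 + B.s * x) * r ∈ Ioo 0 δ ∧ θ₁ ((1 + B.s * x) * r) < θ₂ r ∧
      0 < x := by
    filter_upwards [(e1.and e2).filter_mono nhdsWithin_le_nhds, self_mem_nhdsWithin] with x hx hx0
    exact ⟨hx.1, hx.2, hx0⟩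
  refine (e3.mono fun x hx => hs ⟨(1 + B.s * x) * r, hx.1, θ₂ r, ⟨hx.2.1, ?_⟩, ?_⟩).frequently
  · rcases B.sign with h' | h'
    · have h4 : B.s * θ₂ r < B.s * θ₂ ((1 + B.s * x) * r) := h.tail₂.mono hr hx.1 (by
        rw [h']; nlinarith [hx.2.2, hr.1])
      rw [h'] at h4 ⊢; linarith
    · have h4 : B.s * θ₂ ((1 + B.s * x) * r) < B.s * θ₂ r := h.tail₂.mono hx.1 hr (by
        rw [h']; nlinarith [hx.2.2, hr.1])
      rw [h'] at h4 ⊢; linarith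
  · rw [hte']; push_cast; ring

/-- The line in the direction β = sup θ₁ fits: the rays at the angles β and β + π lie between the
two graphs within radius δ'. -/
lemma Tails.not_proper (hAB : Apart A B) (h : Tails A B θ₁ θ₂ δ) {V : Set ℂ}
    (hV : IsComp (region A B) V) (hs : sector θ₁ θ₂ δ ⊆ V) {δ' : ℝ} (hδ' : 0 < δ') (hle : δ' ≤ δ)
    (hpi : ∀ r ∈ Ioo 0 δ', ∀ r' ∈ Ioo 0 δ', Real.pi ≤ θ₂ r' - θ₁ r) : ¬ Proper V := by
  have hsub : Ioo 0 δ' ⊆ Ioo 0 δ := Ioo_subset_Ioo_right hle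
  have hr₀ : δ' / 2 ∈ Ioo 0 δ' := ⟨by positivity, by linarith⟩
  set β := sSup (θ₁ '' Ioo 0 δ')
  have hub : ∀ r' ∈ Ioo 0 δ', θ₂ r' - Real.pi ∈ upperBounds (θ₁ '' Ioo 0 δ') := by
    rintro r' hr' _ ⟨r, hr, rfl⟩
    linarith [hpi r hr r' hr']
  have hbdd : BddAbove (θ₁ '' Ioo 0 δ') := ⟨_, hub _ hr₀⟩
  have hne : (θ₁ '' Ioo 0 δ').Nonempty := ⟨_, _, hr₀, rfl⟩
  have hle1 : ∀ r ∈ Ioo 0 δ', θ₁ r ≤ β := fun r hr => le_csSup hbdd ⟨r, hr, rfl⟩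
  have hle2 : ∀ r ∈ Ioo 0 δ', β + Real.pi ≤ θ₂ r := fun r hr => by
    linarith [csSup_le hne (hub r hr)]
  have hsm : ∀ r ∈ Ioo 0 δ', r / 2 ∈ Ioo 0 δ' ∧ r / 2 < r := fun r hr =>
    ⟨⟨by linarith [hr.1], by linarith [hr.1, hr.2]⟩, by linarith [hr.1]⟩
  have hbig : ∀ r ∈ Ioo 0 δ', (r + δ') / 2 ∈ Ioo 0 δ' ∧ r < (r + δ') / 2 := fun r hr =>
    ⟨⟨by linarith [hr.1], by linarith [hr.2]⟩, by linarith [hr.2]⟩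
  -- A strictly monotone function on an open interval does not attain its supremum, so the rays
  -- avoid the graphs themselves.
  have hlt1 : ∀ r ∈ Ioo 0 δ', θ₁ r < β := by
    intro r hr
    obtain ⟨h1, h2⟩ := hsm r hr
    obtain ⟨h3, h4⟩ := hbig r hr
    rcases A.sign with h' | h'
    · have : A.s * θ₁ r < A.s * θ₁ ((r + δ') / 2) := h.tail₁.mono (hsub hr) (hsub h3) h4
      rw [h'] at this
      linarith [hle1 _ h3]
    · have : A.s * θ₁ (r / 2) < A.s * θ₁ r := h.tail₁.mono (hsub h1) (hsub hr) h2
      rw [h'] at this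
      linarith [hle1 _ h1]
  have hlt2 : ∀ r ∈ Ioo 0 δ', β + Real.pi < θ₂ r := by
    intro r hr
    obtain ⟨h1, h2⟩ := hsm r hr
    obtain ⟨h3, h4⟩ := hbig r hr
    rcases B.sign with h' | h'
    · have : B.s * θ₂ (r / 2) < B.s * θ₂ r := h.tail₂.mono (hsub h1) (hsub hr) h2
      rw [h'] at this
      linarith [hle2 _ h1]
    · have : B.s * θ₂ r < B.s * θ₂ ((r + δ') / 2) := h.tail₂.mono (hsub hr) (hsub h3) h4
      rw [h'] at this
      linarith [hle2 _ h3]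
  have hpos := Real.pi_pos
  set e := Complex.exp (β * Complex.I) with he
  have he0 : e ≠ 0 := Complex.exp_ne_zero _
  have hmem : ∀ c : ℝ, |c| < δ' → (c : ℂ) * e ∈ closure V := by
    intro c hc
    rcases lt_trichotomy c 0 with hneg | rfl | hpos'
    · have hr : -c ∈ Ioo 0 δ' := ⟨by linarith, by rwa [abs_of_neg hneg] at hc⟩
      refine subset_closure (hs ⟨-c, hsub hr, β + Real.pi, ⟨?_, hlt2 _ hr⟩, ?_⟩)
      · linarith [hlt1 _ hr]
      · push_cast
        rw [add_mul, Complex.exp_add, Complex.exp_pi_mul_I]; ring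
    · have := (h.hasSide_left hAB hV hs).mem_closure (Or.inl rfl) (left_mem_Icc.2 zero_le_one)
      simpa [A.zero] using this
    · have hr : c ∈ Ioo 0 δ' := ⟨hpos', by rwa [abs_of_pos hpos'] at hc⟩
      exact subset_closure (hs ⟨c, hsub hr, β, ⟨hlt1 _ hr, by linarith [hlt2 _ hr]⟩, rfl⟩)
  intro hp
  refine hp ⟨((-(δ' / 2) : ℝ) : ℂ) * e, ((δ' / 2 : ℝ) : ℂ) * e, ?_, ?_, ?_⟩
  · intro heq
    have := mul_right_cancel₀ he0 heq
    have h6 : -(δ' / 2) = δ' / 2 := by exact_mod_cast this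
    linarith
  · refine ⟨1 / 2, 1 / 2, by norm_num, by norm_num, by norm_num, ?_⟩
    simp only [Complex.real_smul]
    push_cast; ring
  · rintro _ ⟨p, q, hp0, hq0, hpq, rfl⟩
    have e1 : p • (((-(δ' / 2) : ℝ) : ℂ) * e) + q • (((δ' / 2 : ℝ) : ℂ) * e)
        = (((q - p) * (δ' / 2) : ℝ) : ℂ) * e := by
      simp only [Complex.real_smul]; push_cast; ring
    rw [e1]
    apply hmem
    rw [abs_mul, abs_of_pos (half_pos hδ')]
    have : |q - p| ≤ 1 := by rw [abs_le]; constructor <;> linarith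
    nlinarith

end Arm

/-! ### Transversal chords of proper components. -/

/-- The simple zeros of a function form a countable set. -/
lemma countable_simple_zeros {f f' : ℝ → ℝ} {s : Set ℝ} (hf : ∀ t ∈ s, HasDerivAt f (f' t) t) :
    {t ∈ s | f t = 0 ∧ f' t ≠ 0}.Countable := by
  have : DiscreteTopology {t ∈ s | f t = 0 ∧ f' t ≠ 0} := by
    rw [discreteTopology_subtype_iff]
    rintro t ⟨ht, -, h1⟩
    have := (hf t ht).eventually_ne h1 (c := 0)
    rw [← disjoint_iff, Filter.disjoint_principal_right]
    filter_upwards [this] with x hx hx'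
    exact hx hx'.2.1
  exact Set.countable_coe_iff.1 countable_of_Lindelof_of_discrete

namespace Arm
variable {R : ℝ}

/-- The parameters of the arm whose tangent line passes through `q`. -/
def tangential (A : Arm R) (q : ℂ) : Set ℝ :=
  {t | t ∈ Ioo (0 : ℝ) 1 ∧ A.g t ≠ q ∧ cross (A.g t - q) (A.v t) = 0}

/-- Where the tangent line passes through q, g - q is a nonzero multiple of v, so the derivative
cross (g - q) a of the defining function is nonzero by curvature and the zero is simple. -/
lemma countable_tangential (A : Arm R) (q : ℂ) : (A.tangential q).Countable := by
  refine (countable_simple_zeros (s := Ioo (0 : ℝ) 1) (f := fun t => cross (A.g t - q) (A.v t))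
    (f' := fun t => cross (A.v t) (A.v t) + cross (A.g t - q) (A.a t)) fun t ht => ?_).mono ?_
  · exact ((A.hasDerivAt t (A.mem_of_Ioo ht)).sub_const q).cross (A.hasDerivAt_v t (A.mem_of_Ioo ht))
  · rintro t ⟨ht, hq, h⟩
    refine ⟨ht, h, fun h' => ?_⟩
    simp only [cross_self_eq_zero, zero_add] at h'
    obtain ⟨c, hc⟩ := eq_of_cross_eq_zero (sub_ne_zero.2 hq) h
    have := A.curv t (A.mem_of_Ioo ht)
    rw [hc, cross_real_mul_left, h'] at this
    simp at this

/-- The line through q meets the arm either transversally, which is a simple zero, or tangentially,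
and then q lies on the tangent line. -/
lemma countable_on_line (A : Arm R) (q : ℂ) {d : ℂ} (hd : d ≠ 0) :
    {t | t ∈ Ioo (0 : ℝ) 1 ∧ A.g t ≠ q ∧ cross d (A.g t - q) = 0}.Countable := by
  refine ((A.countable_tangential q).union (countable_simple_zeros (s := Ioo (0 : ℝ) 1)
    (f := fun t => cross d (A.g t - q)) (f' := fun t => cross d (A.v t)) fun t ht =>
      ((A.hasDerivAt t (A.mem_of_Ioo ht)).sub_const q).const_cross d)).mono ?_
  rintro t ⟨ht, hq, h⟩
  by_cases h' : cross d (A.v t) = 0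
  · left
    refine ⟨ht, hq, ?_⟩
    obtain ⟨c, hc⟩ := eq_of_cross_eq_zero hd h
    rw [hc, cross_real_mul_left, h', mul_zero]
  · exact Or.inr ⟨ht, h, h'⟩

/-- A line through a given point `q` and some point of the arm `A` that is not tangent to the
arms, except possibly at `q`. -/
lemma exists_transversal (A B : Arm R) (q : ℂ) {w : ℂ} (hw : w ≠ 0) {J : Set ℝ} (hJ : J ∈ 𝓝 t₀)
    (hJ' : ∀ t ∈ J, t ∈ Ioo (0 : ℝ) 1 ∧ A.g t ≠ q) :
    ∃ t ∈ J, cross w (A.g t - q) ≠ 0 ∧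
      (∀ t' ∈ Ioo (0 : ℝ) 1, A.g t' ≠ q → cross (A.g t' - q) (A.g t - q) = 0 →
        cross (A.v t') (A.g t - q) ≠ 0) ∧
      (∀ t' ∈ Ioo (0 : ℝ) 1, B.g t' ≠ q → cross (B.g t' - q) (A.g t - q) = 0 →
        cross (B.v t') (A.g t - q) ≠ 0) := by
  -- The lines through q to be avoided join it to one of countably many points of tangency. Each
  -- meets A in countably many parameters, while J is uncountable.
  have hbad : ∀ C : Arm R, (⋃ t' ∈ C.tangential q,
      {t | t ∈ Ioo (0 : ℝ) 1 ∧ A.g t ≠ q ∧ cross (C.g t' - q) (A.g t - q) = 0}).Countable :=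
    fun C => (C.countable_tangential q).biUnion fun t' ht' =>
      A.countable_on_line q (sub_ne_zero.2 ht'.2.1)
  have hc := ((A.countable_on_line q hw).union (hbad A)).union (hbad B)
  have hnc : ¬ J.Countable := fun h => by
    obtain ⟨l, u, hlu, hsub⟩ := mem_nhds_iff_exists_Ioo_subset.1 hJ
    exact (hlu.1.trans hlu.2).not_ge (Cardinal.Real.Ioo_countable_iff.1 (h.mono hsub))
  obtain ⟨t, ht, htn⟩ : ∃ t ∈ J, t ∉ ({t | t ∈ Ioo (0 : ℝ) 1 ∧ A.g t ≠ q ∧ cross w (A.g t - q) = 0} ∪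
      (⋃ t' ∈ A.tangential q,
      {t | t ∈ Ioo (0 : ℝ) 1 ∧ A.g t ≠ q ∧ cross (A.g t' - q) (A.g t - q) = 0})) ∪
      (⋃ t' ∈ B.tangential q,
      {t | t ∈ Ioo (0 : ℝ) 1 ∧ A.g t ≠ q ∧ cross (B.g t' - q) (A.g t - q) = 0}) := by
    by_contra! h
    exact hnc (hc.mono h)
  obtain ⟨ht1, ht2⟩ := hJ' t ht
  have key : ∀ C : Arm R, t ∉ (⋃ t' ∈ C.tangential q,
      {t | t ∈ Ioo (0 : ℝ) 1 ∧ A.g t ≠ q ∧ cross (C.g t' - q) (A.g t - q) = 0}) →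
      ∀ t' ∈ Ioo (0 : ℝ) 1, C.g t' ≠ q → cross (C.g t' - q) (A.g t - q) = 0 →
        cross (C.v t') (A.g t - q) ≠ 0 := by
    intro C hC t' ht' hq h1 h2
    apply hC
    rw [mem_iUnion₂]
    refine ⟨t', ⟨ht', hq, ?_⟩, ht1, ht2, h1⟩
    rw [cross_swap] at h1 h2
    obtain ⟨c, hc⟩ := eq_of_cross_eq_zero (sub_ne_zero.2 ht2) (neg_eq_zero.1 h1)
    rw [hc, cross_real_mul_left, neg_eq_zero.1 h2, mul_zero]
  simp only [mem_union, not_or] at htn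
  exact ⟨t, ht, fun h => htn.1.1 ⟨ht1, ht2, h⟩, key A htn.1.2, key B htn.2⟩

lemma IsTail.exists_eq {A : Arm R} {θ : ℝ → ℝ} {δ r : ℝ} (h : A.IsTail θ δ) (hr : r ∈ Ioo 0 δ) :
    ∃ t ∈ Ioo (0 : ℝ) 1, A.g t = r * Complex.exp (θ r * Complex.I) := by
  obtain ⟨t, ht, hte⟩ := h.surj r hr
  have := h.eq t (Ioo_subset_Icc_self ht) (by rwa [hte])
  rw [hte] at this
  exact ⟨t, ht, this⟩

variable {A B : Arm R} {θ₁ θ₂ : ℝ → ℝ} {δ : ℝ}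

/-- The angle Φ of the segment from p to q runs continuously from θ₁ to θ₂. The adjacent parameters
with Φ ≤ θ₁ and Φ ≥ θ₂ bound a piece that runs strictly inside the sector with its ends on the two
arms. -/
lemma Tails.exists_subchord (h : Tails A B θ₁ θ₂ δ) {ρ r : ℝ} (hρ : ρ ∈ Ioo 0 δ) (hr : r ∈ Ioo 0 δ)
    (h0 : 0 < θ₂ r - θ₁ ρ) (hpi : θ₂ r - θ₁ ρ < Real.pi) {p q : ℂ}
    (hp : p = ρ * Complex.exp (θ₁ ρ * Complex.I)) (hq : q = r * Complex.exp (θ₂ r * Complex.I)) :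
    ∃ y x : ℝ, y < x ∧ ∃ tp ∈ Ioo (0 : ℝ) 1, ∃ tq ∈ Ioo (0 : ℝ) 1, A.g tp = p + y * (q - p) ∧
      B.g tq = p + x * (q - p) ∧ openSegment ℝ (A.g tp) (B.g tq) ⊆ sector θ₁ θ₂ δ := by
  set ω := θ₂ r - θ₁ ρ with hω
  -- The segment after the rotation that puts p on the positive real axis. As the angle ω is between
  -- 0 and π, the rotated segment stays in the slit plane, where `Complex.arg` is continuous.
  set w : ℝ → ℂ := fun u => ((1 - u) * ρ : ℝ) + ((u * r : ℝ) : ℂ) * Complex.exp (ω * Complex.I)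
    with hw
  set z : ℝ → ℂ := fun u => p + u * (q - p) with hz
  have hzw : ∀ u, z u = Complex.exp (θ₁ ρ * Complex.I) * w u := by
    intro u
    have : Complex.exp (θ₂ r * Complex.I) =
        Complex.exp (θ₁ ρ * Complex.I) * Complex.exp (ω * Complex.I) := by
      rw [← Complex.exp_add, hω]; push_cast; ring_nf
    simp only [hz, hw, hp, hq, this]
    push_cast; ring
  have him : ∀ u, (w u).im = u * r * Real.sin ω := by
    intro u
    simp only [hw, Complex.add_im, Complex.ofReal_im, Complex.im_ofReal_mul,
      Complex.exp_ofReal_mul_I_im, zero_add]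
  have hsin : 0 < Real.sin ω := Real.sin_pos_of_pos_of_lt_pi h0 hpi
  have hslit : ∀ u ∈ Icc (0 : ℝ) 1, w u ∈ Complex.slitPlane := by
    intro u hu
    rcases hu.1.eq_or_lt with rfl | hu0
    · left; simp [hw, hρ.1]
    · right; rw [him]
      have := hr.1
      positivity
  have hwc : Continuous w := by
    simp only [hw]
    exact (Complex.continuous_ofReal.comp (by fun_prop)).add
      ((Complex.continuous_ofReal.comp (by fun_prop)).mul continuous_const)
  have hzc : Continuous z := by
    have : z = fun u => Complex.exp (θ₁ ρ * Complex.I) * w u := funext hzw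
    rw [this]; exact continuous_const.mul hwc
  set Φ : ℝ → ℝ := fun u => θ₁ ρ + (w u).arg with hΦ
  have hΦc : ContinuousOn Φ (Icc 0 1) := fun u hu =>
    (continuousAt_const.add ((Complex.continuousAt_arg (hslit u hu)).comp
      hwc.continuousAt)).continuousWithinAt
  have hnorm : ∀ u, ‖z u‖ = ‖w u‖ := by
    intro u
    rw [hzw, norm_mul, Complex.norm_exp_ofReal_mul_I, one_mul]
  have hpol : ∀ u, z u = ‖z u‖ * Complex.exp (Φ u * Complex.I) := by
    intro u
    conv_lhs => rw [hzw, ← Complex.norm_mul_exp_arg_mul_I (w u)]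
    rw [hnorm, hΦ]
    push_cast
    rw [add_mul, Complex.exp_add]; ring
  have hmem : ∀ u ∈ Icc (0 : ℝ) 1, ‖z u‖ ∈ Ioo 0 δ := by
    intro u hu
    rw [hnorm]
    refine ⟨norm_pos_iff.2 (Complex.slitPlane_ne_zero (hslit u hu)), ?_⟩
    calc ‖w u‖ ≤ (1 - u) * ρ + u * r := by
          refine (norm_add_le _ _).trans ?_
          rw [norm_mul, Complex.norm_exp_ofReal_mul_I, Complex.norm_real, Complex.norm_real,
            Real.norm_of_nonneg (mul_nonneg (by linarith [hu.2]) hρ.1.le),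
            Real.norm_of_nonneg (mul_nonneg hu.1 hr.1.le), mul_one]
      _ < δ := by
          rcases hu.1.eq_or_lt with rfl | hu0
          · simpa using hρ.2
          · nlinarith [hu.2, hρ.2, hr.2]
  have hnc : ContinuousOn (fun u => ‖z u‖) (Icc 0 1) := hzc.norm.continuousOn
  have hc1 : ContinuousOn (fun u => Φ u - θ₁ ‖z u‖) (Icc 0 1) :=
    hΦc.sub (h.tail₁.cont.comp hnc hmem)
  have hc2 : ContinuousOn (fun u => θ₂ ‖z u‖ - Φ u) (Icc 0 1) :=
    (h.tail₂.cont.comp hnc hmem).sub hΦc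
  have hw0 : w 0 = ρ := by simp [hw]
  have hw1 : w 1 = r * Complex.exp (ω * Complex.I) := by simp [hw]
  have hΦ0 : Φ 0 = θ₁ ‖z 0‖ := by
    simp only [hΦ, hnorm, hw0, Complex.norm_real, Real.norm_of_nonneg hρ.1.le,
      Complex.arg_ofReal_of_nonneg hρ.1.le, add_zero]
  have hΦ1 : Φ 1 = θ₂ ‖z 1‖ := by
    have : (w 1).arg = ω := by
      rw [hw1, Complex.exp_mul_I]
      exact_mod_cast Complex.arg_mul_cos_add_sin_mul_I hr.1 ⟨by linarith, hpi.le⟩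
    simp only [hΦ, hnorm, this]
    rw [hw1, norm_mul, Complex.norm_exp_ofReal_mul_I, Complex.norm_real,
      Real.norm_of_nonneg hr.1.le, mul_one, hω]
    ring
  obtain ⟨x, ⟨hx, hxle⟩, y, ⟨hy, hyle⟩, hyx, -, -, hbetween⟩ := exists_adjacent
    (a := {u | u ∈ Icc (0 : ℝ) 1 ∧ θ₂ ‖z u‖ - Φ u ≤ 0})
    (b := {u | u ∈ Icc (0 : ℝ) 1 ∧ Φ u - θ₁ ‖z u‖ ≤ 0}) (x₀ := 1) (y₀ := 0)
    (isCompact_Icc.of_isClosed_subset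
      (hc2.preimage_isClosed_of_isClosed isClosed_Icc isClosed_Iic) inter_subset_left)
    (isCompact_Icc.of_isClosed_subset
      (hc1.preimage_isClosed_of_isClosed isClosed_Icc isClosed_Iic) inter_subset_left)
    ⟨by simp, by rw [hΦ1, sub_self]⟩ ⟨by simp, by rw [hΦ0, sub_self]⟩
    (by
      rw [disjoint_left]
      rintro u ⟨hu, h1⟩ ⟨-, h2⟩
      linarith [h.lt _ (hmem u hu)]) zero_le_one
  have hsub : ∀ u ∈ Ioo y x, u ∈ Icc (0 : ℝ) 1 := fun u hu =>
    ⟨hy.1.trans hu.1.le, hu.2.le.trans hx.2⟩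
  have hpos : ∀ u ∈ Ioo y x, 0 < Φ u - θ₁ ‖z u‖ ∧ 0 < θ₂ ‖z u‖ - Φ u := by
    intro u hu
    obtain ⟨h1, h2⟩ := hbetween u hu
    constructor
    · by_contra! hcon; exact h2 ⟨hsub u hu, hcon⟩
    · by_contra! hcon; exact h1 ⟨hsub u hu, hcon⟩
  have hcl : closure (Ioo y x) = Icc y x := closure_Ioo hyx.ne
  have hIcc : Icc y x ⊆ Icc 0 1 := Icc_subset_Icc hy.1 hx.2
  have hy0 : Φ y = θ₁ ‖z y‖ := by
    have : 0 ≤ Φ y - θ₁ ‖z y‖ :=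
      le_on_closure (f := fun _ => (0 : ℝ)) (fun u hu => (hpos u hu).1.le)
        continuousOn_const (by rw [hcl]; exact hc1.mono hIcc)
        (by rw [hcl]; exact ⟨le_rfl, hyx.le⟩)
    linarith
  have hx0 : Φ x = θ₂ ‖z x‖ := by
    have : 0 ≤ θ₂ ‖z x‖ - Φ x :=
      le_on_closure (f := fun _ => (0 : ℝ)) (fun u hu => (hpos u hu).2.le)
        continuousOn_const (by rw [hcl]; exact hc2.mono hIcc)
        (by rw [hcl]; exact ⟨hyx.le, le_rfl⟩)
    linarith
  obtain ⟨tp, htp, hep⟩ := h.tail₁.exists_eq (hmem y hy)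
  obtain ⟨tq, htq, heq⟩ := h.tail₂.exists_eq (hmem x hx)
  rw [← hy0, ← hpol] at hep
  rw [← hx0, ← hpol] at heq
  refine ⟨y, x, hyx, tp, htp, tq, htq, hep, heq, ?_⟩
  rw [hep, heq]
  rintro _ ⟨a, b, ha, hb, hab, rfl⟩
  have hu : a * y + b * x ∈ Ioo y x := by
    have ha' : a = 1 - b := by linarith
    subst ha'
    constructor <;> nlinarith
  have he : a • z y + b • z x = z (a * y + b * x) := by
    have ha' : a = 1 - b := by linarith
    subst ha'
    simp only [hz, Complex.real_smul]
    push_cast; ring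
  rw [he, hpol]
  obtain ⟨h1, h2⟩ := hpos _ hu
  exact ⟨_, hmem _ (hsub _ hu), _, ⟨by linarith, by linarith⟩, rfl⟩

/-- A difference less than π at different radii may be negative. But θ₂ exceeds θ₁ at the radius r,
so if neither r' nor r itself serves, the difference takes the value π / 2 in between. -/
lemma Tails.exists_narrow (h : Tails A B θ₁ θ₂ δ) {r r' : ℝ} (hr : r ∈ Ioo 0 δ)
    (hr' : r' ∈ Ioo 0 δ) (hpi : θ₂ r' - θ₁ r < Real.pi) :
    ∃ x ∈ Ioo 0 δ, 0 < θ₂ x - θ₁ r ∧ θ₂ x - θ₁ r < Real.pi := by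
  have h1 := h.lt r hr
  by_cases h2 : 0 < θ₂ r' - θ₁ r
  · exact ⟨r', hr', h2, hpi⟩
  by_cases h3 : θ₂ r - θ₁ r < Real.pi
  · exact ⟨r, hr, by linarith, h3⟩
  push Not at h2 h3
  have hpos := Real.pi_pos
  obtain ⟨x, hx, hxe⟩ := isPreconnected_Ioo.intermediate_value hr' hr
    (h.tail₂.cont.sub continuousOn_const)
    (⟨by linarith, by linarith⟩ : Real.pi / 2 ∈ Icc (θ₂ r' - θ₁ r) (θ₂ r - θ₁ r))
  change θ₂ x - θ₁ r = _ at hxe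
  exact ⟨x, hx, by rw [hxe]; linarith, by rw [hxe]; linarith⟩

/-- A proper side that contains the sector between two tails has a chord. -/
lemma Tails.hasChord (hAB : Apart A B) (h : Tails A B θ₁ θ₂ δ) {U : Set ℂ}
    (hU : IsComp (region A B) U) (hs : sector θ₁ θ₂ δ ⊆ U) (hP : Proper U) :
    HasChord A B U 1 := by
  obtain ⟨r, hr, r', hr', hpi⟩ : ∃ r ∈ Ioo 0 δ, ∃ r' ∈ Ioo 0 δ, θ₂ r' - θ₁ r < Real.pi := by
    by_contra! hcon
    exact h.not_proper hAB hU hs h.pos le_rfl hcon hP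
  obtain ⟨r', hr', h0, hpi⟩ := h.exists_narrow hr hr' hpi
  have hU' : IsComp (region B A) U := region_comm A B ▸ hU
  obtain ⟨z₀, hz₀⟩ : (sector θ₂ (fun r => θ₁ r + 2 * Real.pi) δ).Nonempty :=
    ⟨_, r, hr, (θ₂ r + (θ₁ r + 2 * Real.pi)) / 2,
      ⟨by linarith [h.lt' r hr], by linarith [h.lt' r hr]⟩, rfl⟩
  have hsub' := region_comm A B ▸ h.symm.sector_subset
  set V := connectedComponentIn (region A B) z₀
  have hV : IsComp (region A B) V := isComp_connectedComponentIn (hsub' hz₀)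
  have hV' : IsComp (region B A) V := region_comm A B ▸ hV
  have hsV : sector θ₂ (fun r => θ₁ r + 2 * Real.pi) δ ⊆ V :=
    h.symm.isPreconnected_sector.subset_connectedComponentIn hz₀ hsub'
  have a1 := h.hasSide_left hAB hU hs
  have b1 := h.hasSide_right hAB hU hs
  have b2 := h.symm.hasSide_left hAB.symm hV' hsV
  have a2 := h.symm.hasSide_right hAB.symm hV' hsV
  -- The two sectors account for all four sides; in a single component they would contradict
  -- properness.
  have hall : U ≠ V := fun he => by
    subst he
    refine not_proper_of_all_sides hAB hU ?_ ?_ hP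
    · rintro σ (rfl | rfl)
      exacts [a1, a2]
    · rintro σ (rfl | rfl)
      exacts [b2, b1]
  obtain ⟨tq₀, htq₀, hq₀⟩ := h.tail₂.exists_eq hr'
  obtain ⟨tp₀, htp₀, hp₀⟩ := h.tail₁.exists_eq hr
  have hn0 : ‖A.g tp₀‖ = r := by
    rw [hp₀, norm_mul, Complex.norm_exp_ofReal_mul_I, Complex.norm_real,
      Real.norm_of_nonneg hr.1.le, mul_one]
  have hnc : ContinuousAt (fun t => ‖A.g t‖) tp₀ :=
    (A.hasDerivAt _ (A.mem_of_Ioo htp₀)).continuousAt.norm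
  have hc : ContinuousAt (fun t => θ₂ r' - θ₁ ‖A.g t‖) tp₀ := by
    apply continuousAt_const.sub
    apply ContinuousAt.comp (f := fun t => ‖A.g t‖) _ hnc
    rw [hn0]
    exact h.tail₁.cont.continuousAt (Ioo_mem_nhds hr.1 hr.2)
  have hJ : ∀ᶠ t in 𝓝 tp₀, t ∈ Ioo (0 : ℝ) 1 ∧ ‖A.g t‖ ∈ Ioo 0 δ ∧
      θ₂ r' - θ₁ ‖A.g t‖ ∈ Ioo 0 Real.pi := by
    refine Filter.Eventually.and (Ioo_mem_nhds htp₀.1 htp₀.2) (Filter.Eventually.and ?_ ?_)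
    · refine hnc (Ioo_mem_nhds ?_ ?_) <;> beta_reduce <;> rw [hn0]
      exacts [hr.1, hr.2]
    · refine hc (Ioo_mem_nhds ?_ ?_) <;> beta_reduce <;> rw [hn0]
      exacts [h0, hpi]
  -- The end on A is moved a little so that the line is tangent to no arm. At the fixed point of B
  -- this is the condition `hw`, as tangency at q itself is not covered by the other two.
  obtain ⟨t, ⟨ht, htn, htθ⟩, hw, hA, hB⟩ := exists_transversal A B (B.g tq₀)
    (B.v_ne_zero (B.mem_of_Ioo htq₀)) hJ
    (fun t ht => ⟨ht.1, hAB.ne (Ioo_subset_Ioc_self ht.1) (Ioo_subset_Icc_self htq₀)⟩)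
  obtain ⟨y, x, hyx, tp, htp, tq, htq, hep, heq, hsec⟩ := h.exists_subchord htn hr' htθ.1 htθ.2
    (h.tail₁.eq t (Ioo_subset_Icc_self ht) htn) hq₀
  set d := A.g t - B.g tq₀ with hd
  have hD : B.g tq - A.g tp = ((-(x - y) : ℝ) : ℂ) * d := by
    rw [hep, heq, hd]; push_cast; ring
  have hxy : -(x - y) ≠ 0 := by linarith
  have hA' : cross (A.v tp) (B.g tq - A.g tp) ≠ 0 := by
    rw [hD, cross_real_mul_right]
    refine mul_ne_zero hxy (hA tp htp (hAB.ne (Ioo_subset_Ioc_self htp) (Ioo_subset_Icc_self htq₀)) ?_)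
    have : A.g tp - B.g tq₀ = ((1 - y : ℝ) : ℂ) * d := by rw [hep, hd]; push_cast; ring
    rw [this, cross_real_mul_left, cross_self_eq_zero, mul_zero]
  have hB' : cross (B.v tq) (B.g tq - A.g tp) ≠ 0 := by
    rw [hD, cross_real_mul_right]
    refine mul_ne_zero hxy ?_
    by_cases hq : B.g tq = B.g tq₀
    · rw [B.inj (Ioo_subset_Icc_self htq) (Ioo_subset_Icc_self htq₀) hq]
      exact hw
    · refine hB tq htq hq ?_
      have : B.g tq - B.g tq₀ = ((1 - x : ℝ) : ℂ) * d := by rw [heq, hd]; push_cast; ring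
      rw [this, cross_real_mul_left, cross_self_eq_zero, mul_zero]
  have hopen : ∀ᶠ u : ℝ in 𝓝[>] 0, u ∈ Ioo (0 : ℝ) 1 := Ioo_mem_nhdsGT one_pos
  have hpt : ∀ u ∈ Ioo (0 : ℝ) 1, A.g tp + u * (B.g tq - A.g tp) ∈ U := fun u hu =>
    hs (hsec ⟨1 - u, u, by linarith [hu.2], hu.1, by ring, by
      simp only [Complex.real_smul]; push_cast; ring⟩)
  have hpt' : ∀ u ∈ Ioo (0 : ℝ) 1, B.g tq + u * -(B.g tq - A.g tp) ∈ U := fun u hu =>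
    hs (hsec ⟨u, 1 - u, hu.1, by linarith [hu.2], by ring, by
      simp only [Complex.real_smul]; push_cast; ring⟩)
  refine ⟨Or.inl rfl, ⟨tp, htp, tq, htq, hsec.trans hs, ?_, ?_⟩, a1, b1, V, hV, a2, b2, ?_⟩
  · rw [one_mul]
    -- Were the chord to leave A on the side -1, U would have that side, which belongs to V.
    by_contra hcon
    have hneg : 0 < -1 * cross (A.v tp) (B.g tq - A.g tp) := by
      have := lt_of_le_of_ne (not_lt.1 hcon) hA'
      linarith
    have := sideIn_of_frequently hAB hU (Or.inr rfl) htp hneg (hopen.mono hpt).frequently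
    exact hall (HasSide.eq hU hV (Or.inr rfl)
      (fun t' ht' => this.const hAB hU (Or.inr rfl) htp ht') a2)
  · rw [one_mul]
    by_contra hcon
    have hneg : 0 < 1 * cross (B.v tq) (-(B.g tq - A.g tp)) := by
      have := lt_of_le_of_ne (not_lt.1 hcon) hB'
      rw [cross_neg_right]
      linarith
    have := sideIn_of_frequently hAB.symm hU' (Or.inl rfl) htq hneg (hopen.mono hpt').frequently
    exact hall (HasSide.eq hU' hV' (Or.inl rfl)
      (fun t' ht' => this.const hAB.symm hU' (Or.inl rfl) htq ht') b2)
  -- Here θ₁ decreases and θ₂ increases with the radius, so the angle of U stays below π all the way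
  -- into the vortex. The complementary sector then has angle at least π.
  · intro hsA hsB
    refine h.symm.not_proper hAB.symm hV' hsV (δ' := min r r') (lt_min hr.1 hr'.1)
      ((min_le_left _ _).trans hr.2.le) fun ρ hρ ρ' hρ' => ?_
    have hρδ : ∀ u ∈ Ioo 0 (min r r'), u ∈ Ioo 0 δ := fun u hu =>
      ⟨hu.1, (hu.2.trans_le (min_le_left _ _)).trans hr.2⟩
    have e1 : B.s * θ₂ ρ < B.s * θ₂ r' :=
      h.tail₂.mono (hρδ ρ hρ) hr' (hρ.2.trans_le (min_le_right _ _))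
    have e2 : A.s * θ₁ ρ' < A.s * θ₁ r :=
      h.tail₁.mono (hρδ ρ' hρ') hr (hρ'.2.trans_le (min_le_left _ _))
    rw [hsB] at e1
    rw [hsA] at e2
    linarith

/-- Every proper component of the complement of a double spiral has a chord. -/
theorem exists_chord (hAB : Apart A B) {U : Set ℂ} (hU : IsComp (region A B) U) (hP : Proper U) :
    ∃ σ, HasChord A B U σ := by
  have hU' : IsComp (region B A) U := region_comm A B ▸ hU
  obtain ⟨φ, hφ⟩ := A.exists_lift
  obtain ⟨χ, hχ⟩ := B.exists_lift
  by_cases hwA : A.Winding φ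
  · exact hasChord_of_winding hAB hφ hχ hwA hU
  by_cases hwB : B.Winding χ
  · obtain ⟨σ, hσ⟩ := hasChord_of_winding hAB.symm hχ hφ hwB hU'
    exact ⟨_, hσ.symm⟩
  obtain ⟨θ₁, δ₁, hδ₁, h₁⟩ := A.exists_tail hφ hwA
  obtain ⟨θ₂, δ₂, hδ₂, h₂⟩ := B.exists_tail hχ hwB
  obtain ⟨θ₁, θ₂, δ, h⟩ := exists_tails hAB hδ₁ hδ₂ h₁ h₂
  have hhalf : δ / 2 ∈ Ioo 0 δ := ⟨by linarith [h.pos], by linarith [h.pos]⟩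
  obtain ⟨z₁, hz₁⟩ : (sector θ₁ θ₂ δ).Nonempty :=
    ⟨_, δ / 2, hhalf, (θ₁ (δ / 2) + θ₂ (δ / 2)) / 2,
      ⟨by linarith [h.lt _ hhalf], by linarith [h.lt _ hhalf]⟩, rfl⟩
  obtain ⟨z₂, hz₂⟩ : (sector θ₂ (fun r => θ₁ r + 2 * Real.pi) δ).Nonempty :=
    ⟨_, δ / 2, hhalf, (θ₂ (δ / 2) + (θ₁ (δ / 2) + 2 * Real.pi)) / 2,
      ⟨by linarith [h.lt' _ hhalf], by linarith [h.lt' _ hhalf]⟩, rfl⟩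
  have hsub' := region_comm A B ▸ h.symm.sector_subset
  have hV₁ : IsComp (region A B) (connectedComponentIn (region A B) z₁) :=
    isComp_connectedComponentIn (h.sector_subset hz₁)
  have hV₂ : IsComp (region A B) (connectedComponentIn (region A B) z₂) :=
    isComp_connectedComponentIn (hsub' hz₂)
  have hs₁ : sector θ₁ θ₂ δ ⊆ _ :=
    h.isPreconnected_sector.subset_connectedComponentIn hz₁ h.sector_subset
  have hs₂ : sector θ₂ (fun r => θ₁ r + 2 * Real.pi) δ ⊆ _ :=
    h.symm.isPreconnected_sector.subset_connectedComponentIn hz₂ hsub'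
  have hV₂' : IsComp (region B A) (connectedComponentIn (region A B) z₂) := region_comm A B ▸ hV₂
  have a1 := h.hasSide_left hAB hV₁ hs₁
  have b1 := h.hasSide_right hAB hV₁ hs₁
  have b2 := h.symm.hasSide_left hAB.symm hV₂' hs₂
  have a2 := h.symm.hasSide_right hAB.symm hV₂' hs₂
  have c1 : U = connectedComponentIn (region A B) z₁ → ∃ σ, HasChord A B U σ := fun he =>
    ⟨1, h.hasChord hAB hU (he ▸ hs₁) hP⟩
  have c2 : U = connectedComponentIn (region A B) z₂ → ∃ σ, HasChord A B U σ := fun he =>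
    ⟨_, (h.symm.hasChord hAB.symm hU' (he ▸ hs₂) hP).symm⟩
  obtain ⟨σ, rfl | rfl, hσ | hσ⟩ := exists_hasSide hAB hU
  · exact c1 (HasSide.eq hU hV₁ (Or.inl rfl) hσ a1)
  · exact c2 (HasSide.eq hU' hV₂' (Or.inl rfl) hσ b2)
  · exact c2 (HasSide.eq hU hV₂ (Or.inr rfl) hσ a2)
  · exact c1 (HasSide.eq hU' (region_comm A B ▸ hV₁) (Or.inr rfl) hσ b1)

end Arm

/-! ### Joining graphs by smoothed maxima, and parametrised curves. -/

/-- The functions agree on an interval to the left of c, so near c the glued function is simply g.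
-/
lemma HasDerivAt.ite {E : Type*} [NormedAddCommGroup E] [NormedSpace ℝ E] {f g : ℝ → E}
    {f' g' : E} {a c x : ℝ} (hac : a < c) (hf : x < c → HasDerivAt f f' x)
    (hg : c ≤ x → HasDerivAt g g' x) (h : ∀ y ∈ Ioo a c, f y = g y) :
    HasDerivAt (fun y => if y < c then f y else g y) (if x < c then f' else g') x := by
  by_cases hx : x < c
  · rw [if_pos hx]
    refine (hf hx).congr_of_eventuallyEq ?_
    filter_upwards [Iio_mem_nhds hx] with y hy
    exact if_pos hy
  · rw [if_neg hx]
    refine (hg (not_lt.1 hx)).congr_of_eventuallyEq ?_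
    filter_upwards [Ioi_mem_nhds (hac.trans_le (not_lt.1 hx))] with y hy
    split_ifs with h'
    exacts [h y ⟨hy, h'⟩, rfl]

lemma ContinuousAt.ite_lt {E : Type*} [TopologicalSpace E] {f g : ℝ → E}
    {a c x : ℝ} (hac : a < c) (hf : x < c → ContinuousAt f x)
    (hg : c ≤ x → ContinuousAt g x) (h : ∀ y ∈ Ioo a c, f y = g y) :
    ContinuousAt (fun y => if y < c then f y else g y) x := by
  by_cases hx : x < c
  · refine (hf hx).congr ?_
    filter_upwards [Iio_mem_nhds hx] with y hy
    exact (if_pos hy).symm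
  · refine (hg (not_lt.1 hx)).congr ?_
    filter_upwards [Ioi_mem_nhds (hac.trans_le (not_lt.1 hx))] with y hy
    split_ifs with h'
    exacts [(h y ⟨hy, h'⟩).symm, rfl]

lemma hasDerivAt_max_pow (n : ℕ) (v : ℝ) :
    HasDerivAt (fun v : ℝ => max v 0 ^ (n + 2)) ((n + 2) * max v 0 ^ (n + 1)) v := by
  rcases lt_trichotomy v 0 with hv | rfl | hv
  · rw [max_eq_right hv.le, zero_pow (by omega), mul_zero]
    refine (hasDerivAt_const v (0 : ℝ)).congr_of_eventuallyEq ?_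
    filter_upwards [Iio_mem_nhds hv] with y hy
    rw [max_eq_right (le_of_lt hy), zero_pow (by omega)]
  · rw [max_self, zero_pow (by omega), mul_zero]
    have : HasFDerivAt (fun v : ℝ => max v 0 ^ (n + 2)) (0 : ℝ →L[ℝ] ℝ) 0 := by
      refine Asymptotics.IsBigO.hasFDerivAt (n := n + 2) ?_ (by omega)
      refine Asymptotics.IsBigO.of_bound 1 (Eventually.of_forall fun y => ?_)
      simp only [sub_zero, norm_pow, Real.norm_eq_abs, abs_abs, one_mul]
      refine pow_le_pow_left₀ (abs_nonneg _) ?_ _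
      rw [abs_of_nonneg (le_max_right _ _)]
      exact max_le (le_abs_self _) (abs_nonneg _)
    simpa using this.hasDerivAt
  · rw [max_eq_left hv.le]
    have := hasDerivAt_pow (n + 2) v
    push_cast at this
    refine this.congr_of_eventuallyEq ?_
    filter_upwards [Ioi_mem_nhds hv] with y hy
    rw [max_eq_left (le_of_lt hy)]

/-- A convex `C²` function that agrees with `max v 0` away from `0`. -/
lemma exists_smoothMax {ε : ℝ} (hε : 0 < ε) : ∃ H H1 H2 : ℝ → ℝ,
    (∀ v, HasDerivAt H (H1 v) v) ∧ (∀ v, HasDerivAt H1 (H2 v) v) ∧ Continuous H2 ∧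
    (∀ v ≤ -ε, H v = 0 ∧ H1 v = 0 ∧ H2 v = 0) ∧ (∀ v ≥ ε, H v = v ∧ H1 v = 1 ∧ H2 v = 0) ∧
    (∀ v, 0 ≤ H1 v ∧ H1 v ≤ 1 ∧ 0 ≤ H2 v) ∧ (∀ v > -ε, 0 < H v) ∧ ∀ v, H v ≤ |v| + ε := by
  -- H2 is the hat function of integral 1 on [-ε, ε]; the three formulas are second differences of
  -- truncated cubes, squares and linear functions, each the derivative of the one before.
  refine ⟨fun v => (max (v + ε) 0 ^ 3 - 2 * max v 0 ^ 3 + max (v - ε) 0 ^ 3) / (6 * ε ^ 2),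
    fun v => (max (v + ε) 0 ^ 2 - 2 * max v 0 ^ 2 + max (v - ε) 0 ^ 2) / (2 * ε ^ 2),
    fun v => (max (v + ε) 0 - 2 * max v 0 + max (v - ε) 0) / ε ^ 2, ?_, ?_, ?_, ?_, ?_, ?_, ?_, ?_⟩
  · intro v
    have h1 := (hasDerivAt_max_pow 1 (v + ε)).comp_add_const v ε
    have h2 := hasDerivAt_max_pow 1 v
    have h3 := (hasDerivAt_max_pow 1 (v - ε)).comp_sub_const v ε
    refine (((h1.sub (h2.const_mul 2)).add h3).div_const (6 * ε ^ 2)).congr_deriv ?_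
    norm_num
    field_simp
    ring
  · intro v
    have h1 := (hasDerivAt_max_pow 0 (v + ε)).comp_add_const v ε
    have h2 := hasDerivAt_max_pow 0 v
    have h3 := (hasDerivAt_max_pow 0 (v - ε)).comp_sub_const v ε
    refine (((h1.sub (h2.const_mul 2)).add h3).div_const (2 * ε ^ 2)).congr_deriv ?_
    norm_num
    field_simp
  · fun_prop
  · intro v hv
    simp only
    rw [max_eq_right (by linarith : v + ε ≤ 0), max_eq_right (by linarith : v ≤ 0),
      max_eq_right (by linarith : v - ε ≤ 0)]
    simp
  · intro v hv
    simp only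
    rw [max_eq_left (by linarith : 0 ≤ v + ε), max_eq_left (by linarith : 0 ≤ v),
      max_eq_left (by linarith : 0 ≤ v - ε)]
    refine ⟨?_, ?_, ?_⟩ <;> field_simp <;> ring
  · intro v
    have h1 : (0 : ℝ) < 2 * ε ^ 2 := by positivity
    simp only
    rw [div_le_one h1]
    rcases le_total v (-ε) with h | h
    · rw [max_eq_right (by linarith : v + ε ≤ 0), max_eq_right (by linarith : v ≤ 0),
        max_eq_right (by linarith : v - ε ≤ 0)]
      norm_num
      positivity
    rcases le_total v 0 with h' | h'
    · rw [max_eq_left (by linarith : 0 ≤ v + ε), max_eq_right (by linarith : v ≤ 0),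
        max_eq_right (by linarith : v - ε ≤ 0)]
      refine ⟨div_nonneg (by nlinarith [sq_nonneg (v + ε)]) h1.le, by nlinarith, ?_⟩
      apply div_nonneg _ (by positivity)
      linarith
    rcases le_total v ε with h'' | h''
    · rw [max_eq_left (by linarith : 0 ≤ v + ε), max_eq_left (by linarith : 0 ≤ v),
        max_eq_right (by linarith : v - ε ≤ 0)]
      refine ⟨div_nonneg (by nlinarith) (by positivity), by nlinarith [sq_nonneg (v - ε)],
        div_nonneg (by linarith) (by positivity)⟩
    · rw [max_eq_left (by linarith : 0 ≤ v + ε), max_eq_left (by linarith : 0 ≤ v),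
        max_eq_left (by linarith : 0 ≤ v - ε)]
      refine ⟨div_nonneg (by nlinarith) (by positivity), by nlinarith,
        div_nonneg (by linarith) (by positivity)⟩
  · intro v hv
    apply div_pos _ (by positivity)
    rw [max_eq_left (by linarith : 0 ≤ v + ε)]
    rcases le_total v 0 with h' | h'
    · rw [max_eq_right h', max_eq_right (by linarith : v - ε ≤ 0)]
      have : 0 < v + ε := by linarith
      simp only [ne_eq, OfNat.ofNat_ne_zero, not_false_eq_true, zero_pow, mul_zero, sub_zero,
        add_zero]
      positivity
    rw [max_eq_left h']
    rcases le_total v ε with h'' | h''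
    · rw [max_eq_right (by linarith : v - ε ≤ 0)]
      have : 0 ≤ v * ε ^ 2 := by positivity
      have : v ^ 3 ≤ v ^ 2 * ε := by nlinarith [sq_nonneg v]
      have : 0 < ε ^ 3 := by positivity
      have : 0 ≤ v ^ 2 * ε := by positivity
      nlinarith
    · rw [max_eq_left (by linarith : 0 ≤ v - ε)]
      have h0 : 0 < v := hε.trans_le h''
      have : 0 < v * ε ^ 2 := by positivity
      nlinarith
  · intro v
    simp only
    rw [div_le_iff₀ (by positivity)]
    rcases le_total v (-ε) with h | h
    · rw [max_eq_right (by linarith : v + ε ≤ 0), max_eq_right (by linarith : v ≤ 0),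
        max_eq_right (by linarith : v - ε ≤ 0)]
      norm_num
      positivity
    rw [max_eq_left (by linarith : 0 ≤ v + ε)]
    have hsq : ∀ y, 0 ≤ y → y ≤ 2 * ε → y ^ 3 ≤ 4 * ε ^ 2 * y := fun y h0 h1 => by
      nlinarith [mul_nonneg h0 (mul_nonneg (sub_nonneg.2 h1) (by linarith : 0 ≤ 2 * ε + y))]
    rcases le_total v 0 with h' | h'
    · rw [max_eq_right h', max_eq_right (by linarith : v - ε ≤ 0), abs_of_nonpos h']
      have := hsq (v + ε) (by linarith) (by linarith)
      nlinarith [mul_nonneg (neg_nonneg.2 h') (sq_nonneg ε), pow_pos hε 3, pow_pos hε 2]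
    rw [max_eq_left h', abs_of_nonneg h']
    rcases le_total v ε with h'' | h''
    · rw [max_eq_right (by linarith : v - ε ≤ 0)]
      have := hsq (v + ε) (by linarith) (by linarith)
      have : 0 ≤ v ^ 3 := by positivity
      have : 0 ≤ (v + ε) * ε ^ 2 := by positivity
      nlinarith
    · rw [max_eq_left (by linarith : 0 ≤ v - ε)]
      nlinarith [pow_pos hε 3]

/-- Rounding the corner between a graph and a parabola. -/
lemma exists_corner {l r x₀ x₂ κ ε : ℝ} {F F1 F2 : ℝ → ℝ} (hl : l < x₀) (h02 : x₀ < x₂)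
    (hr : x₂ < r) (hF : ∀ x ∈ Ioo l r, HasDerivAt F (F1 x) x)
    (hF1 : ∀ x ∈ Ioo l r, HasDerivAt F1 (F2 x) x) (hF2 : ContinuousOn F2 (Ioo l r)) (hκ : 0 < κ)
    (hg : ∀ x ∈ Ioo l r, F1 x < 2 * κ * x) (h0 : κ * x₀ ^ 2 < F x₀) (h2 : F x₂ < κ * x₂ ^ 2)
    (hpos : ∀ x ∈ Ioo x₀ r, 0 < F2 x) (hε : 0 < ε) :
    ∃ (f f1 f2 : ℝ → ℝ) (x₁ : ℝ), x₁ ∈ Ioo x₀ x₂ ∧ (∀ x > l, HasDerivAt f (f1 x) x) ∧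
      (∀ x > l, HasDerivAt f1 (f2 x) x) ∧ ContinuousOn f2 (Ioi l) ∧
      (∀ x ∈ Ioc l x₁, f x = F x ∧ f2 x = F2 x) ∧ (∀ x ≥ x₂, f x = κ * x ^ 2) ∧
      (∀ x ∈ Ioc x₁ x₂, F x < f x ∧ f x ≤ F x + |κ * x ^ 2 - F x| + ε) ∧
      ∀ x > x₀, 0 < f2 x := by
  -- The join is F + H g, the smoothed maximum of F and the parabola. The slope condition makes g
  -- strictly increasing, so the transition happens once, beginning at the point x₁ where g = -δ.
  set g : ℝ → ℝ := fun x => κ * x ^ 2 - F x with hgdef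
  obtain ⟨δ, hδ, hδε, hδ0, hδ2⟩ : ∃ δ > 0, δ ≤ ε ∧ δ < -g x₀ ∧ δ < g x₂ := by
    have a0 : 0 < -g x₀ := by simp only [hgdef]; linarith
    have a2 : 0 < g x₂ := by simp only [hgdef]; linarith
    obtain ⟨δ, h, h'⟩ := exists_between (lt_min hε (lt_min a0 a2))
    exact ⟨δ, h, (h'.trans_le (min_le_left _ _)).le,
      h'.trans_le ((min_le_right _ _).trans (min_le_left _ _)),
      h'.trans_le ((min_le_right _ _).trans (min_le_right _ _))⟩
  obtain ⟨H, H1, H2, hH, hH1, hH2, hlo, hhi, hbd, hHpos, hHle⟩ := exists_smoothMax hδ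
  have hgd : ∀ x ∈ Ioo l r, HasDerivAt g (2 * κ * x - F1 x) x := fun x hx => by
    have := ((hasDerivAt_pow 2 x).const_mul κ).sub (hF x hx)
    exact this.congr_deriv (by push_cast; ring)
  have hgc : ContinuousOn g (Ioo l r) := fun x hx => (hgd x hx).continuousAt.continuousWithinAt
  have hmono : StrictMonoOn g (Ioo l r) := fun x hx y hy hxy =>
    lt_of_hasDerivAt_pos hxy (hgc.mono (ordConnected_Ioo.out hx hy))
      (fun t ht => hgd t (ordConnected_Ioo.out hx hy (Ioo_subset_Icc_self ht)))
      (fun t ht => by linarith [hg t (ordConnected_Ioo.out hx hy (Ioo_subset_Icc_self ht))])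
  have m0 : x₀ ∈ Ioo l r := ⟨hl, h02.trans hr⟩
  have m2 : x₂ ∈ Ioo l r := ⟨hl.trans h02, hr⟩
  obtain ⟨x₁, hx₁, hgx₁⟩ := intermediate_value_Ioo h02.le
    (hgc.mono (ordConnected_Ioo.out m0 m2)) (⟨by linarith, by linarith⟩ : -δ ∈ Ioo (g x₀) (g x₂))
  have m1 : x₁ ∈ Ioo l r := ⟨hl.trans hx₁.1, hx₁.2.trans hr⟩
  set f1 : ℝ → ℝ := fun x => F1 x + H1 (g x) * (2 * κ * x - F1 x)
  set f2 : ℝ → ℝ := fun x => F2 x +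
    (H2 (g x) * (2 * κ * x - F1 x) * (2 * κ * x - F1 x) + H1 (g x) * (2 * κ - F2 x))
  have hf : ∀ x ∈ Ioo l r, HasDerivAt (fun x => F x + H (g x)) (f1 x) x := fun x hx =>
    (hF x hx).add ((hH (g x)).comp x (hgd x hx))
  have hf1 : ∀ x ∈ Ioo l r, HasDerivAt f1 (f2 x) x := fun x hx => by
    have h3 : HasDerivAt (fun x => 2 * κ * x - F1 x) (2 * κ - F2 x) x := by
      exact (((hasDerivAt_id x).const_mul (2 * κ)).sub (hF1 x hx)).congr_deriv (by simp)
    exact (hF1 x hx).add (((hH1 (g x)).comp x (hgd x hx)).mul h3)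
  have hf2 : ContinuousOn f2 (Ioo l r) := by
    have c1 : ContinuousOn F1 (Ioo l r) := fun x hx => (hF1 x hx).continuousAt.continuousWithinAt
    have c2 : ContinuousOn (fun x => H1 (g x)) (Ioo l r) :=
      (continuous_iff_continuousAt.2 fun v => (hH1 v).continuousAt).comp_continuousOn hgc
    have c3 : ContinuousOn (fun x => H2 (g x)) (Ioo l r) := hH2.comp_continuousOn hgc
    have c4 : ContinuousOn (fun x => 2 * κ * x - F1 x) (Ioo l r) :=
      (continuousOn_const.mul continuousOn_id).sub c1
    exact hF2.add (((c3.mul c4).mul c4).add (c2.mul (continuousOn_const.sub hF2)))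
  have heq : ∀ x ∈ Ico x₂ r, F x + H (g x) = κ * x ^ 2 ∧ f1 x = 2 * κ * x ∧ f2 x = 2 * κ := by
    intro x hx
    have hgx : δ ≤ g x := hδ2.le.trans (hmono.monotoneOn m2 ⟨m2.1.trans_le hx.1, hx.2⟩ hx.1)
    obtain ⟨e1, e2, e3⟩ := hhi _ hgx
    simp only [f1, f2, e1, e2, e3]
    refine ⟨?_, ?_, ?_⟩
    · simp only [hgdef]; ring
    · ring
    · ring
  -- F is only given up to r, so the formula is replaced by the parabola, with which it agrees on
  -- [x₂, r), at some x₃ in between.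
  obtain ⟨x₃, h23, h3r⟩ := exists_between hr
  have hif : ∀ x ∈ Ioo l r, ¬ x < x₃ → x ∈ Ico x₂ r := fun x hx h =>
    ⟨h23.le.trans (not_lt.1 h), hx.2⟩
  have hval : ∀ x ∈ Ioo l r, (if x < x₃ then F x + H (g x) else κ * x ^ 2) = F x + H (g x) := by
    intro x hx
    split_ifs with h
    exacts [rfl, (heq x (hif x hx h)).1.symm]
  refine ⟨fun x => if x < x₃ then F x + H (g x) else κ * x ^ 2,
    fun x => if x < x₃ then f1 x else 2 * κ * x, fun x => if x < x₃ then f2 x else 2 * κ, x₁, hx₁,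
    ?_, ?_, ?_, ?_, ?_, ?_, ?_⟩
  · intro x hx
    refine HasDerivAt.ite h23 (fun h => hf x ⟨hx, h.trans h3r⟩) (fun _ => ?_)
      fun y hy => (heq y ⟨hy.1.le, hy.2.trans h3r⟩).1
    exact ((hasDerivAt_pow 2 x).const_mul κ).congr_deriv (by push_cast; ring)
  · intro x hx
    refine HasDerivAt.ite h23 (fun h => hf1 x ⟨hx, h.trans h3r⟩) (fun _ => ?_)
      fun y hy => (heq y ⟨hy.1.le, hy.2.trans h3r⟩).2.1
    simpa using (hasDerivAt_id x).const_mul (2 * κ)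
  · intro x hx
    refine (ContinuousAt.ite_lt h23 (fun h => hf2.continuousAt
      (Ioo_mem_nhds hx (h.trans h3r))) (fun _ => continuousAt_const)
      fun y hy => (heq y ⟨hy.1.le, hy.2.trans h3r⟩).2.2).continuousWithinAt
  · intro x hx
    have hxr : x ∈ Ioo l r := ⟨hx.1, hx.2.trans_lt m1.2⟩
    have hx3 : x < x₃ := hx.2.trans_lt (hx₁.2.trans h23)
    obtain ⟨e1, e2, e3⟩ := hlo (g x) (by
      rw [← hgx₁]; exact hmono.monotoneOn hxr m1 hx.2)
    simp only [if_pos hx3, f2, e1, e2, e3]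
    constructor <;> ring
  · intro x hx
    simp only
    split_ifs with h
    exacts [(heq x ⟨hx, h.trans h3r⟩).1, rfl]
  · intro x hx
    have hxr : x ∈ Ioo l r := ⟨m1.1.trans hx.1, hx.2.trans_lt hr⟩
    simp only
    rw [hval x hxr]
    have := hHpos (g x) (by rw [← hgx₁]; exact hmono m1 hxr hx.1)
    have := hHle (g x)
    constructor
    · linarith
    · simp only [hgdef] at this ⊢; linarith
  · intro x hx
    simp only
    split_ifs with h
    · have hb := hbd (g x)
      have h5 := hpos x ⟨hx, h.trans h3r⟩
      -- Convexity of a smoothed maximum: a convex combination of the two second derivatives plus a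
      -- nonnegative square term.
      have h6 : f2 x = (1 - H1 (g x)) * F2 x + H1 (g x) * (2 * κ) +
        H2 (g x) * ((2 * κ * x - F1 x) * (2 * κ * x - F1 x)) := by simp only [f2]; ring
      rw [h6]
      have h7 := mul_nonneg hb.2.2 (mul_self_nonneg (2 * κ * x - F1 x))
      rcases hb.1.eq_or_lt with h8 | h8
      · rw [← h8]; linarith
      · nlinarith [mul_nonneg (sub_nonneg.2 hb.2.1) h5.le]
    · positivity

lemma eq_of_hasDerivAt_zero {f f' : ℝ → ℝ} {a b : ℝ} (hab : a ≤ b) (hc : ContinuousOn f (Icc a b))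
    (hf : ∀ t ∈ Ioo a b, HasDerivAt f (f' t) t) (h0 : ∀ t ∈ Ioo a b, f' t = 0) : f a = f b :=
  le_antisymm (le_of_hasDerivAt_nonneg hab hc hf fun t ht => (h0 t ht).ge) (by
    have := le_of_hasDerivAt_nonneg (f := fun t => -f t) (f' := fun t => -f' t) hab hc.neg
      (fun t ht => (hf t ht).neg) fun t ht => by rw [h0 t ht, neg_zero]
    linarith)

/-- A concave graph can be bent upwards so that it becomes convex. -/
lemma exists_bend {l r t₀ w K : ℝ} {F F1 F2 : ℝ → ℝ} (hw : 0 < w) (hl : l < t₀)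
    (hr : t₀ + 4 * w < r) (hF : ∀ x ∈ Ioo l r, HasDerivAt F (F1 x) x)
    (hF1 : ∀ x ∈ Ioo l r, HasDerivAt F1 (F2 x) x) (hF2 : ContinuousOn F2 (Ioo l r))
    (hneg : ∀ x ∈ Ioo l r, F2 x < 0) (hK : ∀ x ∈ Ioo l r, -K ≤ F2 x) :
    ∃ G G1 G2 : ℝ → ℝ, (∀ x ∈ Ioo l r, HasDerivAt G (G1 x) x) ∧
      (∀ x ∈ Ioo l r, HasDerivAt G1 (G2 x) x) ∧ ContinuousOn G2 (Ioo l r) ∧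
      (∀ x ∈ Ioc l t₀, G x = F x) ∧ (∀ x ∈ Ioo t₀ r, F x < G x) ∧
      (∀ x ∈ Ioc l (t₀ + 4 * w), G x ≤ F x + 64 * K * w ^ 2 ∧ G1 x ≤ F1 x + 16 * K * w) ∧
      (∀ x ∈ Ioo l (t₀ + w), G2 x < 0) ∧ G2 (t₀ + w) = 0 ∧ ∀ x ∈ Ioo (t₀ + w) r, 0 < G2 x := by
  have m0 : t₀ ∈ Ioo l r := ⟨hl, by linarith⟩
  have hK0 : 0 < K := by linarith [hneg t₀ m0, hK t₀ m0]
  -- Adding this second derivative multiplies F2 by 1 - (x - t₀)⁺ / w, which changes sign exactly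
  -- once, at t₀ + w. Being positive to the right of t₀, it also pushes the graph up there, into the
  -- required side.
  set d2 : ℝ → ℝ := fun x => max (x - t₀) 0 / w * -F2 x with hd2
  have hd2c : ContinuousOn d2 (Ioo l r) :=
    ContinuousOn.mul (by fun_prop) hF2.neg
  obtain ⟨d1, hd10, hd1⟩ := exists_primitive hd2c m0 0
  have hd1c : ContinuousOn d1 (Ioo l r) := fun x hx => (hd1 x hx).continuousAt.continuousWithinAt
  obtain ⟨d, hd0, hd⟩ := exists_primitive hd1c m0 0
  have hdc : ContinuousOn d (Ioo l r) := fun x hx => (hd x hx).continuousAt.continuousWithinAt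
  have hsub : ∀ x ∈ Ioo l r, ∀ y ∈ Ioo l r, Icc x y ⊆ Ioo l r := fun x hx y hy =>
    ordConnected_Ioo.out hx hy
  have hd2z : ∀ x ≤ t₀, d2 x = 0 := fun x hx => by
    simp only [hd2]; rw [max_eq_right (by linarith)]; ring
  have hd2p : ∀ x ∈ Ioo t₀ r, 0 < d2 x := fun x hx => by
    simp only [hd2]
    rw [max_eq_left (by linarith [hx.1])]
    exact mul_pos (div_pos (by linarith [hx.1]) hw) (by linarith [hneg x ⟨hl.trans hx.1, hx.2⟩])
  have hd1z : ∀ x ∈ Ioc l t₀, d1 x = 0 := fun x hx => by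
    have hx' : x ∈ Ioo l r := ⟨hx.1, hx.2.trans_lt m0.2⟩
    rw [← hd10]
    exact eq_of_hasDerivAt_zero hx.2 (hd1c.mono (hsub x hx' t₀ m0))
      (fun t ht => hd1 t (hsub x hx' t₀ m0 (Ioo_subset_Icc_self ht))) fun t ht => hd2z t ht.2.le
  have hdz : ∀ x ∈ Ioc l t₀, d x = 0 := fun x hx => by
    have hx' : x ∈ Ioo l r := ⟨hx.1, hx.2.trans_lt m0.2⟩
    rw [← hd0]
    exact eq_of_hasDerivAt_zero hx.2 (hdc.mono (hsub x hx' t₀ m0))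
      (fun t ht => hd t (hsub x hx' t₀ m0 (Ioo_subset_Icc_self ht)))
      fun t ht => hd1z t ⟨hx.1.trans ht.1, ht.2.le⟩
  have hd1p : ∀ x ∈ Ioo t₀ r, 0 < d1 x := fun x hx => by
    have hs := hsub t₀ m0 x ⟨hl.trans hx.1, hx.2⟩
    rw [← hd10]
    exact lt_of_hasDerivAt_pos hx.1 (hd1c.mono hs)
      (fun t ht => hd1 t (hs (Ioo_subset_Icc_self ht))) fun t ht => hd2p t ⟨ht.1, ht.2.trans hx.2⟩
  have hdp : ∀ x ∈ Ioo t₀ r, 0 < d x := fun x hx => by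
    have hs := hsub t₀ m0 x ⟨hl.trans hx.1, hx.2⟩
    rw [← hd0]
    exact lt_of_hasDerivAt_pos hx.1 (hdc.mono hs)
      (fun t ht => hd t (hs (Ioo_subset_Icc_self ht))) fun t ht => hd1p t ⟨ht.1, ht.2.trans hx.2⟩
  have hd1b : ∀ x ∈ Icc t₀ (t₀ + 4 * w), d1 x ≤ 16 * K * w := fun x hx => by
    have hs := hsub t₀ m0 x ⟨hl.trans_le hx.1, hx.2.trans_lt hr⟩
    have := le_of_hasDerivAt_nonneg (f := fun t => 4 * K * t - d1 t)
      (f' := fun t => 4 * K - d2 t) hx.1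
      ((continuousOn_const.mul continuousOn_id).sub (hd1c.mono hs))
      (fun t ht => ((hasDerivAt_id t).const_mul (4 * K)).sub
        (hd1 t (hs (Ioo_subset_Icc_self ht))) |>.congr_deriv (by ring)) fun t ht => by
        have ht' := hs (Ioo_subset_Icc_self ht)
        have h1 : max (t - t₀) 0 / w ≤ 4 := by
          rw [max_eq_left (by linarith [ht.1]), div_le_iff₀ hw]
          linarith [ht.2, hx.2]
        have h2 : 0 ≤ max (t - t₀) 0 / w := div_nonneg (le_max_right _ _) hw.le
        have := mul_le_mul h1 (show -F2 t ≤ K by linarith [hK t ht'])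
          (by linarith [hneg t ht']) (by norm_num)
        simp only [hd2]; linarith
    nlinarith [hx.2]
  have hdb : ∀ x ∈ Icc t₀ (t₀ + 4 * w), d x ≤ 64 * K * w ^ 2 := fun x hx => by
    have hs := hsub t₀ m0 x ⟨hl.trans_le hx.1, hx.2.trans_lt hr⟩
    have := le_of_hasDerivAt_nonneg (f := fun t => 16 * K * w * t - d t)
      (f' := fun t => 16 * K * w - d1 t) hx.1
      ((continuousOn_const.mul continuousOn_id).sub (hdc.mono hs))
      (fun t ht => ((hasDerivAt_id t).const_mul (16 * K * w)).sub
        (hd t (hs (Ioo_subset_Icc_self ht))) |>.congr_deriv (by ring)) fun t ht => by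
        linarith [hd1b t ⟨ht.1.le, ht.2.le.trans hx.2⟩]
    have h3 : 16 * K * w * (x - t₀) ≤ 16 * K * w * (4 * w) :=
      mul_le_mul_of_nonneg_left (by linarith [hx.2]) (by positivity)
    nlinarith
  have hG2 : ∀ x, F2 x + d2 x = F2 x * (1 - max (x - t₀) 0 / w) := fun x => by
    simp only [hd2]; ring
  refine ⟨fun x => F x + d x, fun x => F1 x + d1 x, fun x => F2 x + d2 x,
    fun x hx => (hF x hx).add (hd x hx), fun x hx => (hF1 x hx).add (hd1 x hx), hF2.add hd2c,
    fun x hx => ?_, fun x hx => ?_, fun x hx => ?_, fun x hx => ?_, ?_, fun x hx => ?_⟩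
  · simp only [hdz x hx, add_zero]
  · have := hdp x hx; simp only; linarith
  · rcases le_total x t₀ with h | h
    · simp only [hdz x ⟨hx.1, h⟩, hd1z x ⟨hx.1, h⟩]
      constructor
      · have : 0 ≤ 64 * K * w ^ 2 := by positivity
        linarith
      · have : 0 ≤ 16 * K * w := by positivity
        linarith
    · have h1 := hd1b x ⟨h, hx.2⟩
      have h2 := hdb x ⟨h, hx.2⟩
      simp only
      constructor <;> linarith
  · simp only [hG2]
    refine mul_neg_of_neg_of_pos (hneg x ⟨hx.1, by linarith [hx.2]⟩) (sub_pos.2 ?_)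
    rw [div_lt_one hw]
    exact max_lt (by linarith [hx.2]) hw
  · simp only [hG2]
    rw [max_eq_left (by linarith), add_sub_cancel_left, div_self hw.ne', sub_self, mul_zero]
  · simp only [hG2]
    refine mul_pos_of_neg_of_neg (hneg x ⟨by linarith [hx.1], hx.2⟩) (sub_neg.2 ?_)
    rw [lt_div_iff₀ hw, one_mul]
    exact lt_max_of_lt_left (by linarith [hx.1])

/-- A decreasing graph through the origin can be joined to a parabola on the right by a graph that
has no inflection if the given graph is convex, and just one if it is concave. -/
lemma exists_join {ρ κ m K η : ℝ} {F F1 F2 : ℝ → ℝ} (hρ : 0 < ρ)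
    (hF : ∀ x ∈ Ioo (-ρ) ρ, HasDerivAt F (F1 x) x)
    (hF1 : ∀ x ∈ Ioo (-ρ) ρ, HasDerivAt F1 (F2 x) x) (hF2 : ContinuousOn F2 (Ioo (-ρ) ρ))
    (h0 : F 0 = 0) (hm : 0 < m) (hslope : ∀ x ∈ Ioo (-ρ) ρ, F1 x < -m) (hκ : 0 < κ)
    (hκρ : 4 * κ * ρ < m) (hK : ∀ x ∈ Ioo (-ρ) ρ, -K ≤ F2 x) (hη : 0 < η)
    (hsgn : (∀ x ∈ Ioo (-ρ) ρ, 0 < F2 x) ∨ ∀ x ∈ Ioo (-ρ) ρ, F2 x < 0) :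
    ∃ (f f1 f2 : ℝ → ℝ) (x₁ x₂ : ℝ), -η < x₁ ∧ -ρ < x₁ ∧ x₁ < x₂ ∧ 0 < x₂ ∧ x₂ < η ∧ x₂ < ρ ∧
      (∀ x > -ρ, HasDerivAt f (f1 x) x) ∧ (∀ x > -ρ, HasDerivAt f1 (f2 x) x) ∧
      ContinuousOn f2 (Ioi (-ρ)) ∧ (∀ x ∈ Ioc (-ρ) x₁, f x = F x) ∧
      (∀ x ≥ x₂, f x = κ * x ^ 2) ∧ (∀ x ∈ Ioc x₁ x₂, F x < f x ∧ f x < F x + η) ∧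
      ((∀ x ∈ Ioo (-ρ) ρ, 0 < F2 x) → ∀ x > -ρ, 0 < f2 x) ∧
      ((∀ x ∈ Ioo (-ρ) ρ, F2 x < 0) →
        ∃ x₀ > x₁, x₀ < x₂ ∧ f2 x₀ = 0 ∧ ∀ x > -ρ, f2 x = 0 → x = x₀) := by
  have hz : (0 : ℝ) ∈ Ioo (-ρ) ρ := ⟨by linarith, hρ⟩
  have hFc : ContinuousOn F (Ioo (-ρ) ρ) := fun x hx => (hF x hx).continuousAt.continuousWithinAt
  have hpos0 : ∀ x ∈ Ioo (-ρ) ρ, x ≤ 0 → -(m * x) ≤ F x := fun x hx hx0 => by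
    have hs : Icc x 0 ⊆ Ioo (-ρ) ρ := ordConnected_Ioo.out hx hz
    have := le_of_hasDerivAt_nonneg (f := fun t => -(F t) - m * t)
      (f' := fun t => -(F1 t) - m) hx0 ((hFc.mono hs).neg.sub (continuousOn_const.mul continuousOn_id))
      (fun t ht => ((hF t (hs (Ioo_subset_Icc_self ht))).neg.sub
        ((hasDerivAt_id t).const_mul m)).congr_deriv (by ring)) fun t ht => by
        linarith [hslope t (hs (Ioo_subset_Icc_self ht))]
    simp only [h0] at this
    linarith
  have hneg0 : ∀ x ∈ Ioo (-ρ) ρ, 0 ≤ x → F x ≤ -(m * x) := fun x hx hx0 => by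
    have hs : Icc 0 x ⊆ Ioo (-ρ) ρ := ordConnected_Ioo.out hz hx
    have := le_of_hasDerivAt_nonneg (f := fun t => -(F t) - m * t)
      (f' := fun t => -(F1 t) - m) hx0 ((hFc.mono hs).neg.sub (continuousOn_const.mul continuousOn_id))
      (fun t ht => ((hF t (hs (Ioo_subset_Icc_self ht))).neg.sub
        ((hasDerivAt_id t).const_mul m)).congr_deriv (by ring)) fun t ht => by
        linarith [hslope t (hs (Ioo_subset_Icc_self ht))]
    simp only [h0] at this
    linarith
  obtain ⟨τ, hτ, hFτ⟩ : ∃ τ > 0, ∀ x, |x| < τ → |F x| < η / 8 := by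
    have := Metric.continuousAt_iff.1 (hF 0 hz).continuousAt (η / 8) (by positivity)
    obtain ⟨τ, hτ, h⟩ := this
    exact ⟨τ, hτ, fun x hx => by simpa [Real.dist_eq, h0] using h (x := x) (by simpa using hx)⟩
  -- The scale on which everything happens: bending must not spoil the steep descent, and all
  -- vertical displacements must stay below η.
  obtain ⟨w, hw, w1, w2, w3, w4, w5, w6⟩ : ∃ w > 0, 4 * w < ρ ∧ 4 * w < τ ∧ 4 * w < η ∧
      16 * K * w < m / 8 ∧ 64 * K * w ^ 2 < η / 8 ∧ 16 * κ * w ^ 2 < η / 8 := by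
    have key : ∀ (g : ℝ → ℝ) (c : ℝ), Continuous g → g 0 < c → ∀ᶠ w in 𝓝[>] (0 : ℝ), g w < c :=
      fun g c hg h => (hg.continuousAt.eventually (gt_mem_nhds h)).filter_mono nhdsWithin_le_nhds
    have a1 := key (fun w => 4 * w) ρ (by fun_prop) (by simpa)
    have a2 := key (fun w => 4 * w) τ (by fun_prop) (by simpa)
    have a3 := key (fun w => 4 * w) η (by fun_prop) (by simpa)
    have a4 := key (fun w => 16 * K * w) (m / 8) (by fun_prop) (by simpa)
    have a5 := key (fun w => 64 * K * w ^ 2) (η / 8) (by fun_prop) (by simpa)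
    have a6 := key (fun w => 16 * κ * w ^ 2) (η / 8) (by fun_prop) (by simpa)
    obtain ⟨w, h⟩ := (Filter.Eventually.and (self_mem_nhdsWithin : Ioi (0 : ℝ) ∈ 𝓝[>] 0)
      (a1.and (a2.and (a3.and (a4.and (a5.and a6)))))).exists
    exact ⟨w, h⟩
  have hsq : ∀ x, |x| < 4 * w → κ * x ^ 2 < η / 8 := fun x hx => by
    have : x ^ 2 ≤ (4 * w) ^ 2 := sq_le_sq' (by linarith [(abs_lt.1 hx).1]) (abs_lt.1 hx).2.le
    nlinarith
  have hest : ∀ x, |x| < 4 * w → |κ * x ^ 2 - F x| < η / 4 := fun x hx => by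
    have e1 := hsq x hx
    have e2 := abs_lt.1 (hFτ x (hx.trans w2))
    have e3 : 0 ≤ κ * x ^ 2 := by positivity
    rw [abs_lt]
    constructor <;> linarith
  have hκw : 4 * κ * w < m := by nlinarith
  have hp2 : κ * (-(2 * w)) ^ 2 < F (-(2 * w)) := by
    have := hpos0 (-(2 * w)) ⟨by linarith, by linarith⟩ (by linarith)
    nlinarith
  rcases hsgn with hs | hs
  -- A convex graph is joined to the parabola directly: it lies above the parabola at -2w and below
  -- it at w.
  · obtain ⟨f, f1, f2, x₁, hx₁, c1, c2, c3, c4, c5, c6, c7⟩ := exists_corner (l := -ρ) (r := ρ)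
      (x₀ := -(2 * w)) (x₂ := w) (κ := κ) (ε := η / 4) (by linarith) (by linarith) (by linarith)
      hF hF1 hF2 hκ (fun x hx => by nlinarith [hslope x hx, hx.1]) hp2
      (by
        have := hneg0 w ⟨by linarith, by linarith⟩ hw.le
        have : 0 < κ * w ^ 2 := by positivity
        nlinarith)
      (fun x hx => hs x ⟨by linarith [hx.1], hx.2⟩) (by linarith)
    refine ⟨f, f1, f2, x₁, w, by linarith [hx₁.1], by linarith [hx₁.1], hx₁.2, hw, by linarith,
      by linarith, c1, c2, c3, fun x hx => (c4 x hx).1, c5, fun x hx => ?_, ?_, ?_⟩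
    · obtain ⟨e1, e2⟩ := c6 x hx
      have := hest x (by rw [abs_lt]; constructor <;> linarith [hx.1, hx.2, hx₁.1])
      exact ⟨e1, by linarith⟩
    · intro _ x hx
      by_cases h : x ≤ x₁
      · rw [(c4 x ⟨hx, h⟩).2]
        exact hs x ⟨hx, by linarith [hx₁.2]⟩
      · exact c7 x (by linarith [hx₁.1])
    · intro hcon
      exact absurd (hcon 0 hz) (hs 0 hz).le.not_gt
  -- A concave graph is bent from -3w on. The bent graph has its inflection at -2w, where it is
  -- still above the parabola, and is convex from there to the corner. The corner is finished at w /
  -- 2 because the bounds on the bent graph hold only up to w.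
  · obtain ⟨G, G1, G2, b1, b2, b3, b4, b5, b6, b7, b8, b9⟩ := exists_bend (l := -ρ) (r := ρ)
      (t₀ := -(3 * w)) hw (by linarith) (by linarith) hF hF1 hF2 hs hK
    have hb : -(3 * w) + 4 * w = w := by ring
    have hb' : -(3 * w) + w = -(2 * w) := by ring
    rw [hb] at b6
    rw [hb'] at b7 b8 b9
    have hGw : G (w / 2) < κ * (w / 2) ^ 2 := by
      have e1 := (b6 (w / 2) ⟨by linarith, by linarith⟩).1
      have e2 := hneg0 (w / 2) ⟨by linarith, by linarith⟩ (by linarith)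
      have e3 : 0 < κ * (w / 2) ^ 2 := by positivity
      have e4 : 64 * K * w ^ 2 ≤ m * (w / 2) := by
        nlinarith
      linarith
    have hsubw : Ioo (-ρ) w ⊆ Ioo (-ρ) ρ := Ioo_subset_Ioo_right (by linarith)
    obtain ⟨f, f1, f2, x₁, hx₁, c1, c2, c3, c4, c5, c6, c7⟩ := exists_corner (l := -ρ) (r := w)
      (x₀ := -(2 * w)) (x₂ := w / 2) (κ := κ) (ε := η / 4) (by linarith) (by linarith) (by linarith)
      (fun x hx => b1 x (hsubw hx)) (fun x hx => b2 x (hsubw hx)) (b3.mono hsubw) hκ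
      (fun x hx => by
        have e1 := (b6 x ⟨hx.1, hx.2.le⟩).2
        have e2 := hslope x (hsubw hx)
        nlinarith [hx.1]) (hp2.trans (b5 _ ⟨by linarith, by linarith⟩)) hGw
      (fun x hx => b9 x ⟨hx.1, by linarith [hx.2]⟩) (by linarith)
    refine ⟨f, f1, f2, -(3 * w), w / 2, by linarith, by linarith, by linarith, by linarith,
      by linarith, by linarith, c1, c2, c3, fun x hx => ?_, c5, fun x hx => ?_, ?_, fun _ => ?_⟩
    · rw [(c4 x ⟨hx.1, by linarith [hx.2, hx₁.1]⟩).1, b4 x hx]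
    · have hd := (b6 x ⟨by linarith [hx.1], by linarith [hx.2]⟩).1
      have hlt := b5 x ⟨hx.1, by linarith [hx.2]⟩
      have := hest x (by rw [abs_lt]; constructor <;> linarith [hx.1, hx.2])
      by_cases h : x ≤ x₁
      · rw [(c4 x ⟨by linarith [hx.1], h⟩).1]
        exact ⟨hlt, by linarith⟩
      · obtain ⟨e1, e2⟩ := c6 x ⟨not_le.1 h, hx.2⟩
        refine ⟨hlt.trans e1, ?_⟩
        have : |κ * x ^ 2 - G x| ≤ |κ * x ^ 2 - F x| + 64 * K * w ^ 2 := by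
          have e3 : κ * x ^ 2 - G x = (κ * x ^ 2 - F x) - (G x - F x) := by ring
          rw [e3]
          refine (abs_sub _ _).trans ?_
          rw [abs_of_pos (sub_pos.2 hlt)]
          linarith
        linarith
    · intro hcon
      exact absurd (hcon 0 hz) (hs 0 hz).le.not_gt
    · refine ⟨-(2 * w), by linarith, by linarith, ?_, ?_⟩
      · rw [(c4 _ ⟨by linarith, hx₁.1.le⟩).2, b8]
      · intro x hx hx0
        rcases lt_trichotomy x (-(2 * w)) with h | h | h
        · rw [(c4 x ⟨hx, (h.trans hx₁.1).le⟩).2] at hx0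
          exact absurd hx0 (b7 x ⟨hx, h⟩).ne
        · exact h
        · exact absurd hx0 (c7 x h).ne'

/-- The function `f` is twice continuously differentiable at `x` with derivatives `f1` and `f2`. -/
structure C2At {E : Type*} [NormedAddCommGroup E] [NormedSpace ℝ E] (f f1 f2 : ℝ → E) (x : ℝ) :
    Prop where
  hasDerivAt : HasDerivAt f (f1 x) x
  hasDerivAt' : HasDerivAt f1 (f2 x) x
  cont : ContinuousAt f2 x

section C2At
variable {E : Type*} [NormedAddCommGroup E] [NormedSpace ℝ E] {f f1 f2 g g1 g2 : ℝ → E}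

lemma C2At.eq_of_eq {a b : ℝ} (hf : ∀ x ∈ Ioo a b, C2At f f1 f2 x)
    (hg : ∀ x ∈ Ioo a b, C2At g g1 g2 x) (h : ∀ x ∈ Ioo a b, f x = g x) {x : ℝ}
    (hx : x ∈ Ioo a b) : f1 x = g1 x ∧ f2 x = g2 x := by
  have h1 : ∀ x ∈ Ioo a b, f1 x = g1 x := fun x hx =>
    ((hf x hx).hasDerivAt.congr_of_eventuallyEq (by
      filter_upwards [Ioo_mem_nhds hx.1 hx.2] with y hy using (h y hy).symm)).unique
      (hg x hx).hasDerivAt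
  exact ⟨h1 x hx, ((hf x hx).hasDerivAt'.congr_of_eventuallyEq (by
      filter_upwards [Ioo_mem_nhds hx.1 hx.2] with y hy using (h1 y hy).symm)).unique
      (hg x hx).hasDerivAt'⟩

lemma C2At.ite {a c x : ℝ} (hac : a < c) (hf : x < c → C2At f f1 f2 x)
    (hg : c ≤ x → C2At g g1 g2 x)
    (h : ∀ y ∈ Ioo a c, C2At f f1 f2 y ∧ C2At g g1 g2 y ∧ f y = g y) :
    C2At (fun y => if y < c then f y else g y) (fun y => if y < c then f1 y else g1 y)
      (fun y => if y < c then f2 y else g2 y) x := by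
  have key := fun y (hy : y ∈ Ioo a c) => C2At.eq_of_eq (fun y hy => (h y hy).1)
    (fun y hy => (h y hy).2.1) (fun y hy => (h y hy).2.2) hy
  exact ⟨HasDerivAt.ite hac (fun hx => (hf hx).hasDerivAt) (fun hx => (hg hx).hasDerivAt)
      fun y hy => (h y hy).2.2,
    HasDerivAt.ite hac (fun hx => (hf hx).hasDerivAt') (fun hx => (hg hx).hasDerivAt')
      fun y hy => (key y hy).1,
    ContinuousAt.ite_lt hac (fun hx => (hf hx).cont) (fun hx => (hg hx).cont)
      fun y hy => (key y hy).2⟩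

lemma C2At.comp_add {s x : ℝ} (h : C2At f f1 f2 (x + s)) :
    C2At (fun y => f (y + s)) (fun y => f1 (y + s)) (fun y => f2 (y + s)) x :=
  ⟨h.hasDerivAt.comp_add_const x s, h.hasDerivAt'.comp_add_const x s,
    ContinuousAt.comp (f := fun y => y + s) h.cont (by fun_prop)⟩

lemma C2At.comp_sub {s x : ℝ} (h : C2At f f1 f2 (s - x)) :
    C2At (fun y => f (s - y)) (fun y => -f1 (s - y)) (fun y => f2 (s - y)) x :=
  ⟨h.hasDerivAt.comp_const_sub s x, (h.hasDerivAt'.comp_const_sub s x).neg.congr_deriv (neg_neg _),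
    ContinuousAt.comp (f := fun y => s - y) h.cont (by fun_prop)⟩

lemma C2At.continuousAt {x : ℝ} (h : C2At f f1 f2 x) : ContinuousAt f x := h.hasDerivAt.continuousAt

end C2At

lemma strictMonoOn_of_hasDerivAt_pos {f f' : ℝ → ℝ} {s : Set ℝ} (hs : s.OrdConnected)
    (hf : ∀ t ∈ s, HasDerivAt f (f' t) t) (hpos : ∀ t ∈ s, 0 < f' t) : StrictMonoOn f s :=
  fun _ hx _ hy hxy => lt_of_hasDerivAt_pos hxy
    (fun t ht => (hf t (hs.out hx hy ht)).continuousAt.continuousWithinAt)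
    (fun t ht => hf t (hs.out hx hy (Ioo_subset_Icc_self ht)))
    (fun t ht => hpos t (hs.out hx hy (Ioo_subset_Icc_self ht)))

/-- Every increasing function can be continued by a translation. -/
lemma exists_blend {r w K : ℝ} {X X1 X2 : ℝ → ℝ} (hw : 0 < w) (hwr : 2 * w < r)
    (hX : ∀ u ∈ Ioo (-r) r, C2At X X1 X2 u) (h0 : X 0 = 0)
    (hpos : ∀ u ∈ Ioo (-r) r, 0 < X1 u) (hK1 : 1 ≤ K) (hK : ∀ u ∈ Ioo (-r) r, X1 u ≤ K) :
    ∃ Z Z1 Z2 : ℝ → ℝ, (∀ u > -r, C2At Z Z1 Z2 u) ∧ (∀ u ∈ Ioc (-r) w, Z u = X u) ∧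
      (∀ u > -r, 0 < Z1 u) ∧ (∀ u ≥ 2 * w, Z u = u - (2 * w - Z (2 * w))) ∧ Z (2 * w) ≤ 2 * w * K := by
  have hz : (0 : ℝ) ∈ Ioo (-r) r := ⟨by linarith, by linarith⟩
  have hXc : ContinuousOn X (Ioo (-r) r) := fun u hu => (hX u hu).continuousAt.continuousWithinAt
  have hX1c : ContinuousOn X1 (Ioo (-r) r) := fun u hu =>
    (hX u hu).hasDerivAt'.continuousAt.continuousWithinAt
  -- Z is a primitive of (1 - χ) * X1 + χ: a convex combination of positive speeds is positive, and
  -- it stays at most K since K ≥ 1.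
  set χ : ℝ → ℝ := fun u => Real.smoothTransition ((u - w) / w) with hχ
  have hχs : ContDiff ℝ 1 χ := Real.smoothTransition.contDiff.comp (by fun_prop)
  have hχd : ∀ u, HasDerivAt χ (deriv χ u) u := fun u =>
    (hχs.differentiable (by norm_num)).differentiableAt.hasDerivAt
  have hχc : Continuous (deriv χ) := hχs.continuous_deriv le_rfl
  have hχ0 : ∀ u ≤ w, χ u = 0 := fun u hu =>
    Real.smoothTransition.zero_of_nonpos (div_nonpos_of_nonpos_of_nonneg (by linarith) hw.le)
  have hχ1 : ∀ u ≥ 2 * w, χ u = 1 := fun u hu =>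
    Real.smoothTransition.one_of_one_le (by rw [le_div_iff₀ hw]; linarith)
  have hχn : ∀ u, 0 ≤ χ u := fun u => Real.smoothTransition.nonneg _
  have hχl : ∀ u, χ u ≤ 1 := fun u => Real.smoothTransition.le_one _
  set Y1 : ℝ → ℝ := fun u => (1 - χ u) * X1 u + χ u with hY1
  set Y2 : ℝ → ℝ := fun u => -deriv χ u * X1 u + (1 - χ u) * X2 u + deriv χ u with hY2
  have hY1d : ∀ u ∈ Ioo (-r) r, HasDerivAt Y1 (Y2 u) u := fun u hu =>
    (((hχd u).const_sub 1).mul (hX u hu).hasDerivAt').add (hχd u)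
  have hY2c : ∀ u ∈ Ioo (-r) r, ContinuousAt Y2 u := fun u hu => by
    have c1 := (hX u hu).hasDerivAt'.continuousAt
    have c2 := (hX u hu).cont
    have c3 := hχc.continuousAt (x := u)
    have c4 := (hχd u).continuousAt
    exact ((c3.neg.mul c1).add ((continuousAt_const.sub c4).mul c2)).add c3
  obtain ⟨Y, hY0, hYd⟩ := exists_primitive (f := Y1)
    (fun u hu => (hY1d u hu).continuousAt.continuousWithinAt) hz 0
  have hYc : ∀ u ∈ Ioo (-r) r, C2At Y Y1 Y2 u := fun u hu => ⟨hYd u hu, hY1d u hu, hY2c u hu⟩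
  have hYX : ∀ u ∈ Ioo (-r) w, Y u = X u := by
    intro u hu
    refine eq_of_hasDerivAt_eq (f' := X1) (l := -r) (r := w) (t₀ := 0) (fun t ht => ?_)
      (fun t ht => (hX t ⟨ht.1, by linarith [ht.2]⟩).hasDerivAt) ⟨hz.1, hw⟩ (by rw [hY0, h0]) hu
    exact (hYd t ⟨ht.1, by linarith [ht.2]⟩).congr_deriv (by simp [hY1, hχ0 t ht.2.le])
  -- X is only given up to r, so from r' on the primitive is replaced by the translation with which
  -- it agrees beyond 2w.
  obtain ⟨r', h1, h2⟩ := exists_between hwr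
  have hYlin : ∀ u ∈ Ioo (2 * w) r, Y u = u - (r' - Y r') := by
    intro u hu
    refine eq_of_hasDerivAt_eq (f' := fun _ => 1) (t₀ := r') (fun t ht => ?_)
      (fun t ht => (hasDerivAt_id t).sub_const _) ⟨h1, h2⟩ (by simp) hu
    exact (hYd t ⟨by linarith [ht.1], ht.2⟩).congr_deriv (by simp [hY1, hχ1 t ht.1.le])
  have hclo : ∀ {f g : ℝ → ℝ} {l b : ℝ}, l < b → ContinuousAt f b → ContinuousAt g b →
      (∀ u ∈ Ioo l b, f u = g u) → f b = g b := by
    intro f g l b hlb hf hg h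
    refine tendsto_nhds_unique_of_eventuallyEq (hf.mono_left (nhdsWithin_le_nhds (s := Iio b)))
      (hg.mono_left nhdsWithin_le_nhds) ?_
    filter_upwards [Ioo_mem_nhdsLT hlb] with u hu using h u hu
  have hclo' : ∀ {f g : ℝ → ℝ} {l b : ℝ}, b < l → ContinuousAt f b → ContinuousAt g b →
      (∀ u ∈ Ioo b l, f u = g u) → f b = g b := by
    intro f g l b hlb hf hg h
    refine tendsto_nhds_unique_of_eventuallyEq (hf.mono_left (nhdsWithin_le_nhds (s := Ioi b)))
      (hg.mono_left nhdsWithin_le_nhds) ?_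
    filter_upwards [Ioo_mem_nhdsGT hlb] with u hu using h u hu
  have hYw : Y w = X w := hclo (by linarith) (hYd w ⟨by linarith, by linarith⟩).continuousAt
    (hX w ⟨by linarith, by linarith⟩).continuousAt hYX
  have hY2w : Y (2 * w) = 2 * w - (r' - Y r') := hclo' (f := Y) (g := fun u => u - (r' - Y r'))
    hwr (hYd _ ⟨by linarith, by linarith⟩).continuousAt (by fun_prop) hYlin
  have hs : r' - Y r' = 2 * w - Y (2 * w) := by linarith
  have hY1p : ∀ u ∈ Ioo (-r) r, 0 < Y1 u := fun u hu => by
    have := hpos u hu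
    simp only [hY1]
    rcases (hχn u).eq_or_lt with h | h
    · rw [← h]; linarith
    · nlinarith [mul_nonneg (sub_nonneg.2 (hχl u)) this.le]
  refine ⟨fun u => if u < r' then Y u else u - (r' - Y r'), fun u => if u < r' then Y1 u else 1,
    fun u => if u < r' then Y2 u else 0, ?_, ?_, ?_, ?_, ?_⟩
  · have hlin : ∀ u, C2At (fun u : ℝ => u - (r' - Y r')) (fun _ => 1) (fun _ => 0) u := fun u =>
      ⟨(hasDerivAt_id u).sub_const _, hasDerivAt_const _ _, continuousAt_const⟩
    intro u hu
    exact C2At.ite h1 (fun h => hYc u ⟨hu, h.trans h2⟩) (fun _ => hlin u)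
      fun y hy => ⟨hYc y ⟨by linarith [hy.1], hy.2.trans h2⟩, hlin y,
        hYlin y ⟨hy.1, hy.2.trans h2⟩⟩
  · intro u hu
    simp only
    rw [if_pos (by linarith [hu.2])]
    rcases hu.2.eq_or_lt with h | h
    · rw [h, hYw]
    · exact hYX u ⟨hu.1, h⟩
  · intro u hu
    simp only
    split_ifs with h
    exacts [hY1p u ⟨hu, h.trans h2⟩, one_pos]
  · intro u hu
    simp only
    rw [if_pos h1, ← hs]
    split_ifs with h
    · rcases hu.le.eq_or_lt with h' | h'
      · rw [← h', hY2w]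
      · exact hYlin u ⟨h', h.trans h2⟩
    · rfl
  · simp only
    rw [if_pos h1]
    have hsub : Icc 0 (2 * w) ⊆ Ioo (-r) r := fun t ht => ⟨by linarith [ht.1], by linarith [ht.2]⟩
    have := le_of_hasDerivAt_nonneg (f := fun t => K * t - Y t) (f' := fun t => K - Y1 t)
      (a := 0) (b := 2 * w) (by linarith)
      (fun t ht => ((continuousAt_const.mul continuousAt_id).sub
        (hYd t (hsub ht)).continuousAt).continuousWithinAt)
      (fun t ht => (((hasDerivAt_id t).const_mul K).sub
        (hYd t (hsub (Ioo_subset_Icc_self ht)))).congr_deriv (by ring)) (fun t ht => by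
        have := hK t (hsub (Ioo_subset_Icc_self ht))
        simp only [hY1]
        nlinarith [hχn t, hχl t])
    simp only [hY0] at this
    linarith

/-- A curve is a graph where its first coordinate is increasing. -/
lemma exists_graph {r κ : ℝ} {X X1 X2 Y Y1 Y2 : ℝ → ℝ} (hr : 0 < r)
    (hX : ∀ u ∈ Ioo (-r) r, C2At X X1 X2 u) (hY : ∀ u ∈ Ioo (-r) r, C2At Y Y1 Y2 u)
    (hX0 : X 0 = 0) (hpos : ∀ u ∈ Ioo (-r) r, 0 < X1 u) (hneg : Y1 0 < 0) :
    ∃ (ρ m K : ℝ) (F F1 F2 T : ℝ → ℝ), 0 < ρ ∧ 0 < m ∧ 4 * κ * ρ < m ∧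
      (∀ x ∈ Ioo (-ρ) ρ, HasDerivAt F (F1 x) x) ∧ (∀ x ∈ Ioo (-ρ) ρ, HasDerivAt F1 (F2 x) x) ∧
      ContinuousOn F2 (Ioo (-ρ) ρ) ∧ (∀ x ∈ Ioo (-ρ) ρ, F1 x < -m) ∧
      (∀ x ∈ Ioo (-ρ) ρ, -K ≤ F2 x) ∧ (∀ u ∈ Ioo (-r) r, F (X u) = Y u) ∧
      ∀ x ∈ Ioo (-ρ) ρ, T x ∈ Ioo (-r) r ∧ X (T x) = x ∧
        F2 x = (X1 (T x) * Y2 (T x) - Y1 (T x) * X2 (T x)) / X1 (T x) ^ 3 := by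
  have hz : (0 : ℝ) ∈ Ioo (-r) r := ⟨by linarith, hr⟩
  have hmono : StrictMonoOn X (Ioo (-r) r) :=
    strictMonoOn_of_hasDerivAt_pos ordConnected_Ioo (fun u hu => (hX u hu).hasDerivAt) hpos
  have hXc : ContinuousOn X (Ioo (-r) r) := fun u hu => (hX u hu).continuousAt.continuousWithinAt
  obtain ⟨T, hTc, hT⟩ := hmono.exists_continuousOn_inverse ordConnected_Ioo hXc
  have ma : -(r / 2) ∈ Ioo (-r) r := ⟨by linarith, by linarith⟩
  have mb : r / 2 ∈ Ioo (-r) r := ⟨by linarith, by linarith⟩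
  have ha : X (-(r / 2)) < 0 := hX0 ▸ hmono ma hz (by linarith)
  have hb : 0 < X (r / 2) := hX0 ▸ hmono hz mb (by linarith)
  obtain ⟨ρ₀, hρ₀, hρa, hρb⟩ : ∃ ρ₀ > 0, ρ₀ ≤ -X (-(r / 2)) ∧ ρ₀ ≤ X (r / 2) :=
    ⟨min (-X (-(r / 2))) (X (r / 2)), lt_min (by linarith) hb, min_le_left _ _, min_le_right _ _⟩
  have hsurj : Ioo (-ρ₀) ρ₀ ⊆ X '' Ioo (-r) r := fun x hx => by
    obtain ⟨u, hu, hux⟩ := intermediate_value_Ioo (by linarith : -(r / 2) ≤ r / 2)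
      (hXc.mono (ordConnected_Ioo.out ma mb)) (⟨by linarith [hx.1], by linarith [hx.2]⟩ : x ∈ Ioo _ _)
    exact ⟨u, ordConnected_Ioo.out ma mb (Ioo_subset_Icc_self hu), hux⟩
  have hTx : ∀ x ∈ Ioo (-ρ₀) ρ₀, T x ∈ Ioo (-r) r ∧ X (T x) = x := fun x hx => by
    obtain ⟨u, hu, rfl⟩ := hsurj hx
    rw [hT u hu]; exact ⟨hu, rfl⟩
  have hTcont : ∀ x ∈ Ioo (-ρ₀) ρ₀, ContinuousAt T x := fun x hx =>
    hTc.continuousAt (mem_of_superset (Ioo_mem_nhds hx.1 hx.2) hsurj)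
  have hTd : ∀ x ∈ Ioo (-ρ₀) ρ₀, HasDerivAt T (X1 (T x))⁻¹ x := fun x hx => by
    refine HasDerivAt.of_local_left_inverse (hTcont x hx) (hX _ (hTx x hx).1).hasDerivAt
      (hpos _ (hTx x hx).1).ne' ?_
    filter_upwards [Ioo_mem_nhds hx.1 hx.2] with y hy using (hTx y hy).2
  set F1 : ℝ → ℝ := fun x => Y1 (T x) / X1 (T x) with hF1
  set F2 : ℝ → ℝ := fun x => (X1 (T x) * Y2 (T x) - Y1 (T x) * X2 (T x)) / X1 (T x) ^ 3 with hF2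
  have dF : ∀ x ∈ Ioo (-ρ₀) ρ₀, HasDerivAt (fun x => Y (T x)) (F1 x) x := fun x hx =>
    ((hY _ (hTx x hx).1).hasDerivAt.comp x (hTd x hx)).congr_deriv (by simp only [hF1, div_eq_mul_inv])
  have dF1 : ∀ x ∈ Ioo (-ρ₀) ρ₀, HasDerivAt F1 (F2 x) x := fun x hx => by
    have hp := hpos _ (hTx x hx).1
    refine (((hY _ (hTx x hx).1).hasDerivAt'.comp x (hTd x hx)).div
      ((hX _ (hTx x hx).1).hasDerivAt'.comp x (hTd x hx)) hp.ne').congr_deriv ?_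
    simp only [hF2, Function.comp_apply]
    field_simp
  have cF2 : ∀ x ∈ Ioo (-ρ₀) ρ₀, ContinuousAt F2 x := fun x hx => by
    have hp := hpos _ (hTx x hx).1
    have hXx := hX _ (hTx x hx).1
    have hYx := hY _ (hTx x hx).1
    have e1 : ContinuousAt (fun x => X1 (T x)) x :=
      ContinuousAt.comp (f := T) hXx.hasDerivAt'.continuousAt (hTcont x hx)
    have e2 : ContinuousAt (fun x => Y1 (T x)) x :=
      ContinuousAt.comp (f := T) hYx.hasDerivAt'.continuousAt (hTcont x hx)
    have e3 : ContinuousAt (fun x => X2 (T x)) x :=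
      ContinuousAt.comp (f := T) hXx.cont (hTcont x hx)
    have e4 : ContinuousAt (fun x => Y2 (T x)) x :=
      ContinuousAt.comp (f := T) hYx.cont (hTcont x hx)
    exact ((e1.mul e4).sub (e2.mul e3)).div (e1.pow 3) (pow_pos hp 3).ne'
  have hz₀ : (0 : ℝ) ∈ Ioo (-ρ₀) ρ₀ := ⟨by linarith, hρ₀⟩
  have hT0 : T 0 = 0 := by rw [← hX0]; rw [hT 0 hz, hX0]
  have hF10 : F1 0 < 0 := by
    simp only [hF1, hT0]
    exact div_neg_of_neg_of_pos hneg (hpos 0 hz)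
  set m := -F1 0 / 2 with hm
  have hm0 : 0 < m := by linarith
  have ev : ∀ᶠ x in 𝓝 (0 : ℝ), F1 x < -m ∧ F2 0 - 1 < F2 x :=
    ((dF1 0 hz₀).continuousAt.eventually (gt_mem_nhds (by linarith))).and
      ((cF2 0 hz₀).eventually (lt_mem_nhds (by linarith)))
  obtain ⟨ρ₁, hρ₁, hball⟩ := Metric.eventually_nhds_iff.1 ev
  obtain ⟨ρ, hρ, h1, h2, h3⟩ : ∃ ρ > 0, ρ ≤ ρ₀ ∧ ρ ≤ ρ₁ ∧ 4 * κ * ρ < m := by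
    have a1 : ∀ᶠ x in 𝓝[>] (0 : ℝ), 4 * κ * x < m := by
      have : ContinuousAt (fun x => 4 * κ * x) 0 := by fun_prop
      exact (this.eventually (gt_mem_nhds (by simpa using hm0))).filter_mono nhdsWithin_le_nhds
    obtain ⟨x, hx, hx'⟩ := (a1.and (Ioo_mem_nhdsGT (lt_min hρ₀ hρ₁))).exists
    exact ⟨x, hx'.1, hx'.2.le.trans (min_le_left _ _), hx'.2.le.trans (min_le_right _ _), hx⟩
  have hsub : Ioo (-ρ) ρ ⊆ Ioo (-ρ₀) ρ₀ := Ioo_subset_Ioo (by linarith) h1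
  have hbl : ∀ x ∈ Ioo (-ρ) ρ, F1 x < -m ∧ F2 0 - 1 < F2 x := fun x hx => by
    apply hball
    rw [Real.dist_eq, sub_zero, abs_lt]
    constructor <;> linarith [hx.1, hx.2]
  exact ⟨ρ, m, -(F2 0 - 1), fun x => Y (T x), F1, F2, T, hρ, hm0, h3, fun x hx => dF x (hsub hx),
    fun x hx => dF1 x (hsub hx), fun x hx => (cF2 x (hsub hx)).continuousWithinAt,
    fun x hx => (hbl x hx).1, fun x hx => by linarith [(hbl x hx).2],
    fun u hu => by simp only [hT u hu], fun x hx => ⟨(hTx x (hsub hx)).1, (hTx x (hsub hx)).2, rfl⟩⟩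

/-! ### From an arm to a parabola. -/

namespace Arm
variable {R : ℝ}

/-- A modification of an arm that turns from the arm to a parabola inside a region. -/
structure Half (A : Arm R) (σ κ N : ℝ) (O : Set ℂ) (p d e : ℂ) where
  c : ℝ → ℂ
  c1 : ℝ → ℂ
  c2 : ℝ → ℂ
  -- The arm is run inwards, u standing for the arm parameter τ - u. It is left at u₁, and from L on
  -- the curve is the parabola with u as its coordinate, ready to be glued to the middle curve.
  τ : ℝ
  u₁ : ℝ
  L : ℝ
  lt : u₁ < L
  pos : 0 < L
  lt' : L < N
  mem₁ : τ - u₁ ∈ Ioo (0 : ℝ) 1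
  c2At : ∀ u > τ - A.b, C2At c c1 c2 u
  regular : ∀ u > τ - A.b, c1 u ≠ 0
  arm : ∀ u ∈ Ioc (τ - A.b) u₁, c u = A.g (τ - u)
  mid : ∀ u ≥ L, c u = p + u * d + ((κ * u ^ 2 : ℝ) : ℂ) * e
  mem : ∀ u ∈ Ioc u₁ L, c u ∈ O
  -- This coordinate stays monotone along the middle curve, and so rules out double points in the
  -- assembled arc.
  mono : StrictMonoOn (fun u => σ * cross e (c u)) (Ici u₁)
  ne : A.s = σ → ∀ u > τ - A.b, cross (c1 u) (c2 u) ≠ 0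
  eq : A.s = -σ → ∃ u₀ ∈ Ioo u₁ L, ∀ u > τ - A.b, cross (c1 u) (c2 u) = 0 ↔ u = u₀

/-- Taylor-like coordinates of an arm in the frame `d`, `e`, traversed backwards. -/
lemma exists_coord (A : Arm R) {σ t : ℝ} (hσ : σ = 1 ∨ σ = -1) {d e : ℂ}
    (hd : 0 < σ * cross (A.v t) d) (he : 0 < σ * cross (A.v t) e) (hde : 0 < σ * cross e d) :
    ∃ (X X1 X2 Y Y1 Y2 : ℝ → ℝ), (∀ u ∈ Ioo (t - A.b) t, C2At X X1 X2 u) ∧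
      (∀ u ∈ Ioo (t - A.b) t, C2At Y Y1 Y2 u) ∧ X 0 = 0 ∧ Y 0 = 0 ∧ 0 < X1 0 ∧ Y1 0 < 0 ∧
      (∀ u, A.g (t - u) = A.g t + X u * d + Y u * e) ∧
      (∀ u ∈ Ioo (t - A.b) t, 0 < A.s * σ * (X1 u * Y2 u - Y1 u * X2 u)) := by
  have hσσ : σ * σ = 1 := by rcases hσ with rfl | rfl <;> norm_num
  set k := σ * cross e d with hk
  have hmem : ∀ u ∈ Ioo (t - A.b) t, t - u ∈ Ioo 0 A.b := fun u hu =>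
    ⟨by linarith [hu.2], by linarith [hu.1]⟩
  have hg : ∀ u ∈ Ioo (t - A.b) t, C2At (fun u => A.g (t - u)) (fun u => -A.v (t - u))
      (fun u => A.a (t - u)) u := fun u hu =>
    C2At.comp_sub ⟨A.hasDerivAt _ (hmem u hu), A.hasDerivAt_v _ (hmem u hu),
      A.cont_a.continuousAt (Ioo_mem_nhds (hmem u hu).1 (hmem u hu).2)⟩
  have hlin : ∀ w : ℂ, ∀ u ∈ Ioo (t - A.b) t,
      C2At (fun u => σ * cross w (A.g (t - u) - A.g t) / k) (fun u => σ * cross w (-A.v (t - u)) / k)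
        (fun u => σ * cross w (A.a (t - u)) / k) u := fun w u hu =>
    ⟨((((hg u hu).hasDerivAt.sub_const _).const_cross w).const_mul σ).div_const k,
      (((hg u hu).hasDerivAt'.const_cross w).const_mul σ).div_const k,
      ((continuousAt_const.cross (hg u hu).cont).const_mul σ).div_const k⟩
  -- Coordinates with respect to d and e by Cramer's rule; the signs of the three hypotheses on d
  -- and e make the first coordinate increase and the second decrease at the arm point.
  have hsub : ∀ z : ℂ, z = ((σ * cross e z / k : ℝ) : ℂ) * d + ((-(σ * cross d z / k) : ℝ) : ℂ) * e := by
    intro z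
    have h1 := cross_smul_eq z d e
    have hc : cross d e ≠ 0 := fun h => by
      rw [cross_swap] at h
      rw [hk, neg_eq_zero.1 h, mul_zero] at hde
      exact hde.false
    have hσ0 : σ ≠ 0 := fun h => by simp [h] at hσσ
    have e1 : σ * cross e z / k = cross z e / cross d e := by
      rw [hk, cross_swap e z, cross_swap e d]
      field_simp
    have e2 : -(σ * cross d z / k) = cross d z / cross d e := by
      rw [hk, cross_swap e d]
      field_simp
    rw [e1, e2]
    have hc' : ((cross d e : ℝ) : ℂ) ≠ 0 := by exact_mod_cast hc
    push_cast
    field_simp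
    linear_combination h1
  have hY : ∀ u ∈ Ioo (t - A.b) t,
      C2At (fun u => -(σ * cross d (A.g (t - u) - A.g t) / k))
        (fun u => -(σ * cross d (-A.v (t - u)) / k)) (fun u => -(σ * cross d (A.a (t - u)) / k)) u :=
    fun u hu => ⟨(hlin d u hu).hasDerivAt.neg, (hlin d u hu).hasDerivAt'.neg, (hlin d u hu).cont.neg⟩
  refine ⟨_, _, _, _, _, _, hlin e, hY, by simp [cross_zero_right], by simp [cross_zero_right],
    ?_, ?_, ?_, ?_⟩
  · rw [sub_zero, cross_neg_right, cross_swap e, neg_neg]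
    exact div_pos he hde
  · rw [sub_zero, cross_neg_right, cross_swap d, neg_neg, neg_lt_zero]
    exact div_pos hd hde
  · intro u
    have := hsub (A.g (t - u) - A.g t)
    linear_combination this
  · intro u hu
    have hcurv := A.curv _ (hmem u hu)
    have h1 := hsub (-A.v (t - u))
    have h2 := hsub (A.a (t - u))
    set x1 := σ * cross e (-A.v (t - u)) / k
    set x2 := σ * cross e (A.a (t - u)) / k
    set y1 := -(σ * cross d (-A.v (t - u)) / k)
    set y2 := -(σ * cross d (A.a (t - u)) / k)
    have h3 : cross (-A.v (t - u)) (A.a (t - u)) = (x1 * y2 - y1 * x2) * cross d e := by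
      conv_lhs => rw [h1, h2]
      simp only [cross_add_left, cross_add_right, cross_real_mul_left, cross_real_mul_right,
        cross_self_eq_zero]
      rw [cross_swap e d]
      ring
    rw [cross_neg_left, cross_swap d e] at h3
    have h4 : cross (A.v (t - u)) (A.a (t - u)) = (x1 * y2 - y1 * x2) * cross e d := by linarith
    rw [h4] at hcurv
    have h5 : A.s * ((x1 * y2 - y1 * x2) * cross e d) = A.s * σ * (x1 * y2 - y1 * x2) * k := by
      rw [hk]
      linear_combination (-(A.s * (x1 * y2 - y1 * x2) * cross e d)) * hσσ
    rw [h5] at hcurv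
    exact pos_of_mul_pos_left hcurv hde.le

/-- Points on the side `σ` of an arm. -/
lemma SideIn.exists_mem {A : Arm R} {t σ : ℝ} {U O : Set ℂ} (h : A.SideIn σ t U)
    (ht : t ∈ Ioo (0 : ℝ) 1) {e : ℂ} (he : 0 < σ * cross (A.v t) e) (hO : O ∈ 𝓝 (A.g t)) :
    ∃ ε > 0, ∀ t' y : ℝ, |t' - t| < ε → 0 < y → y < ε → A.g t' + y * e ∈ U ∩ O := by
  have he0 : 0 < ‖e‖ := by
    rw [norm_pos_iff]; rintro rfl; simp [cross_zero_right] at he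
  obtain ⟨c, hc0, hc⟩ : ∃ c > 0, c * ‖e‖ < σ * cross (A.v t) e := by
    refine ⟨σ * cross (A.v t) e / (2 * ‖e‖), by positivity, ?_⟩
    have : σ * cross (A.v t) e / (2 * ‖e‖) * ‖e‖ = σ * cross (A.v t) e / 2 := by field_simp
    linarith
  obtain ⟨ε, hε, hsub⟩ := h c hc0
  have hcont : ContinuousAt (fun q : ℝ × ℝ => A.g q.1 + q.2 * e) (t, 0) := by
    have h1 : ContinuousAt (fun q : ℝ × ℝ => A.g q.1) (t, 0) :=
      ContinuousAt.comp (f := Prod.fst) (x := (t, (0 : ℝ)))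
        (A.hasDerivAt t (A.mem_of_Ioo ht)).continuousAt continuousAt_fst
    exact h1.add ((Complex.continuous_ofReal.comp continuous_snd).continuousAt.mul
      continuousAt_const)
  have hev : ∀ᶠ q : ℝ × ℝ in 𝓝 (t, 0), A.g q.1 + q.2 * e ∈ O :=
    hcont (by simpa using hO)
  obtain ⟨δ, hδ, hball⟩ := Metric.eventually_nhds_iff.1 hev
  refine ⟨min (min ε (ε / ‖e‖)) δ, lt_min (lt_min hε (by positivity)) hδ, fun t' y h1 h2 h3 => ?_⟩
  have h4 := h1.trans_le (min_le_left _ _)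
  have h5 := (h3.trans_le (min_le_left _ _)).trans_le (min_le_right _ _)
  refine ⟨hsub ⟨t', y * e, h4.trans_le (min_le_left _ _), ?_, ?_, rfl⟩, ?_⟩
  · rw [norm_mul, Complex.norm_real, Real.norm_of_nonneg h2.le]
    rwa [lt_div_iff₀ he0] at h5
  · rw [norm_mul, Complex.norm_real, Real.norm_of_nonneg h2.le, cross_real_mul_right]
    nlinarith
  · refine hball (y := (t', y)) ?_
    rw [Prod.dist_eq, max_lt_iff, Real.dist_eq, Real.dist_eq, sub_zero, abs_of_pos h2]
    exact ⟨h1.trans_le (min_le_right _ _), h3.trans_le (min_le_right _ _)⟩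

/-- In the frame d, e the reversed arm is a descending graph F near its point and the parabola is
the graph of κ x². `exists_join` connects them by a graph f ≥ F, which lies on the side σ, with zero
or one inflection according to the convexity of F, that is, to the sign A.s * σ. The curve is run by
a function Z which is the first coordinate of the arm at the start and a translation at the end. -/
lemma exists_half {A : Arm R} {U O : Set ℂ} {σ t κ N : ℝ} (hσ : σ = 1 ∨ σ = -1)
    (ht : t ∈ Ioo (0 : ℝ) 1) (hU : A.SideIn σ t U) (hO : O ∈ 𝓝 (A.g t)) {d e : ℂ}
    (hd : 0 < σ * cross (A.v t) d) (he : 0 < σ * cross (A.v t) e) (hde : 0 < σ * cross e d)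
    (hκ : 0 < κ) (hN : 0 < N)
    (hM : ∀ ξ ∈ Ioo 0 N, A.g t + ξ * d + ((κ * ξ ^ 2 : ℝ) : ℂ) * e ∈ U) :
    Nonempty (Half A σ κ N (U ∩ O) (A.g t) d e) := by
  have hσσ : σ * σ = 1 := by rcases hσ with rfl | rfl <;> norm_num
  have hbt : t < A.b := ht.2.trans A.one_lt
  obtain ⟨X, X1, X2, Y, Y1, Y2, hX, hY, hX0, hY0, hX1, hY1, hco, hsg⟩ := A.exists_coord hσ hd he hde
  obtain ⟨ε, hε, hεU⟩ := hU.exists_mem ht he hO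
  -- the parabola near its vertex
  obtain ⟨N', hN', hN'N, hM'⟩ : ∃ N' > 0, N' ≤ N ∧ ∀ ξ ∈ Ioo 0 N',
      A.g t + ξ * d + ((κ * ξ ^ 2 : ℝ) : ℂ) * e ∈ U ∩ O := by
    have hc : Continuous fun ξ : ℝ => A.g t + ξ * d + ((κ * ξ ^ 2 : ℝ) : ℂ) * e :=
      (continuous_const.add (Complex.continuous_ofReal.mul continuous_const)).add
        ((Complex.continuous_ofReal.comp (by fun_prop)).mul continuous_const)
    have := hc.continuousAt.preimage_mem_nhds (x := 0) (t := O) (by simpa using hO)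
    obtain ⟨δ, hδ, hb⟩ := Metric.eventually_nhds_iff.1 this
    refine ⟨min N δ, lt_min hN hδ, min_le_left _ _, fun ξ hξ => ⟨hM ξ ⟨hξ.1, hξ.2.trans_le
      (min_le_left _ _)⟩, hb (y := ξ) ?_⟩⟩
    rw [Real.dist_eq, sub_zero, abs_of_pos hξ.1]
    exact hξ.2.trans_le (min_le_right _ _)
  have h0m : (0 : ℝ) ∈ Ioo (t - A.b) t := ⟨by linarith, ht.1⟩
  -- A bound for the speed of the first coordinate; it keeps Z (2w) ≤ 2wK inside the range in which
  -- the parabola is known to lie in U and O.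
  obtain ⟨K, hK1, hKX⟩ : ∃ K : ℝ, 1 ≤ K ∧ X1 0 < K := ⟨|X1 0| + 1, by linarith [abs_nonneg (X1 0)],
    by linarith [le_abs_self (X1 0)]⟩
  obtain ⟨r, hr, hrε, hrt, hrb, hr1, hrX⟩ : ∃ r > 0, r ≤ ε ∧ r ≤ t ∧ r ≤ A.b - t ∧ r ≤ 1 - t ∧
      ∀ u ∈ Ioo (-r) r, 0 < X1 u ∧ X1 u ≤ K := by
    have hc := (hX 0 h0m).hasDerivAt'.continuousAt
    obtain ⟨δ, hδ, hb⟩ := Metric.eventually_nhds_iff.1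
      ((hc.eventually (lt_mem_nhds hX1)).and (hc.eventually (gt_mem_nhds hKX)))
    obtain ⟨r, hr, hr'⟩ := exists_between (lt_min (lt_min hε hδ) (lt_min ht.1 (lt_min (sub_pos.2 hbt)
      (sub_pos.2 ht.2))))
    obtain ⟨h12, h345⟩ := lt_min_iff.1 hr'
    obtain ⟨h1, h2⟩ := lt_min_iff.1 h12
    obtain ⟨h3, h45⟩ := lt_min_iff.1 h345
    obtain ⟨h4, h5⟩ := lt_min_iff.1 h45
    refine ⟨r, hr, h1.le, h3.le, h4.le, h5.le, fun u hu => ?_⟩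
    have := hb (y := u) (by rw [Real.dist_eq, sub_zero, abs_lt]; constructor <;> linarith [hu.1, hu.2])
    exact ⟨this.1, this.2.le⟩
  have hsub : Ioo (-r) r ⊆ Ioo (t - A.b) t := Ioo_subset_Ioo (by linarith) hrt
  have hXr := fun u hu => hX u (hsub hu)
  have hYr := fun u hu => hY u (hsub hu)
  obtain ⟨ρ, m, K', F, F1, F2, T, hρ, hm, hκρ, hF, hF1, hF2c, hslope, hF2, hFX, hT⟩ :=
    exists_graph (κ := κ) hr hXr hYr hX0 (fun u hu => (hrX u hu).1) hY1
  have hz : (0 : ℝ) ∈ Ioo (-r) r := ⟨by linarith, hr⟩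
  have hF0 : F 0 = 0 := by
    have := hFX 0 hz
    rwa [hX0, hY0] at this
  have hXmono : StrictMonoOn X (Ioo (-r) r) :=
    strictMonoOn_of_hasDerivAt_pos ordConnected_Ioo (fun u hu => (hXr u hu).hasDerivAt)
      fun u hu => (hrX u hu).1
  -- the speed
  obtain ⟨w, hw, hwr, hwN⟩ : ∃ w > 0, 2 * w < r ∧ 2 * w * K < N' := by
    refine ⟨min r (N' / K) / 3, by positivity, ?_, ?_⟩
    · linarith [min_le_left r (N' / K)]
    · have h1 : min r (N' / K) * K ≤ N' := by
        have := min_le_right r (N' / K)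
        rwa [le_div_iff₀ (by linarith)] at this
      nlinarith
  obtain ⟨Z, Z1, Z2, hZ, hZX, hZ1, hZlin, hZle⟩ :=
    exists_blend hw hwr hXr hX0 (fun u hu => (hrX u hu).1) hK1 fun u hu => (hrX u hu).2
  have hZmono : StrictMonoOn Z (Ioi (-r)) :=
    strictMonoOn_of_hasDerivAt_pos ordConnected_Ioi (fun u hu => (hZ u hu).hasDerivAt) hZ1
  have hwm : w ∈ Ioo (-r) r := ⟨by linarith, by linarith⟩
  have hXw : 0 < X w := hX0 ▸ hXmono hz hwm hw
  -- the graph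
  obtain ⟨f, f1, f2, x₁, x₂, hx1η, hx1ρ, hx12, hx2, hx2η, hx2ρ, hf, hf1, hf2, hfF, hfM, hFf, hin, hout⟩ :=
    exists_join (η := min (min (X w) ε) (ρ / 2)) hρ hF hF1 hF2c hF0 hm hslope hκ hκρ hF2
      (lt_min (lt_min hXw hε) (by linarith))
      (by
        rcases A.sign with h1 | h1 <;> rcases hσ with h2 | h2
        · left; intro x hx
          obtain ⟨hTx, -, h3⟩ := hT x hx
          have := hsg _ (hsub hTx)
          rw [h3]
          exact div_pos (by rw [h1, h2] at this; linarith) (pow_pos (hrX _ hTx).1 3)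
        · right; intro x hx
          obtain ⟨hTx, -, h3⟩ := hT x hx
          have := hsg _ (hsub hTx)
          rw [h3]
          exact div_neg_of_neg_of_pos (by rw [h1, h2] at this; linarith) (pow_pos (hrX _ hTx).1 3)
        · right; intro x hx
          obtain ⟨hTx, -, h3⟩ := hT x hx
          have := hsg _ (hsub hTx)
          rw [h3]
          exact div_neg_of_neg_of_pos (by rw [h1, h2] at this; linarith) (pow_pos (hrX _ hTx).1 3)
        · left; intro x hx
          obtain ⟨hTx, -, h3⟩ := hT x hx
          have := hsg _ (hsub hTx)
          rw [h3]
          exact div_pos (by rw [h1, h2] at this; linarith) (pow_pos (hrX _ hTx).1 3))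
  have hηX : min (min (X w) ε) (ρ / 2) ≤ X w := (min_le_left _ _).trans (min_le_left _ _)
  have hηε : min (min (X w) ε) (ρ / 2) ≤ ε := (min_le_left _ _).trans (min_le_right _ _)
  have hηρ : min (min (X w) ε) (ρ / 2) ≤ ρ / 2 := min_le_right _ _
  have hTm : ∀ x ∈ Ioo (-ρ) ρ, T x ∈ Ioo (-r) r ∧ X (T x) = x := fun x hx =>
    ⟨(hT x hx).1, (hT x hx).2.1⟩
  have hTlt : ∀ x ∈ Ioo (-ρ) ρ, ∀ y ∈ Ioo (-ρ) ρ, x < y → T x < T y := fun x hx y hy hxy => by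
    rw [← (hXmono.lt_iff_lt (hTm x hx).1 (hTm y hy).1), (hTm x hx).2, (hTm y hy).2]
    exact hxy
  have hTw : ∀ x ∈ Ioo (-ρ) ρ, x ≤ x₂ → T x < w := fun x hx h => by
    rw [← (hXmono.lt_iff_lt (hTm x hx).1 hwm), (hTm x hx).2]
    linarith
  have mx1 : x₁ ∈ Ioo (-ρ) ρ := ⟨hx1ρ, by linarith⟩
  have m2 : -(ρ / 2) ∈ Ioo (-ρ) ρ := ⟨by linarith, by linarith⟩
  have m3 : -(3 * ρ / 4) ∈ Ioo (-ρ) ρ := ⟨by linarith, by linarith⟩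
  have hac : T (-(3 * ρ / 4)) < T (-(ρ / 2)) := hTlt _ m3 _ m2 (by linarith)
  -- The graph describes the curve only above -ρ. The arm itself is used before u₂; on the overlap
  -- from -3ρ / 4 to -ρ / 2 both descriptions agree.
  set u₂ := T (-(ρ / 2)) with hu₂
  have hu₂m := hTm _ m2
  have hu₁m := hTm _ mx1
  have hu21 : u₂ < T x₁ := hTlt _ m2 _ mx1 (by linarith)
  have hT1w : T x₁ < w := hTw _ mx1 hx12.le
  have hZT : ∀ x ∈ Ioo (-ρ) ρ, x ≤ x₂ → Z (T x) = x := fun x hx h => by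
    rw [hZX _ ⟨(hTm x hx).1.1, (hTw x hx h).le⟩, (hTm x hx).2]
  have hu₂r : -r < u₂ := hu₂m.1.1
  have hZρ : ∀ u ≥ u₂, -ρ < Z u := fun u hu => by
    have h1 : Z u₂ ≤ Z u := hZmono.monotoneOn hu₂r (hu₂r.trans_le hu) hu
    rw [hu₂, hZT _ m2 (by linarith)] at h1
    linarith
  set C : ℝ → ℂ := fun u => A.g t + Z u * d + f (Z u) * e with hC
  set C1 : ℝ → ℂ := fun u => Z1 u * d + ((f1 (Z u) * Z1 u : ℝ) : ℂ) * e with hC1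
  set C2 : ℝ → ℂ := fun u => Z2 u * d +
    ((f2 (Z u) * Z1 u * Z1 u + f1 (Z u) * Z2 u : ℝ) : ℂ) * e with hC2
  have hCat : ∀ u > T (-(3 * ρ / 4)), C2At C C1 C2 u := by
    intro u hu
    have hur : -r < u := (hTm _ m3).1.1.trans hu
    have hZu : -ρ < Z u := by
      have h1 : Z (T (-(3 * ρ / 4))) < Z u := hZmono (hTm _ m3).1.1 hur hu
      rw [hZT _ m3 (by linarith)] at h1
      linarith
    have hZc := hZ u hur
    have d1 : HasDerivAt (fun u => f (Z u)) (f1 (Z u) * Z1 u) u :=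
      (hf _ hZu).comp u hZc.hasDerivAt
    have d2 : HasDerivAt (fun u => f1 (Z u) * Z1 u) (f2 (Z u) * Z1 u * Z1 u + f1 (Z u) * Z2 u) u :=
      ((hf1 _ hZu).comp u hZc.hasDerivAt).mul hZc.hasDerivAt'
    have d3 : ContinuousAt (fun u => f2 (Z u) * Z1 u * Z1 u + f1 (Z u) * Z2 u) u := by
      have c1 : ContinuousAt (fun u => f2 (Z u)) u :=
        ContinuousAt.comp (f := Z) (hf2.continuousAt (Ioi_mem_nhds hZu)) hZc.continuousAt
      have c2 : ContinuousAt (fun u => f1 (Z u)) u :=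
        ContinuousAt.comp (f := Z) (hf1 _ hZu).continuousAt hZc.continuousAt
      have c3 := hZc.hasDerivAt'.continuousAt
      exact ((c1.mul c3).mul c3).add (c2.mul hZc.cont)
    refine ⟨?_, ?_, ?_⟩
    · exact ((hZc.hasDerivAt.ofReal_comp.mul_const d).const_add (A.g t)).add
        (d1.ofReal_comp.mul_const e)
    · exact (hZc.hasDerivAt'.ofReal_comp.mul_const d).add (d2.ofReal_comp.mul_const e)
    · exact ((Complex.continuous_ofReal.continuousAt.comp hZc.cont).mul continuousAt_const).add
        ((Complex.continuous_ofReal.continuousAt.comp d3).mul continuousAt_const)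
  have hGat : ∀ u ∈ Ioo (t - A.b) t, C2At (fun u => A.g (t - u)) (fun u => -A.v (t - u))
      (fun u => A.a (t - u)) u := fun u hu => by
    have hm : t - u ∈ Ioo 0 A.b := ⟨by linarith [hu.2], by linarith [hu.1]⟩
    exact C2At.comp_sub ⟨A.hasDerivAt _ hm, A.hasDerivAt_v _ hm,
      A.cont_a.continuousAt (Ioo_mem_nhds hm.1 hm.2)⟩
  have hagree : ∀ u ∈ Ioo (-r) r, u ≤ T x₁ → T (-(3 * ρ / 4)) < u → A.g (t - u) = C u := by
    intro u hu h1 h2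
    have e1 : X u ≤ x₁ := by
      rw [← hu₁m.2]; exact hXmono.monotoneOn hu hu₁m.1 h1
    have e2 : -ρ < X u := by
      have := hXmono (hTm _ m3).1 hu h2
      rw [(hTm _ m3).2] at this
      linarith
    simp only [hC]
    rw [hZX u ⟨hu.1, by linarith⟩, hfF _ ⟨e2, e1⟩, hFX u hu, hco u]
  set c : ℝ → ℂ := fun u => if u < u₂ then A.g (t - u) else C u
  set c1 : ℝ → ℂ := fun u => if u < u₂ then -A.v (t - u) else C1 u
  set c2 : ℝ → ℂ := fun u => if u < u₂ then A.a (t - u) else C2 u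
  have hu₂t : u₂ < t := by linarith [hu₂m.1.2]
  have hcat : ∀ u > t - A.b, C2At c c1 c2 u := fun u hu =>
    C2At.ite hac (fun h => hGat u ⟨hu, h.trans hu₂t⟩) (fun h => hCat u (hac.trans_le h))
      fun y hy => ⟨hGat y ⟨by linarith [hy.1, (hTm _ m3).1.1], hy.2.trans hu₂t⟩, hCat y hy.1,
        hagree y ⟨(hTm _ m3).1.1.trans hy.1, hy.2.trans hu₂m.1.2⟩ (hy.2.trans hu21).le hy.1⟩
  have hcC : ∀ u ≥ u₂, c u = C u := fun u hu => if_neg (not_lt.2 hu)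
  have hdet : ∀ u ≥ u₂, cross (c1 u) (c2 u) = Z1 u ^ 3 * f2 (Z u) * cross d e := by
    intro u hu
    simp only [c1, c2, if_neg (not_lt.2 hu), hC1, hC2, cross_add_left, cross_add_right,
      cross_real_mul_left, cross_real_mul_right, cross_self_eq_zero]
    rw [cross_swap e d]
    ring
  have hde0 : cross d e ≠ 0 := fun h => by
    rw [cross_swap, h] at hde
    simp at hde
  have hdet0 : ∀ u ≥ u₂, (cross (c1 u) (c2 u) = 0 ↔ f2 (Z u) = 0) := by
    intro u hu
    rw [hdet u hu]
    have := hZ1 u (hu₂r.trans_le hu)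
    constructor
    · intro h
      by_contra hcon
      exact mul_ne_zero (mul_ne_zero (pow_pos this 3).ne' hcon) hde0 h
    · intro h
      rw [h]; ring
  have hdetA : ∀ u > t - A.b, u < u₂ → cross (c1 u) (c2 u) ≠ 0 := by
    intro u hu h h0
    have := A.curv (t - u) ⟨by linarith, by linarith⟩
    simp only [c1, c2, if_pos h, cross_neg_left, neg_eq_zero] at h0
    rw [h0, mul_zero] at this
    exact this.false
  have hsF : ∀ x ∈ Ioo (-ρ) ρ, 0 < A.s * σ * F2 x := fun x hx => by
    obtain ⟨hTx, -, h3⟩ := hT x hx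
    have := div_pos (hsg _ (hsub hTx)) (pow_pos (hrX _ hTx).1 3)
    rw [h3, ← mul_div_assoc]
    exact this
  -- Shifting the parameter by s makes Z the identity on the parabola.
  set s := 2 * w - Z (2 * w) with hs
  have hZ2w : 0 < Z (2 * w) := by
    have h1 : Z 0 < Z (2 * w) := hZmono (by simp [hr]) (by simp; linarith) (by linarith)
    rw [hZX 0 ⟨by linarith, hw.le⟩, hX0] at h1
    exact h1
  refine ⟨{
    c := fun u => c (u + s)
    c1 := fun u => c1 (u + s)
    c2 := fun u => c2 (u + s)
    τ := t - s
    u₁ := T x₁ - s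
    L := Z (2 * w)
    lt := by rw [hs]; linarith
    pos := hZ2w
    lt' := by linarith
    mem₁ := ⟨by linarith, by linarith [hu₁m.1.1]⟩
    c2At := fun u hu => (hcat (u + s) (by linarith)).comp_add
    regular := fun u hu h0 => ?_
    arm := fun u hu => ?_
    mid := fun u hu => ?_
    mem := fun u hu => ?_
    mono := fun u hu v hv huv => ?_
    ne := fun hA u hu => ?_
    eq := fun hA => ?_ }⟩
  · simp only [c1] at h0
    split_ifs at h0 with h
    · exact A.v_ne_zero (t := t - (u + s)) ⟨by linarith, by linarith⟩ (neg_eq_zero.1 h0)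
    · have := congrArg (fun z => cross z e) h0
      simp only [hC1, cross_add_left, cross_real_mul_left, cross_self_eq_zero, mul_zero, add_zero,
        cross_zero_left] at this
      exact mul_ne_zero (hZ1 _ (hu₂r.trans_le (not_lt.1 h))).ne' hde0 this
  · have e1 : t - s - u = t - (u + s) := by ring
    rw [e1]
    by_cases h : u + s < u₂
    · exact if_pos h
    · rw [hcC _ (not_lt.1 h)]
      have h1 : u + s ≤ T x₁ := by linarith [hu.2]
      exact (hagree _ ⟨by linarith, by linarith⟩ h1 (by linarith)).symm
  · have h1 : 2 * w ≤ u + s := by rw [hs]; linarith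
    rw [hcC _ (by linarith)]
    simp only [hC]
    rw [hZlin _ h1, add_sub_cancel_right, hfM u]
    have h2 : Z (T x₁) < Z (2 * w) := hZmono hu₁m.1.1 (by simp; linarith) (by linarith)
    have h3 : Z w ≤ Z (2 * w) := (hZmono (by simp; linarith) (by simp; linarith) (by linarith)).le
    rw [hZX w ⟨by linarith, le_rfl⟩] at h3
    linarith [hu]
  · set u' := u + s with hu'
    have h1 : T x₁ < u' := by linarith [hu.1]
    have h2 : u' ≤ 2 * w := by linarith [hu.2]
    have hur : -r < u' := hu₁m.1.1.trans h1
    have h3 : x₁ < Z u' := by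
      have := hZmono hu₁m.1.1 hur h1
      rwa [hZT _ mx1 hx12.le] at this
    have h4 : Z u' ≤ Z (2 * w) := hZmono.monotoneOn hur (by simp; linarith) h2
    show c u' ∈ _
    rw [hcC _ (by linarith)]
    by_cases h5 : Z u' ≤ x₂
    · have h6 : u' < w := by
        rw [← hZmono.lt_iff_lt hur (by simp; linarith), hZX w ⟨by linarith, le_rfl⟩]
        linarith
      have h7 : Z u' = X u' := hZX _ ⟨hur, h6.le⟩
      have hum : u' ∈ Ioo (-r) r := ⟨hur, by linarith⟩
      obtain ⟨e1, e2⟩ := hFf _ ⟨h3, h5⟩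
      -- The point is an arm point plus f - F times e, with 0 < f - F < ε, hence on the side σ and
      -- inside O.
      have := hεU (t - u') (f (Z u') - F (Z u')) (by
        rw [sub_sub_cancel_left, abs_neg, abs_lt]; constructor <;> linarith [hum.1, hum.2])
        (by linarith) (by linarith)
      rw [hco u'] at this
      rw [show C u' = A.g t + X u' * d + Y u' * e + ((f (Z u') - F (Z u') : ℝ) : ℂ) * e by
        rw [h7, hFX u' hum, ← h7]; simp only [hC]; rw [h7]; push_cast; ring]
      exact this
    · have := hM' (Z u') ⟨hx2.trans (not_le.1 h5), by linarith⟩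
      simp only [hC]
      rw [hfM _ (not_le.1 h5).le]
      exact this
  · have key : ∀ u, u ∈ Ici (T x₁ - s) →
        σ * cross e (c (u + s)) = σ * cross e (A.g t) + σ * cross e d * Z (u + s) := by
      intro u hu
      rw [hcC _ (by linarith [mem_Ici.1 hu])]
      simp only [hC, cross_add_right, cross_real_mul_right, cross_self_eq_zero]
      ring
    simp only [key u hu, key v hv]
    have := hZmono (a := u + s) (b := v + s) (by simp; linarith [mem_Ici.1 hu, hu₁m.1.1])
      (by simp; linarith [mem_Ici.1 hv, hu₁m.1.1]) (by linarith)
    nlinarith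
  · by_cases h : u + s < u₂
    · exact hdetA _ (by linarith) h
    · rw [Ne, hdet0 _ (not_lt.1 h)]
      refine (hin (fun x hx => ?_) _ (hZρ _ (not_lt.1 h))).ne'
      have := hsF x hx
      rwa [hA, hσσ, one_mul] at this
  · obtain ⟨x₀, h1, h2, h3, h4⟩ := hout (fun x hx => by
      have := hsF x hx
      rw [hA, neg_mul, hσσ] at this
      linarith)
    have mx0 : x₀ ∈ Ioo (-ρ) ρ := ⟨by linarith, by linarith⟩
    have h5 := hZT x₀ mx0 h2.le
    have h6 := hTlt _ mx1 _ mx0 h1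
    have h7 := hTw _ mx0 h2.le
    refine ⟨T x₀ - s, ⟨by linarith, by rw [hs]; linarith⟩, fun u hu => ?_⟩
    by_cases h : u + s < u₂
    · refine iff_of_false (hdetA _ (by linarith) h) fun h' => ?_
      rw [h'] at h
      linarith
    · show cross (c1 (u + s)) (c2 (u + s)) = 0 ↔ _
      rw [hdet0 _ (not_lt.1 h)]
      constructor
      · intro h0
        have h8 := h4 _ (hZρ _ (not_lt.1 h)) h0
        have : u + s = T x₀ := hZmono.injOn (hu₂r.trans_le (not_lt.1 h)) (hTm _ mx0).1.1
          (by rw [h8, h5])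
        linarith
      · rintro rfl
        rw [sub_add_cancel, h5, h3]

end Arm

/-! ### A curve without inflections along the chord. -/

/-- The fraction of the way from the first to the second acceleration. -/
noncomputable def blendWeight (ξ : ℝ) : ℝ := 3 * (max (ξ - 1 / 3) 0 - max (ξ - 2 / 3) 0)

lemma blendWeight_mem (ξ : ℝ) : 0 ≤ blendWeight ξ ∧ blendWeight ξ ≤ 1 := by
  unfold blendWeight
  rcases le_total ξ (1 / 3) with h | h
  · rw [max_eq_right (by linarith), max_eq_right (by linarith)]; norm_num
  rw [max_eq_left (by linarith)]
  rcases le_total ξ (2 / 3) with h' | h'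
  · rw [max_eq_right (by linarith)]; constructor <;> linarith
  · rw [max_eq_left (by linarith)]; constructor <;> linarith

/-- A curve from `p` to `p + D` with acceleration `2 κ e` near `p` and `2 κ e'` near `p + D`. -/
noncomputable def blendCurve (p D e e' : ℂ) (κ ξ : ℝ) : ℂ :=
  p + ξ * D + κ * ((ξ ^ 2 - ξ : ℝ) * e +
    -- The constant 7 / 27 = (2 / 3)³ - (1 / 3)³ makes the cubic term vanish at ξ = 1, so that the
    -- curve ends at p + D.
    (max (ξ - 1 / 3) 0 ^ 3 - max (ξ - 2 / 3) 0 ^ 3 - 7 / 27 * ξ : ℝ) * (e' - e))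

noncomputable def blendCurve' (D e e' : ℂ) (κ ξ : ℝ) : ℂ :=
  D + κ * ((2 * ξ - 1 : ℝ) * e +
    (3 * (max (ξ - 1 / 3) 0 ^ 2 - max (ξ - 2 / 3) 0 ^ 2) - 7 / 27 : ℝ) * (e' - e))

noncomputable def blendCurve'' (e e' : ℂ) (κ ξ : ℝ) : ℂ :=
  κ * (2 * e + ((2 * blendWeight ξ : ℝ) : ℂ) * (e' - e))

section blendCurve
variable (p D e e' : ℂ)

lemma continuous_blendCurve : Continuous fun q : ℝ × ℝ => blendCurve p D e e' q.1 q.2 := by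
  unfold blendCurve
  have h1 : Continuous fun q : ℝ × ℝ => ((q.1 : ℝ) : ℂ) := Complex.continuous_ofReal.comp continuous_fst
  have h2 : Continuous fun q : ℝ × ℝ => ((q.2 : ℝ) : ℂ) := Complex.continuous_ofReal.comp continuous_snd
  exact (continuous_const.add (h2.mul continuous_const)).add (h1.mul
    (((Complex.continuous_ofReal.comp (by fun_prop)).mul continuous_const).add
      ((Complex.continuous_ofReal.comp (by fun_prop)).mul continuous_const)))

lemma continuous_blendCurve' : Continuous fun q : ℝ × ℝ => blendCurve' D e e' q.1 q.2 := by
  unfold blendCurve'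
  have h1 : Continuous fun q : ℝ × ℝ => ((q.1 : ℝ) : ℂ) := Complex.continuous_ofReal.comp continuous_fst
  exact continuous_const.add (h1.mul
    (((Complex.continuous_ofReal.comp (by fun_prop)).mul continuous_const).add
      ((Complex.continuous_ofReal.comp (by fun_prop)).mul continuous_const)))

lemma c2At_blendCurve (κ ξ : ℝ) :
    C2At (blendCurve p D e e' κ) (blendCurve' D e e' κ) (blendCurve'' e e' κ) ξ := by
  have m3 : ∀ a : ℝ, HasDerivAt (fun x : ℝ => max (x - a) 0 ^ 3) (3 * max (ξ - a) 0 ^ 2) ξ := by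
    intro a
    exact ((hasDerivAt_max_pow 1 (ξ - a)).comp_sub_const ξ a).congr_deriv (by norm_num)
  have m2 : ∀ a : ℝ, HasDerivAt (fun x : ℝ => max (x - a) 0 ^ 2) (2 * max (ξ - a) 0) ξ := by
    intro a
    exact ((hasDerivAt_max_pow 0 (ξ - a)).comp_sub_const ξ a).congr_deriv (by norm_num)
  refine ⟨?_, ?_, ?_⟩
  · have h1 : HasDerivAt (fun x : ℝ => x ^ 2 - x) (2 * ξ - 1) ξ :=
      ((hasDerivAt_pow 2 ξ).sub (hasDerivAt_id ξ)).congr_deriv (by norm_num)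
    have h2 : HasDerivAt (fun x : ℝ => max (x - 1 / 3) 0 ^ 3 - max (x - 2 / 3) 0 ^ 3 - 7 / 27 * x)
        (3 * (max (ξ - 1 / 3) 0 ^ 2 - max (ξ - 2 / 3) 0 ^ 2) - 7 / 27) ξ :=
      (((m3 _).sub (m3 _)).sub ((hasDerivAt_id ξ).const_mul (7 / 27))).congr_deriv (by ring)
    have h3 : HasDerivAt (fun x : ℝ => p + x * D) D ξ := by
      simpa using (((hasDerivAt_id ξ).ofReal_comp.mul_const D).const_add p)
    exact h3.add (((h1.ofReal_comp.mul_const e).add (h2.ofReal_comp.mul_const (e' - e))).const_mul _)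
  · have h1 : HasDerivAt (fun x : ℝ => 2 * x - 1) 2 ξ := by
      simpa using ((hasDerivAt_id ξ).const_mul 2).sub_const 1
    have h2 : HasDerivAt
        (fun x : ℝ => 3 * (max (x - 1 / 3) 0 ^ 2 - max (x - 2 / 3) 0 ^ 2) - 7 / 27)
        (2 * blendWeight ξ) ξ :=
      ((((m2 _).sub (m2 _)).const_mul 3).sub_const _).congr_deriv (by unfold blendWeight; ring)
    exact ((((h1.ofReal_comp.mul_const e).add
      (h2.ofReal_comp.mul_const (e' - e))).const_mul (κ : ℂ)).const_add D).congr_deriv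
        (by unfold blendCurve''; push_cast; ring)
  · have : Continuous fun x : ℝ => ((2 * blendWeight x : ℝ) : ℂ) :=
      Complex.continuous_ofReal.comp (by unfold blendWeight; fun_prop)
    exact (continuous_const.mul (continuous_const.add (this.mul continuous_const))).continuousAt

lemma blendCurve_left {κ ξ : ℝ} (h : ξ ≤ 1 / 3) : blendCurve p D e e' κ ξ =
    p + ξ * blendCurve' D e e' κ 0 + ((κ * ξ ^ 2 : ℝ) : ℂ) * e := by
  unfold blendCurve blendCurve'
  rw [max_eq_right (by linarith : ξ - 1 / 3 ≤ 0), max_eq_right (by linarith : ξ - 2 / 3 ≤ 0)]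
  norm_num
  ring

lemma blendCurve_right {κ ξ : ℝ} (h : 2 / 3 ≤ ξ) : blendCurve p D e e' κ ξ =
    p + D + ((1 - ξ : ℝ) : ℂ) * -blendCurve' D e e' κ 1 + ((κ * (1 - ξ) ^ 2 : ℝ) : ℂ) * e' := by
  unfold blendCurve blendCurve'
  rw [max_eq_left (by linarith : 0 ≤ ξ - 1 / 3), max_eq_left (by linarith : 0 ≤ ξ - 2 / 3)]
  norm_num
  ring

end blendCurve

namespace Arm
variable {R : ℝ} {A B : Arm R}

lemma IsComp.mem_nhds {U : Set ℂ} (hU : IsComp (region A B) U) {z : ℂ} (hz : z ∈ U)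
    (hzR : ‖z‖ < R) : U ∈ 𝓝 z := by
  have ho : IsOpen (Metric.ball (0 : ℂ) R \ (A.g '' Icc 0 1 ∪ B.g '' Icc 0 1)) :=
    Metric.isOpen_ball.sdiff (A.isClosed_image.union B.isClosed_image)
  obtain ⟨ε, hε, hb⟩ := Metric.isOpen_iff.1 ho z ⟨by simpa using hzR, (hU.sub hz).2⟩
  refine mem_of_superset (Metric.ball_mem_nhds z hε) ?_
  exact hU.maximal _ (convex_ball z ε).isPreconnected
    (hb.trans fun w hw => ⟨Metric.ball_subset_closedBall hw.1, hw.2⟩)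
    ⟨z, Metric.mem_ball_self hε, hz⟩

/-- U is no neighbourhood of the arm point; what is stable is that all short vectors in directions
near D lead into U. This controls curves near the ends of the chord. -/
lemma SideIn.eventually_cone {t σ : ℝ} {U : Set ℂ} (h : A.SideIn σ t U) {D : ℂ}
    (hD : 0 < σ * cross (A.v t) D) :
    ∀ᶠ q : ℝ × ℂ in 𝓝 (0, D), 0 < q.1 → A.g t + q.1 * q.2 ∈ U := by
  have hD0 : 0 < ‖D‖ := by
    rw [norm_pos_iff]; rintro rfl; simp [cross_zero_right] at hD
  obtain ⟨c, hc0, hc⟩ : ∃ c > 0, c * ‖D‖ < σ * cross (A.v t) D := by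
    refine ⟨σ * cross (A.v t) D / (2 * ‖D‖), by positivity, ?_⟩
    have : σ * cross (A.v t) D / (2 * ‖D‖) * ‖D‖ = σ * cross (A.v t) D / 2 := by field_simp
    linarith
  obtain ⟨ε, hε, hsub⟩ := h c hc0
  have e1 : ∀ᶠ q : ℝ × ℂ in 𝓝 (0, D), c * ‖q.2‖ < σ * cross (A.v t) q.2 := by
    have h1 : ContinuousAt (fun q : ℝ × ℂ => c * ‖q.2‖) (0, D) := by fun_prop
    have h2 : ContinuousAt (fun q : ℝ × ℂ => σ * cross (A.v t) q.2) (0, D) :=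
      (continuousAt_const.cross continuousAt_snd).const_mul σ
    exact h1.eventually_lt h2 hc
  have e2 : ∀ᶠ q : ℝ × ℂ in 𝓝 (0, D), ‖(q.1 : ℂ) * q.2‖ < ε := by
    have h1 : ContinuousAt (fun q : ℝ × ℂ => ‖(q.1 : ℂ) * q.2‖) (0, D) :=
      (((Complex.continuous_ofReal.comp continuous_fst).mul continuous_snd).norm).continuousAt
    exact h1.eventually (gt_mem_nhds (by simpa using hε))
  filter_upwards [e1, e2] with q h1 h2 h3
  refine hsub ⟨t, q.1 * q.2, by simpa using hε, h2, ?_, rfl⟩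
  rw [norm_mul, Complex.norm_real, Real.norm_of_nonneg h3.le, cross_real_mul_right]
  nlinarith

/-- A convex curve close to a chord. -/
lemma exists_middle {U : Set ℂ} (hU : IsComp (region A B) U) {σ tp tq : ℝ}
    (hp : tp ∈ Ioo (0 : ℝ) 1) (hq : tq ∈ Ioo (0 : ℝ) 1) (hA : A.SideIn σ tp U)
    (hB : B.SideIn (-σ) tq U) (hseg : openSegment ℝ (A.g tp) (B.g tq) ⊆ U)
    (h1 : 0 < σ * cross (A.v tp) (B.g tq - A.g tp)) (h2 : 0 < σ * cross (B.v tq) (B.g tq - A.g tp)) :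
    ∃ (κ : ℝ) (M M1 M2 : ℝ → ℂ) (d e d' e' : ℂ), 0 < κ ∧ (∀ ξ, C2At M M1 M2 ξ) ∧
      (∀ ξ ≤ 1 / 3, M ξ = A.g tp + ξ * d + ((κ * ξ ^ 2 : ℝ) : ℂ) * e) ∧
      (∀ ξ ≥ 2 / 3, M ξ = B.g tq + ((1 - ξ : ℝ) : ℂ) * d' + ((κ * (1 - ξ) ^ 2 : ℝ) : ℂ) * e') ∧
      0 < σ * cross (A.v tp) d ∧ 0 < σ * cross (A.v tp) e ∧ 0 < σ * cross e d ∧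
      0 < -σ * cross (B.v tq) d' ∧ 0 < -σ * cross (B.v tq) e' ∧ 0 < -σ * cross e' d' ∧
      (∀ ξ ∈ Ioo (0 : ℝ) 1, M ξ ∈ U) ∧ ∀ ξ ∈ Icc (0 : ℝ) 1,
        0 < σ * cross e (M1 ξ) ∧ 0 < σ * cross e' (M1 ξ) ∧ cross (M1 ξ) (M2 ξ) ≠ 0 := by
  set p := A.g tp with hpd
  set D := B.g tq - p with hD
  -- Adding the velocity makes cross e D and cross e' D both equal to a cross product of a velocity
  -- with D, so that they have the sign σ. The multiple ± D makes e and e' point from the arms into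
  -- U.
  set e := D + A.v tp with he
  set e' := -D + B.v tq with he'
  have hDe : 0 < σ * cross e D := by
    rw [he, cross_add_left, cross_self_eq_zero, zero_add]; exact h1
  have hDe' : 0 < σ * cross e' D := by
    rw [he', cross_add_left, cross_neg_left, cross_self_eq_zero, neg_zero, zero_add]; exact h2
  have hdir : ∀ w : ℂ, 0 < σ * cross w D → ∀ᶠ κ in 𝓝 (0 : ℝ), ∀ ξ ∈ Icc (0 : ℝ) 1,
      0 < σ * cross w (blendCurve' D e e' κ ξ) := by
    intro w hw
    refine isCompact_Icc.eventually_forall_of_forall_eventually fun ξ _ => ?_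
    have hc : ContinuousAt (fun q : ℝ × ℝ => σ * cross w (blendCurve' D e e' q.1 q.2)) (0, ξ) :=
      ((continuous_const.cross (continuous_blendCurve' D e e')).const_mul σ).continuousAt
    refine hc.eventually (lt_mem_nhds ?_)
    simpa [blendCurve'] using hw
  -- For κ = 0 the curve is the chord. By compactness in ξ a small κ keeps it in U; interior points
  -- use that U is a neighbourhood, the two ends use the cones.
  have hmem : ∀ᶠ κ in 𝓝 (0 : ℝ), ∀ ξ ∈ Icc (0 : ℝ) 1, ξ ∈ Ioo (0 : ℝ) 1 →
      blendCurve p D e e' κ ξ ∈ U := by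
    refine isCompact_Icc.eventually_forall_of_forall_eventually fun ξ hξ => ?_
    have hc2 : Tendsto (fun q : ℝ × ℝ => q.2) (𝓝 (0, ξ)) (𝓝 ξ) := continuous_snd.continuousAt
    rcases hξ.1.eq_or_lt with rfl | h0
    · have hc : ContinuousAt (fun q : ℝ × ℝ => (q.2, blendCurve' D e e' q.1 0 + ((q.1 * q.2 : ℝ) : ℂ) * e))
          (0, 0) := by
        refine continuousAt_snd.prodMk ?_
        refine ContinuousAt.add ?_ ?_
        · exact ((continuous_blendCurve' D e e').comp
            (continuous_fst.prodMk continuous_const)).continuousAt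
        · exact ((Complex.continuous_ofReal.comp (by fun_prop)).mul continuous_const).continuousAt
      have hev := hc.eventually (p := fun q : ℝ × ℂ => 0 < q.1 → A.g tp + q.1 * q.2 ∈ U) (by
        have := hA.eventually_cone h1
        simpa [blendCurve'] using this)
      filter_upwards [hev, hc2 (gt_mem_nhds (by norm_num : (0 : ℝ) < 1 / 3))] with q h3 h4 h5
      rw [blendCurve_left p D e e' (le_of_lt h4)]
      have := h3 h5.1
      convert this using 1
      push_cast; ring
    rcases hξ.2.eq_or_lt with rfl | h1'
    · have hc : ContinuousAt (fun q : ℝ × ℝ => (1 - q.2, -blendCurve' D e e' q.1 1 +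
          ((q.1 * (1 - q.2) : ℝ) : ℂ) * e')) (0, 1) := by
        refine ContinuousAt.prodMk (by fun_prop) ?_
        refine ContinuousAt.add ?_ ?_
        · exact ((continuous_blendCurve' D e e').comp
            (continuous_fst.prodMk continuous_const)).continuousAt.neg
        · exact ((Complex.continuous_ofReal.comp (by fun_prop)).mul continuous_const).continuousAt
      have hev := hc.eventually (p := fun q : ℝ × ℂ => 0 < q.1 → B.g tq + q.1 * q.2 ∈ U) (by
        have := hB.eventually_cone (D := -D) (by rw [cross_neg_right]; linarith)
        simpa [blendCurve'] using this)
      filter_upwards [hev, hc2 (lt_mem_nhds (by norm_num : (2 / 3 : ℝ) < 1))] with q h3 h4 h5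
      rw [blendCurve_right p D e e' (le_of_lt h4), hD]
      have := h3 (by linarith [h5.2])
      convert this using 1
      push_cast; ring
    · have hz : blendCurve p D e e' 0 ξ ∈ openSegment ℝ (A.g tp) (B.g tq) := by
        refine ⟨1 - ξ, ξ, by linarith, h0, by ring, ?_⟩
        simp only [blendCurve, hD, hpd, Complex.real_smul]
        push_cast; ring
      have hn : ‖blendCurve p D e e' 0 ξ‖ < R := by
        have := (convex_ball (0 : ℂ) R).openSegment_subset
          (x := A.g tp) (y := B.g tq) (by simpa using A.norm_lt tp ⟨hp.1.le, hp.2⟩)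
          (by simpa using B.norm_lt tq ⟨hq.1.le, hq.2⟩) hz
        simpa using this
      have := (continuous_blendCurve p D e e').continuousAt.preimage_mem_nhds (x := (0, ξ))
        (IsComp.mem_nhds hU (hseg hz) hn)
      filter_upwards [this] with q h3 _ using h3
  obtain ⟨κ, hκ, a1, a2, a3, a4, a5⟩ := (Filter.Eventually.and (self_mem_nhdsWithin : Ioi (0 : ℝ) ∈ 𝓝[>] 0)
    (((hdir _ hDe).and ((hdir _ hDe').and ((hdir _ h1).and ((hdir _ h2).and hmem)))).filter_mono
      nhdsWithin_le_nhds)).exists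
  have m0 : (0 : ℝ) ∈ Icc (0 : ℝ) 1 := ⟨le_rfl, zero_le_one⟩
  have m1 : (1 : ℝ) ∈ Icc (0 : ℝ) 1 := ⟨zero_le_one, le_rfl⟩
  refine ⟨κ, blendCurve p D e e' κ, blendCurve' D e e' κ, blendCurve'' e e' κ, _, e, _, e', hκ,
    c2At_blendCurve p D e e' κ, fun ξ hξ => blendCurve_left p D e e' hξ,
    fun ξ hξ => by rw [blendCurve_right p D e e' hξ, hD, add_sub_cancel], a3 0 m0, ?_, a1 0 m0, ?_,
    ?_, ?_, fun ξ hξ => a5 ξ (Ioo_subset_Icc_self hξ) hξ, fun ξ hξ => ⟨a1 ξ hξ, a2 ξ hξ, ?_⟩⟩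
  · rw [he, cross_add_right, cross_self_eq_zero, add_zero]; exact h1
  · have := a4 1 m1
    rw [cross_neg_right]; linarith
  · rw [he', cross_add_right, cross_self_eq_zero, cross_neg_right]; linarith
  · have := a2 1 m1
    rw [cross_neg_right]; linarith
  · have b1 := a1 ξ hξ
    have b2 := a2 ξ hξ
    obtain ⟨w0, w1⟩ := blendWeight_mem ξ
    -- The acceleration is a nonnegative combination of e and e', not both with weight zero, and
    -- both lie strictly on the same side of the velocity.
    have hcr : cross (blendCurve' D e e' κ ξ) (blendCurve'' e e' κ ξ) =
        -(2 * κ * ((1 - blendWeight ξ) * cross e (blendCurve' D e e' κ ξ) +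
          blendWeight ξ * cross e' (blendCurve' D e e' κ ξ))) := by
      rw [cross_swap]
      have : blendCurve'' e e' κ ξ = ((2 * κ * (1 - blendWeight ξ) : ℝ) : ℂ) * e +
          ((2 * κ * blendWeight ξ : ℝ) : ℂ) * e' := by
        unfold blendCurve''; push_cast; ring
      rw [this]
      simp only [cross_add_left, cross_real_mul_left]
      ring
    intro h0
    rw [hcr] at h0
    have hκ' : (0 : ℝ) < κ := hκ
    have h3 : (1 - blendWeight ξ) * cross e (blendCurve' D e e' κ ξ) +
          blendWeight ξ * cross e' (blendCurve' D e e' κ ξ) = 0 := by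
      have := neg_eq_zero.1 h0
      exact (mul_eq_zero.1 this).resolve_left (by positivity)
    have h4 : (1 - blendWeight ξ) * (σ * cross e (blendCurve' D e e' κ ξ)) +
          blendWeight ξ * (σ * cross e' (blendCurve' D e e' κ ξ)) = 0 := by
      linear_combination σ * h3
    rcases w0.eq_or_lt with h5 | h5
    · rw [← h5] at h4; linarith
    · nlinarith [mul_pos h5 b2, mul_nonneg (sub_nonneg.2 w1) b1.le]

end Arm

/-! ### Assembling the arc. -/

namespace Arm
variable {R : ℝ} {A B : Arm R}

/-- A regular arc in the closure of a component that agrees with two arms near its ends. -/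
structure Arc (A B : Arm R) (U : Set ℂ) where
  c : ℝ → ℂ
  c1 : ℝ → ℂ
  c2 : ℝ → ℂ
  α : ℝ
  u : ℝ
  v : ℝ
  β : ℝ
  αu : α < u
  uv : u < v
  vβ : v < β
  lt₁ : u - α < 1
  lt₂ : β - v < 1
  c2At : ∀ x ∈ Icc α β, C2At c c1 c2 x
  regular : ∀ x ∈ Icc α β, c1 x ≠ 0
  arm₁ : ∀ x ∈ Icc α u, c x = A.g (1 - (x - α))
  arm₂ : ∀ x ∈ Icc v β, c x = B.g (1 - (β - x))
  mem : ∀ x ∈ Ioo u v, c x ∈ U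
  inj : InjOn c (Icc α β)

/-- The parameters of inflections. -/
def Arc.infl {U : Set ℂ} (C : Arc A B U) : Set ℝ :=
  {x ∈ Icc C.α C.β | cross (C.c1 x) (C.c2 x) = 0}

/-- The inflection, if any, occurs before L, so any further restriction P that holds below L leaves
the count unchanged. This allows counting on ranges cut at the gluing points. -/
lemma Half.encard {σ κ N : ℝ} {O : Set ℂ} {p d e : ℂ} (H : Half A σ κ N O p d e)
    (hσ : σ = 1 ∨ σ = -1) {P : ℝ → Prop} (hP : ∀ x < H.L, P x) :
    {x | H.τ - 1 ≤ x ∧ P x ∧ cross (H.c1 x) (H.c2 x) = 0}.encard = if A.s = σ then 0 else 1 := by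
  have h1 := A.one_lt
  split_ifs with h
  · rw [encard_eq_zero, eq_empty_iff_forall_notMem]
    rintro x ⟨h2, -, h3⟩
    exact H.ne h x (by linarith) h3
  · have h' : A.s = -σ := by
      rcases A.sign with h2 | h2 <;> rcases hσ with h3 | h3 <;> simp_all
    obtain ⟨u₀, hu₀, h2⟩ := H.eq h'
    rw [encard_eq_one]
    refine ⟨u₀, ?_⟩
    ext x
    constructor
    · rintro ⟨h3, -, h4⟩
      exact (h2 x (by linarith)).1 h4
    · rintro rfl
      have h3 := H.mem₁.2
      exact ⟨by linarith [hu₀.1], hP _ hu₀.2, (h2 x (by linarith [hu₀.1])).2 rfl⟩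

/-- The two modified arms and the curve along the chord agree on overlapping intervals where all are
parabolas. The middle contributes no inflection, so only the two halves count. -/
theorem exists_arc (hAB : Apart A B) {U : Set ℂ} {σ : ℝ} (hU : IsComp (region A B) U)
    (hch : HasChord A B U σ) :
    ∃ C : Arc A B U, C.infl.encard = (if A.s = σ then 0 else 1) + if B.s = -σ then 0 else 1 := by
  have hσ := hch.sign
  have hσ' : -σ = 1 ∨ -σ = -1 := by
    rcases hσ with rfl | rfl
    exacts [Or.inr rfl, Or.inl (by norm_num)]
  obtain ⟨tp, htp, tq, htq, hseg, h1, h2⟩ := hch.chord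
  obtain ⟨κ, M, M1, M2, d, e, d', e', hκ, hM, hMl, hMr, c1, c2, c3, c4, c5, c6, hMU, hMd⟩ :=
    exists_middle hU htp htq (hch.side₁ tp htp) (hch.side₂ tq htq) hseg h1 h2
  have hpq : A.g tp ≠ B.g tq := hAB.ne (Ioo_subset_Ioc_self htp) (Ioo_subset_Icc_self htq)
  -- The halves are confined to disjoint balls about the ends of the chord, so they cannot meet each
  -- other.
  set r := dist (A.g tp) (B.g tq) / 2 with hr
  have hr0 : 0 < r := half_pos (dist_pos.2 hpq)
  obtain ⟨H⟩ := exists_half (N := 1 / 3) hσ htp (hch.side₁ tp htp) (Metric.ball_mem_nhds (A.g tp) hr0)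
    c1 c2 c3 hκ (by norm_num) (fun ξ hξ => by
      rw [← hMl ξ hξ.2.le]; exact hMU ξ ⟨hξ.1, by linarith [hξ.2]⟩)
  obtain ⟨H'⟩ := exists_half (N := 1 / 3) hσ' htq (hch.side₂ tq htq)
    (Metric.ball_mem_nhds (B.g tq) hr0) c4 c5 c6 hκ (by norm_num) (fun ξ hξ => by
      have := hMr (1 - ξ) (by linarith [hξ.2])
      rw [sub_sub_cancel] at this
      rw [← this]; exact hMU (1 - ξ) ⟨by linarith [hξ.2], by linarith [hξ.1]⟩)
  have hdisj : ∀ z, z ∈ Metric.ball (A.g tp) r → z ∉ Metric.ball (B.g tq) r := fun z hz hz' => by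
    have := dist_triangle_left (A.g tp) (B.g tq) z
    rw [Metric.mem_ball] at hz hz'
    linarith
  have a0 := H.pos
  have a1 := H.lt'
  have a2 := H.lt
  have b0 := H'.pos
  have b1 := H'.lt'
  have b2 := H'.lt
  have hm := H.mem₁
  have hm' := H'.mem₁
  have hm1 := hm.2
  have hm1' := hm'.2
  have hA1 := A.one_lt
  have hB1 := B.one_lt
  set b := 1 - H'.L with hb
  set C : ℝ → ℂ := fun x => if x < 1 / 3 then H.c x else if x < b then M x else H'.c (1 - x)
  set C1 : ℝ → ℂ := fun x => if x < 1 / 3 then H.c1 x else if x < b then M1 x else -H'.c1 (1 - x)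
  set C2 : ℝ → ℂ := fun x => if x < 1 / 3 then H.c2 x else if x < b then M2 x else H'.c2 (1 - x)
  have hR : ∀ x < 1 - (H'.τ - B.b),
      C2At (fun x => H'.c (1 - x)) (fun x => -H'.c1 (1 - x)) (fun x => H'.c2 (1 - x)) x :=
    fun x hx => C2At.comp_sub (H'.c2At (1 - x) (by linarith))
  have hMR : ∀ x ∈ Icc (2 / 3) b, M x = H'.c (1 - x) := fun x hx => by
    rw [hMr x hx.1, H'.mid (1 - x) (by linarith [hx.2])]
  have hML : ∀ x ∈ Icc H.L (1 / 3), H.c x = M x := fun x hx => by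
    rw [hMl x hx.2, H.mid x hx.1]
  have hin : ∀ x < 1 - (H'.τ - B.b), C2At (fun x => if x < b then M x else H'.c (1 - x))
      (fun x => if x < b then M1 x else -H'.c1 (1 - x))
      (fun x => if x < b then M2 x else H'.c2 (1 - x)) x := fun x hx =>
    C2At.ite (a := 2 / 3) (by linarith) (fun _ => hM x) (fun _ => hR x hx) fun y hy =>
      ⟨hM y, hR y (by linarith [hy.2]), hMR y ⟨hy.1.le, hy.2.le⟩⟩
  have hC : ∀ x ∈ Icc (H.τ - 1) (2 - H'.τ), C2At C C1 C2 x := fun x hx =>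
    C2At.ite a1 (fun h => H.c2At x (by linarith [hx.1])) (fun h => hin x (by linarith [hx.2]))
      fun y hy => ⟨H.c2At y (by linarith [hy.1]), hin y (by linarith [hy.2]), by
        rw [if_pos (by linarith [hy.2])]; exact hML y ⟨hy.1.le, hy.2.le⟩⟩
  have eL : ∀ x < 1 / 3, C x = H.c x := fun x hx => if_pos hx
  have eM : ∀ x ∈ Icc H.L b, C x = M x := fun x hx => by
    simp only [C]
    split_ifs with h h'
    · exact hML x ⟨hx.1, h.le⟩
    · rfl
    · exact (hMR x ⟨by linarith, hx.2⟩).symm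
  have eR : ∀ x ≥ b, C x = H'.c (1 - x) := fun x hx => by
    simp only [C]
    rw [if_neg (by linarith), if_neg (not_lt.2 hx)]
  have hMmono : ∀ w, (∀ ξ ∈ Icc (0 : ℝ) 1, 0 < σ * cross w (M1 ξ)) →
      StrictMonoOn (fun x => σ * cross w (C x)) (Icc H.L b) := fun w hw => by
    have h3 : StrictMonoOn (fun x => σ * cross w (M x)) (Icc H.L b) :=
      strictMonoOn_of_hasDerivAt_pos ordConnected_Icc
        (fun x _ => ((hM x).hasDerivAt.const_cross w).const_mul σ)
        fun x hx => hw x ⟨by linarith [hx.1], by linarith [hx.2]⟩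
    exact h3.congr fun x hx => by simp only [eM x hx]
  have hLb : H.L ≤ b := by linarith
  -- The coordinate transverse to e increases along the left half and the whole middle; likewise the
  -- one transverse to e' along the middle and the right half.
  have hmonoL : StrictMonoOn (fun x => σ * cross e (C x)) (Icc H.u₁ b) := by
    rw [← Icc_union_Icc_eq_Icc a2.le hLb]
    refine StrictMonoOn.union ?_ (hMmono e fun ξ hξ => (hMd ξ hξ).1) (isGreatest_Icc a2.le)
      (isLeast_Icc hLb)
    exact (H.mono.mono Icc_subset_Ici_self).congr fun x hx => by
      simp only [eL x (by linarith [hx.2])]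
  have hmonoR : StrictMonoOn (fun x => σ * cross e' (C x)) (Icc H.L (1 - H'.u₁)) := by
    have hbv : b ≤ 1 - H'.u₁ := by linarith
    rw [← Icc_union_Icc_eq_Icc hLb hbv]
    refine StrictMonoOn.union (hMmono e' fun ξ hξ => (hMd ξ hξ).2.1) ?_ (isGreatest_Icc hLb)
      (isLeast_Icc hbv)
    intro x hx y hy hxy
    have : -σ * cross e' (H'.c (1 - y)) < -σ * cross e' (H'.c (1 - x)) :=
      H'.mono (by simp; linarith [hy.2]) (by simp; linarith [hx.2]) (by linarith)
    simp only [eR x hx.1, eR y hy.1]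
    linarith
  have harm₁ : ∀ x ∈ Icc (H.τ - 1) H.u₁, C x = A.g (1 - (x - (H.τ - 1))) := fun x hx => by
    rw [eL x (by linarith [hx.2]), H.arm x ⟨by linarith [hx.1], hx.2⟩]
    congr 1; ring
  have harm₂ : ∀ x ∈ Icc (1 - H'.u₁) (2 - H'.τ), C x = B.g (1 - (2 - H'.τ - x)) := fun x hx => by
    rw [eR x (by linarith [hx.1]), H'.arm (1 - x) ⟨by linarith [hx.2], by linarith [hx.1]⟩]
    congr 1; ring
  have hmem : ∀ x ∈ Ioo H.u₁ (1 - H'.u₁), C x ∈ U := fun x hx => by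
    rcases le_total x H.L with h | h
    · rw [eL x (by linarith)]; exact (H.mem x ⟨hx.1, h⟩).1
    rcases le_total x b with h' | h'
    · rw [eM x ⟨h, h'⟩]; exact hMU x ⟨by linarith, by linarith⟩
    · rw [eR x h']; exact (H'.mem (1 - x) ⟨by linarith [hx.2], by linarith⟩).1
  have hUA : ∀ z ∈ U, z ∉ A.g '' Icc 0 1 := fun z hz h => (hU.sub hz).2 (Or.inl h)
  have hUB : ∀ z ∈ U, z ∉ B.g '' Icc 0 1 := fun z hz h => (hU.sub hz).2 (Or.inr h)
  -- Double points are excluded on the arms by their injectivity and disjointness, and between an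
  -- arm and the new part because the latter lies in U. Within the new part a monotone coordinate
  -- works, unless the parameters are in different halves, which lie in disjoint balls.
  have hinj : ∀ x ∈ Icc (H.τ - 1) (2 - H'.τ), ∀ y ∈ Icc (H.τ - 1) (2 - H'.τ), x < y → C x ≠ C y := by
    intro x hx y hy hxy heq
    have tA : ∀ z ∈ Icc (H.τ - 1) H.u₁, 1 - (z - (H.τ - 1)) ∈ Ioc (0 : ℝ) 1 := fun z hz =>
      ⟨by linarith [hz.2, hm.1], by linarith [hz.1]⟩
    have tB : ∀ z ∈ Icc (1 - H'.u₁) (2 - H'.τ), 1 - (2 - H'.τ - z) ∈ Ioc (0 : ℝ) 1 := fun z hz =>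
      ⟨by linarith [hz.1, hm'.1], by linarith [hz.2]⟩
    rcases le_or_gt x H.u₁ with h | h
    · rw [harm₁ x ⟨hx.1, h⟩] at heq
      have t1 := tA x ⟨hx.1, h⟩
      rcases le_or_gt y H.u₁ with h' | h'
      · rw [harm₁ y ⟨hy.1, h'⟩] at heq
        have := A.inj (Ioc_subset_Icc_self t1) (Ioc_subset_Icc_self (tA y ⟨hy.1, h'⟩)) heq
        linarith
      rcases lt_or_ge y (1 - H'.u₁) with h'' | h''
      · exact hUA _ (hmem y ⟨h', h''⟩) ⟨_, Ioc_subset_Icc_self t1, heq⟩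
      · rw [harm₂ y ⟨h'', hy.2⟩] at heq
        exact hAB.ne t1 (Ioc_subset_Icc_self (tB y ⟨h'', hy.2⟩)) heq
    rcases lt_or_ge x (1 - H'.u₁) with h' | h'
    · rcases lt_or_ge y (1 - H'.u₁) with h'' | h''
      · rcases le_or_gt y b with h3 | h3
        · have := hmonoL ⟨h.le, hxy.le.trans h3⟩ ⟨(h.trans hxy).le, h3⟩ hxy
          simp only [heq] at this
          exact this.false
        rcases le_or_gt H.L x with h4 | h4
        · have := hmonoR ⟨h4, h'.le⟩ ⟨h4.trans hxy.le, h''.le⟩ hxy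
          simp only [heq] at this
          exact this.false
        · have e1 := (H.mem x ⟨h, h4.le⟩).2
          have e2 := (H'.mem (1 - y) ⟨by linarith, by linarith⟩).2
          rw [← eL x (by linarith), heq] at e1
          rw [← eR y h3.le] at e2
          exact hdisj _ e1 e2
      · rw [harm₂ y ⟨h'', hy.2⟩] at heq
        exact hUB _ (hmem x ⟨h, h'⟩) ⟨_, Ioc_subset_Icc_self (tB y ⟨h'', hy.2⟩), heq.symm⟩
    · rw [harm₂ x ⟨h', hx.2⟩, harm₂ y ⟨h'.trans hxy.le, hy.2⟩] at heq
      have := B.inj (Ioc_subset_Icc_self (tB x ⟨h', hx.2⟩))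
        (Ioc_subset_Icc_self (tB y ⟨h'.trans hxy.le, hy.2⟩)) heq
      linarith
  have hMne : ∀ ξ ∈ Icc (0 : ℝ) 1, M1 ξ ≠ 0 := fun ξ hξ h0 => by
    have := (hMd ξ hξ).1
    rw [h0, cross_zero_right, mul_zero] at this
    exact this.false
  refine ⟨⟨C, C1, C2, H.τ - 1, H.u₁, 1 - H'.u₁, 2 - H'.τ, by linarith [hm.2], by linarith,
    by linarith [hm'.2], by linarith [hm.1], by linarith [hm'.1], hC, fun x hx => ?_, harm₁, harm₂,
    hmem, fun x hx y hy heq => ?_⟩, ?_⟩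
  · simp only [C1]
    split_ifs with h h'
    · exact H.regular x (by linarith [hx.1])
    · exact hMne x ⟨by linarith, by linarith⟩
    · exact neg_ne_zero.2 (H'.regular (1 - x) (by linarith [hx.2]))
  · rcases lt_trichotomy x y with h | h | h
    · exact absurd heq (hinj x hx y hy h)
    · exact h
    · exact absurd heq.symm (hinj y hy x hx h)
  · rw [← H.encard hσ (P := fun x => x < 1 / 3) fun x hx => hx.trans a1,
      ← H'.encard hσ' (P := fun x => x ≤ H'.L) fun x hx => hx.le]
    -- The cut at 1 / 3 is strict and the one at b is not, matching the order of the conditionals.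
    set S := {x | H.τ - 1 ≤ x ∧ x < 1 / 3 ∧ cross (H.c1 x) (H.c2 x) = 0}
    set S' := {x | H'.τ - 1 ≤ x ∧ x ≤ H'.L ∧ cross (H'.c1 x) (H'.c2 x) = 0}
    have himg : ((fun x => 1 - x) '' S').encard = S'.encard :=
      (sub_right_injective (b := (1 : ℝ))).encard_image S'
    rw [← himg, ← encard_union_eq]
    · congr 1
      ext x
      simp only [Arc.infl, C1, C2, mem_union, mem_image]
      constructor
      · rintro ⟨hx, h0⟩
        split_ifs at h0 with h h'
        · exact Or.inl ⟨hx.1, h, h0⟩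
        · exact absurd h0 (hMd x ⟨by linarith, by linarith⟩).2.2
        · right
          refine ⟨1 - x, ⟨by linarith [hx.2], by linarith, ?_⟩, by ring⟩
          rw [cross_neg_left] at h0; linarith
      · rintro (⟨h, h', h0⟩ | ⟨y, ⟨h, h', h0⟩, rfl⟩)
        · refine ⟨⟨h, by linarith⟩, ?_⟩
          rw [if_pos h', if_pos h']; exact h0
        · refine ⟨⟨by linarith, by linarith⟩, ?_⟩
          rw [if_neg (by linarith), if_neg (by linarith), if_neg (by linarith),
            if_neg (by linarith), sub_sub_cancel, cross_neg_left, h0, neg_zero]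
    · rw [disjoint_left]
      rintro x ⟨-, h, -⟩ ⟨y, ⟨-, h', -⟩, rfl⟩
      linarith

end Arm

/-! ### Counting inflections, and the arc near its ends. -/

/-- Adding a limit point to a connected set keeps it connected, and a component is maximal. -/
lemma IsComp.mem_of_mem_closure {Ω U : Set ℂ} (hU : IsComp Ω U) {z : ℂ} (hz : z ∈ closure U)
    (hzΩ : z ∈ Ω) : z ∈ U := by
  have h1 : IsPreconnected (insert z U) :=
    hU.preconn.subset_closure (subset_insert _ _) (insert_subset hz subset_closure)
  obtain ⟨w, hw⟩ := hU.nonempty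
  exact hU.maximal _ h1 (insert_subset hzΩ hU.sub) ⟨w, mem_insert_of_mem _ hw, hw⟩ (mem_insert _ _)

namespace Arm
variable {R : ℝ} {A B : Arm R}

/-- The vector that points to the side to which the arm curves. -/
lemma normal_pos (A : Arm R) {t : ℝ} (ht : t ∈ Ioo (0 : ℝ) 1) :
    0 < A.s * cross (A.v t) ((A.s * ‖A.v t‖⁻¹ : ℝ) * (Complex.I * A.v t)) := by
  have := norm_pos_iff.2 (A.v_ne_zero (A.mem_of_Ioo ht))
  rw [cross_real_mul_right, cross_I_mul_self, ← mul_assoc, ← mul_assoc, A.s_mul_s, one_mul]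
  positivity

/-- The normals are only known to lead into the closure of W, but a short way along them is in the
region, and there the closure of W is W. -/
lemma hasSide_of_normal (hAB : Apart A B) {W : Set ℂ} (hW : IsComp (region A B) W)
    (h : ∀ t ∈ Ioo (0 : ℝ) 1, ∀ᶠ r : ℝ in 𝓝[>] 0,
      A.g t + r * ((A.s * ‖A.v t‖⁻¹ : ℝ) * (Complex.I * A.v t)) ∈ closure W) :
    A.HasSide A.s W := by
  intro t ht
  have hn := A.normal_pos ht
  set n := (A.s * ‖A.v t‖⁻¹ : ℝ) * (Complex.I * A.v t)
  have hn0 : 0 < ‖n‖ := by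
    rw [norm_pos_iff]; intro h0; simp [h0, cross_zero_right] at hn
  obtain ⟨c, hc0, hc⟩ : ∃ c > 0, c * ‖n‖ < A.s * cross (A.v t) n := by
    refine ⟨A.s * cross (A.v t) n / (2 * ‖n‖), by positivity, ?_⟩
    have : A.s * cross (A.v t) n / (2 * ‖n‖) * ‖n‖ = A.s * cross (A.v t) n / 2 := by field_simp
    linarith
  obtain ⟨ε, hε, hsub⟩ := exists_sideSet_subset_region hAB ht hc0
  have hreg := A.sideSet_mem_eventually (t' := t) (ε := ε) (by simpa using hε) hc
  refine sideIn_of_frequently hAB hW A.sign ht hn (Eventually.frequently ?_)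
  filter_upwards [hreg, h t ht] with r h1 h2
  exact IsComp.mem_of_mem_closure hW h2 ((hsub _ A.sign).1 h1)

/-- How the number of inflections depends on the position of the principal normals. -/
lemma HasChord.count (hAB : Apart A B) {U : Set ℂ} {σ : ℝ} (hU : IsComp (region A B) U)
    (hP : Proper U) (h : HasChord A B U σ) :
    ((¬ ∃ W, IsComp (region A B) W ∧ A.HasSide A.s W ∧ B.HasSide B.s W) →
      (A.s = σ ↔ ¬ B.s = -σ)) ∧
    ((∃ W, IsComp (region A B) W ∧ Proper W ∧ A.HasSide A.s W ∧ B.HasSide B.s W) →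
      A.s = σ ∧ B.s = -σ) := by
  have hU' : IsComp (region B A) U := region_comm A B ▸ hU
  obtain ⟨V, hV, hVA, hVB, hVP⟩ := h.other
  have hV' : IsComp (region B A) V := region_comm A B ▸ hV
  have hσ := h.sign
  have hσ' : -σ = 1 ∨ -σ = -1 := by
    rcases hσ with rfl | rfl
    exacts [Or.inr rfl, Or.inl (by norm_num)]
  have hA : A.s = σ ∨ A.s = -σ := by
    rcases hσ with rfl | rfl
    · exact A.sign
    · simpa using A.sign.symm
  have hB : B.s = σ ∨ B.s = -σ := by
    rcases hσ with rfl | rfl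
    · exact B.sign
    · simpa using B.sign.symm
  have hne : σ ≠ -σ := by rcases hσ with rfl | rfl <;> norm_num
  -- The sides of U and of V in the chord data are all four; a single component with all of them
  -- would not be proper.
  have hUV : U ≠ V := by
    rintro rfl
    have key : ∀ s : ℝ, (s = 1 ∨ s = -1) → s = σ ∨ s = -σ := by
      intro s hs
      rcases hσ with rfl | rfl
      · exact hs
      · simpa using hs.symm
    refine not_proper_of_all_sides hAB hU (fun s hs => ?_) (fun s hs => ?_) hP
    · rcases key s hs with rfl | rfl
      exacts [h.side₁, hVA]
    · rcases key s hs with rfl | rfl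
      exacts [hVB, h.side₂]
  constructor
  · intro hno
    rcases hA with hA | hA <;> rcases hB with hB | hB
    · rw [hA, hB]; exact iff_of_true rfl hne
    · exact absurd ⟨U, hU, hA ▸ h.side₁, hB ▸ h.side₂⟩ hno
    · exact absurd ⟨V, hV, hA ▸ hVA, hB ▸ hVB⟩ hno
    · rw [hA, hB]; exact iff_of_false hne.symm (not_not.2 rfl)
  · rintro ⟨W, hW, hWP, hWA, hWB⟩
    have hW' : IsComp (region B A) W := region_comm A B ▸ hW
    rcases hA with hA | hA <;> rcases hB with hB | hB
    · rw [hA] at hWA; rw [hB] at hWB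
      exact absurd ((HasSide.eq hU hW hσ h.side₁ hWA).trans (HasSide.eq hW' hV' hσ hWB hVB)) hUV
    · exact ⟨hA, hB⟩
    -- Both arms curve towards V, so W = V; this is the case in which V is not proper, against the
    -- properness of W.
    · rw [hA] at hWA
      have := HasSide.eq hW hV hσ' hWA hVA
      exact absurd (this ▸ hWP) (hVP hA hB)
    · rw [hA] at hWA; rw [hB] at hWB
      exact absurd ((HasSide.eq hU' hW' hσ' h.side₂ hWB).trans (HasSide.eq hW hV hσ' hWA hVA)) hUV

/-- Three compact sets miss the end point: the inner part of the arm, the other arm and the part of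
the arc after u. Off these sets the arc and the double spiral are both the outer part of the arm. -/
lemma eventually_near_end (hAB : Apart A B) {c : ℝ → ℂ} {α u β : ℝ} (hαu : α < u) (huβ : u ≤ β)
    (hu1 : u - α < 1) (hc : ContinuousOn c (Icc α β)) (hinj : InjOn c (Icc α β))
    (harm : ∀ x ∈ Icc α u, c x = A.g (1 - (x - α))) :
    ∀ᶠ z in 𝓝 (A.g 1), (z ∈ c '' Icc α β ↔ z ∈ A.g '' Icc 0 1 ∪ B.g '' Icc 0 1) := by
  have m1 : (1 : ℝ) ∈ Ioc (0 : ℝ) 1 := ⟨one_pos, le_rfl⟩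
  have k1 : IsClosed (A.g '' Icc 0 (1 - (u - α))) :=
    (A.isCompact_image isCompact_Icc (Icc_subset_Icc_right (by linarith))).isClosed
  have k2 := B.isClosed_image
  have k3 : IsClosed (c '' Icc u β) :=
    (isCompact_Icc.image_of_continuousOn (hc.mono (Icc_subset_Icc_left hαu.le))).isClosed
  have n1 : A.g 1 ∉ A.g '' Icc 0 (1 - (u - α)) := by
    rintro ⟨t, ht, h⟩
    have := A.inj ⟨ht.1, by linarith [ht.2]⟩ (Ioc_subset_Icc_self m1) h
    linarith [ht.2]
  have n2 : A.g 1 ∉ B.g '' Icc 0 1 := by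
    rintro ⟨t, ht, h⟩
    exact hAB.ne m1 ht h.symm
  have n3 : A.g 1 ∉ c '' Icc u β := by
    rintro ⟨x, hx, h⟩
    have h1 := harm α ⟨le_rfl, hαu.le⟩
    rw [sub_self, sub_zero, ← h] at h1
    have := hinj ⟨le_rfl, by linarith⟩ ⟨by linarith [hx.1], hx.2⟩ h1
    linarith [hx.1]
  filter_upwards [k1.isOpen_compl.mem_nhds n1, k2.isOpen_compl.mem_nhds n2,
    k3.isOpen_compl.mem_nhds n3] with z h1 h2 h3
  constructor
  · rintro ⟨x, hx, rfl⟩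
    have hxu : x < u := by
      by_contra hcon
      exact h3 ⟨x, ⟨not_lt.1 hcon, hx.2⟩, rfl⟩
    exact Or.inl ⟨1 - (x - α), ⟨by linarith, by linarith [hx.1]⟩, (harm x ⟨hx.1, hxu.le⟩).symm⟩
  · rintro (⟨t, ht, rfl⟩ | h)
    · have htu : 1 - (u - α) < t := by
        by_contra hcon
        exact h1 ⟨t, ⟨ht.1, not_lt.1 hcon⟩, rfl⟩
      refine ⟨α + 1 - t, ⟨by linarith [ht.2], by linarith⟩, ?_⟩
      rw [harm _ ⟨by linarith [ht.2], by linarith⟩]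
      congr 1; ring
    · exact absurd h h2

namespace Arc
variable {U : Set ℂ}

lemma continuousOn (C : Arc A B U) : ContinuousOn C.c (Icc C.α C.β) := fun x hx =>
  (C.c2At x hx).continuousAt.continuousWithinAt

lemma αβ (C : Arc A B U) : C.α < C.β := C.αu.trans (C.uv.trans C.vβ)

lemma map_α (C : Arc A B U) : C.c C.α = A.g 1 := by
  rw [C.arm₁ _ ⟨le_rfl, C.αu.le⟩, sub_self, sub_zero]

lemma map_β (C : Arc A B U) : C.c C.β = B.g 1 := by
  rw [C.arm₂ _ ⟨C.vβ.le, le_rfl⟩, sub_self, sub_zero]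

lemma near₁ (hAB : Apart A B) (C : Arc A B U) : ∀ᶠ z in 𝓝 (A.g 1),
    (z ∈ C.c '' Icc C.α C.β ↔ z ∈ A.g '' Icc 0 1 ∪ B.g '' Icc 0 1) :=
  eventually_near_end hAB C.αu (C.uv.trans C.vβ).le C.lt₁ C.continuousOn C.inj C.arm₁

lemma near₂ (hAB : Apart A B) (C : Arc A B U) : ∀ᶠ z in 𝓝 (B.g 1),
    (z ∈ C.c '' Icc C.α C.β ↔ z ∈ A.g '' Icc 0 1 ∪ B.g '' Icc 0 1) := by
  have hm : MapsTo (fun x => C.α + C.β - x) (Icc C.α C.β) (Icc C.α C.β) := fun x hx =>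
    ⟨by linarith [hx.2], by linarith [hx.1]⟩
  have himg : (fun x => C.c (C.α + C.β - x)) '' Icc C.α C.β = C.c '' Icc C.α C.β := by
    ext z
    constructor
    · rintro ⟨x, hx, rfl⟩; exact ⟨_, hm hx, rfl⟩
    · rintro ⟨x, hx, rfl⟩; exact ⟨_, hm hx, by simp⟩
  have := eventually_near_end hAB.symm (c := fun x => C.c (C.α + C.β - x)) (α := C.α) (β := C.β)
    (u := C.α + C.β - C.v) (by linarith [C.vβ]) (by linarith [C.αu, C.uv]) (by linarith [C.lt₂])
    (C.continuousOn.comp (by fun_prop) hm)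
    (fun x hx y hy h => by have := C.inj (hm hx) (hm hy) h; linarith)
    (fun x hx => by
      rw [C.arm₂ _ ⟨by linarith [hx.2], by linarith [hx.1]⟩]; congr 1; ring)
  rwa [himg, union_comm] at this

lemma mem_closure (C : Arc A B U) {σ : ℝ} (hU : IsComp (region A B) U) (hσ : σ = 1 ∨ σ = -1)
    (h₁ : A.HasSide σ U) (h₂ : B.HasSide (-σ) U) {x : ℝ} (hx : x ∈ Icc C.α C.β) :
    C.c x ∈ closure U ∧ C.c x ≠ 0 := by
  have hσ' : -σ = 1 ∨ -σ = -1 := by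
    rcases hσ with rfl | rfl
    exacts [Or.inr rfl, Or.inl (by norm_num)]
  have := C.lt₁
  have := C.lt₂
  rcases le_or_gt x C.u with h | h
  · rw [C.arm₁ x ⟨hx.1, h⟩]
    have ht : 1 - (x - C.α) ∈ Ioc (0 : ℝ) 1 := ⟨by linarith, by linarith [hx.1]⟩
    exact ⟨h₁.mem_closure hσ (Ioc_subset_Icc_self ht), A.g_ne_zero ht⟩
  rcases lt_or_ge x C.v with h' | h'
  · have hm := C.mem x ⟨h, h'⟩
    refine ⟨subset_closure hm, fun h0 => (hU.sub hm).2 (Or.inl ⟨0, by simp, ?_⟩)⟩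
    rw [A.zero, h0]
  · rw [C.arm₂ x ⟨h', hx.2⟩]
    have ht : 1 - (C.β - x) ∈ Ioc (0 : ℝ) 1 := ⟨by linarith, by linarith [hx.2]⟩
    exact ⟨h₂.mem_closure hσ' (Ioc_subset_Icc_self ht), B.g_ne_zero ht⟩

end Arc
end Arm

/-! ### Differentiability on an interval and extension beyond its end. -/

section C2At
variable {E F : Type*} [NormedAddCommGroup E] [NormedSpace ℝ E] [NormedAddCommGroup F]
  [NormedSpace ℝ F] {f f1 f2 : ℝ → E} {s : Set ℝ}

lemma C2At.contDiffOn (hs : UniqueDiffOn ℝ s) (h : ∀ t ∈ s, C2At f f1 f2 t) :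
    ContDiffOn ℝ 2 f s ∧ (∀ t ∈ s, derivWithin f s t = f1 t) ∧
      ∀ t ∈ s, derivWithin (derivWithin f s) s t = f2 t := by
  have h1 : ∀ t ∈ s, derivWithin f s t = f1 t := fun t ht =>
    (h t ht).hasDerivAt.hasDerivWithinAt.derivWithin (hs t ht)
  have h2 : ∀ t ∈ s, HasDerivWithinAt (derivWithin f s) (f2 t) s t := fun t ht =>
    (h t ht).hasDerivAt'.hasDerivWithinAt.congr h1 (h1 t ht)
  have h3 : ∀ t ∈ s, derivWithin (derivWithin f s) s t = f2 t := fun t ht =>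
    (h2 t ht).derivWithin (hs t ht)
  refine ⟨?_, h1, h3⟩
  rw [show (2 : WithTop ℕ∞) = 1 + 1 by norm_num, contDiffOn_succ_iff_derivWithin hs]
  refine ⟨fun t ht => (h t ht).hasDerivAt.differentiableAt.differentiableWithinAt,
    fun h => absurd h (by decide), ?_⟩
  rw [show (1 : WithTop ℕ∞) = 0 + 1 by norm_num, contDiffOn_succ_iff_derivWithin hs]
  refine ⟨fun t ht => (h2 t ht).differentiableWithinAt, fun h => absurd h (by decide), ?_⟩
  rw [contDiffOn_zero]
  exact ContinuousOn.congr (fun t ht => (h t ht).cont.continuousWithinAt) h3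

lemma C2At.comp_affine {α δ x : ℝ} (h : C2At f f1 f2 (α + δ * x)) :
    C2At (fun y => f (α + δ * y)) (fun y => δ • f1 (α + δ * y)) (fun y => (δ * δ) • f2 (α + δ * y))
      x := by
  have hl : HasDerivAt (fun y => α + δ * y) δ x := by
    simpa using ((hasDerivAt_id x).const_mul δ).const_add α
  refine ⟨h.hasDerivAt.scomp x hl, ?_, ?_⟩
  · have := (h.hasDerivAt'.scomp x hl).const_smul δ
    rwa [smul_smul] at this
  · exact (ContinuousAt.comp (f := fun y => α + δ * y) h.cont hl.continuousAt).const_smul _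

lemma C2At.clm_comp {x : ℝ} (h : C2At f f1 f2 x) (L : E →L[ℝ] F) (p : F) :
    C2At (fun y => p + L (f y)) (fun y => L (f1 y)) (fun y => L (f2 y)) x :=
  ⟨(L.hasFDerivAt.comp_hasDerivAt x h.hasDerivAt).const_add p,
    L.hasFDerivAt.comp_hasDerivAt x h.hasDerivAt',
    ContinuousAt.comp (f := f2) L.continuous.continuousAt h.cont⟩

lemma hasDerivAt_ite_le {f g f' g' : ℝ → E} {c x : ℝ}
    (hf : x ≤ c → HasDerivWithinAt f (f' x) (Iic c) x) (hg : c ≤ x → HasDerivAt g (g' x) x)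
    (h : f c = g c) (h' : f' c = g' c) :
    HasDerivAt (fun y => if y ≤ c then f y else g y) (if x ≤ c then f' x else g' x) x := by
  rcases lt_trichotomy x c with hx | rfl | hx
  · rw [if_pos hx.le]
    refine ((hf hx.le).hasDerivAt (Iic_mem_nhds hx)).congr_of_eventuallyEq ?_
    filter_upwards [Iio_mem_nhds hx] with y hy
    exact if_pos (le_of_lt hy)
  · rw [if_pos le_rfl]
    have h1 : HasDerivWithinAt (fun y => if y ≤ x then f y else g y) (f' x) (Iic x) x :=
      (hf le_rfl).congr (fun y hy => if_pos hy) (if_pos le_rfl)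
    have h2 : HasDerivWithinAt (fun y => if y ≤ x then f y else g y) (f' x) (Ici x) x := by
      rw [h']
      refine (hg le_rfl).hasDerivWithinAt.congr (fun y hy => ?_) (by rw [if_pos le_rfl, h])
      rcases (mem_Ici.1 hy).eq_or_lt with rfl | hy'
      · rw [if_pos le_rfl, h]
      · rw [if_neg (not_le.2 hy')]
    have := h1.union h2
    rwa [Iic_union_Ici, hasDerivWithinAt_univ] at this
  · rw [if_neg (not_le.2 hx)]
    refine (hg hx.le).congr_of_eventuallyEq ?_
    filter_upwards [Ioi_mem_nhds hx] with y hy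
    exact if_neg (not_le.2 hy)

/-- A `C²` function on `(0, 1]` has a `C²` extension beyond `1`. -/
lemma exists_extension (hf : ContDiffOn ℝ 2 f (Ioc 0 1)) : ∃ g g1 g2 : ℝ → E,
    (∀ t > 0, C2At g g1 g2 t) ∧ (∀ t ≤ 1, g t = f t) ∧
    (∀ t ≤ 1, g1 t = derivWithin f (Ioc 0 1) t) ∧
    ∀ t ≤ 1, g2 t = derivWithin (derivWithin f (Ioc 0 1)) (Ioc 0 1) t := by
  have hs : UniqueDiffOn ℝ (Ioc (0 : ℝ) 1) := uniqueDiffOn_Ioc 0 1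
  rw [show (2 : WithTop ℕ∞) = 1 + 1 by norm_num, contDiffOn_succ_iff_derivWithin hs] at hf
  obtain ⟨h1, -, h2⟩ := hf
  rw [show (1 : WithTop ℕ∞) = 0 + 1 by norm_num, contDiffOn_succ_iff_derivWithin hs] at h2
  obtain ⟨h2, -, h3⟩ := h2
  rw [contDiffOn_zero] at h3
  set D := derivWithin f (Ioc 0 1)
  set D' := derivWithin D (Ioc 0 1)
  have hnh : ∀ t > (0 : ℝ), Ioc (0 : ℝ) 1 ∈ 𝓝[Iic 1] t := fun t ht => by
    rw [← Ioi_inter_Iic]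
    exact inter_mem (mem_nhdsWithin_of_mem_nhds (Ioi_mem_nhds ht)) self_mem_nhdsWithin
  have d1 : ∀ t > 0, t ≤ 1 → HasDerivWithinAt f (D t) (Iic 1) t := fun t ht ht' =>
    (h1 t ⟨ht, ht'⟩).hasDerivWithinAt.mono_of_mem_nhdsWithin (hnh t ht)
  have d2 : ∀ t > 0, t ≤ 1 → HasDerivWithinAt D (D' t) (Iic 1) t := fun t ht ht' =>
    (h2 t ⟨ht, ht'⟩).hasDerivWithinAt.mono_of_mem_nhdsWithin (hnh t ht)
  have hl : ∀ t : ℝ, HasDerivAt (fun t : ℝ => t - 1) 1 t := fun t => (hasDerivAt_id t).sub_const 1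
  -- Beyond 1 the function is continued by its Taylor polynomial of degree two.
  refine ⟨fun t => if t ≤ 1 then f t else f 1 + ((t - 1) • D 1 + ((t - 1) ^ 2 / 2) • D' 1),
    fun t => if t ≤ 1 then D t else D 1 + (t - 1) • D' 1, fun t => if t ≤ 1 then D' t else D' 1,
    fun t ht => ⟨?_, ?_, ?_⟩, fun t ht => if_pos ht, fun t ht => if_pos ht, fun t ht => if_pos ht⟩
  · refine hasDerivAt_ite_le (f := f) (f' := D) (c := 1)
      (g := fun t => f 1 + ((t - 1) • D 1 + ((t - 1) ^ 2 / 2) • D' 1))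
      (g' := fun t => D 1 + (t - 1) • D' 1) (d1 t ht) (fun _ => ?_) (by simp) (by simp)
    have h4 : HasDerivAt (fun t : ℝ => (t - 1) ^ 2 / 2) (t - 1) t :=
      (((hl t).pow 2).div_const 2).congr_deriv (by norm_num)
    exact ((((hl t).smul_const (D 1)).add (h4.smul_const (D' 1))).const_add (f 1)).congr_deriv
      (by rw [one_smul])
  · refine hasDerivAt_ite_le (f := D) (f' := D') (c := 1) (g := fun t => D 1 + (t - 1) • D' 1)
      (g' := fun _ => D' 1) (d2 t ht) (fun _ => ?_) (by simp) rfl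
    exact (((hl t).smul_const (D' 1)).const_add (D 1)).congr_deriv (by rw [one_smul])
  · rcases lt_trichotomy t 1 with h | rfl | h
    · refine (h3.continuousAt (Ioc_mem_nhds ht h)).congr ?_
      filter_upwards [Iio_mem_nhds h] with y hy
      exact (if_pos (le_of_lt hy)).symm
    · rw [continuousAt_iff_continuous_left_right]
      constructor
      · refine ((h3 1 ⟨ht, le_rfl⟩).mono_of_mem_nhdsWithin (hnh 1 ht)).congr
          (fun y hy => if_pos hy) (if_pos le_rfl)
      · refine (continuousWithinAt_const (b := D' 1)).congr (fun y hy => ?_) (if_pos le_rfl)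
        rcases (mem_Ici.1 hy).eq_or_lt with rfl | hy'
        · exact if_pos le_rfl
        · exact if_neg (not_le.2 hy')
    · refine (continuousAt_const (y := D' 1)).congr ?_
      filter_upwards [Ioi_mem_nhds h] with y hy
      exact (if_neg (not_le.2 hy)).symm

end C2At

/-! ### Transfer between the complex numbers and the plane. -/

/-- The identification of the complex numbers with the plane. -/
noncomputable abbrev toPlane : ℂ ≃ₗᵢ[ℝ] Plane := Complex.orthonormalBasisOneI.repr

lemma toPlane_I_mul (z : ℂ) : toPlane (Complex.I * z) = !₂[-(toPlane z 1), toPlane z 0] := by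
  ext i
  fin_cases i <;> simp [toPlane]

section curvature
variable {γ : ℝ → Plane} {I : Set ℝ} {t : ℝ} {v a : ℂ}

lemma leftNormal_eq (hv : derivWithin γ I t = toPlane v) :
    leftNormal γ I t = toPlane ((‖v‖⁻¹ : ℝ) * (Complex.I * v)) := by
  rw [leftNormal, hv, LinearIsometryEquiv.norm_map, ← toPlane_I_mul, ← map_smul, Complex.real_smul]

lemma geodesicCurvature_eq (hv : derivWithin γ I t = toPlane v)
    (ha : derivWithin (derivWithin γ I) I t = toPlane a) :
    geodesicCurvature γ I (leftNormal γ I t) t = cross v a * ‖v‖⁻¹ / ‖v‖ ^ 2 := by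
  rw [geodesicCurvature, leftNormal_eq hv, ha, hv, LinearIsometryEquiv.norm_map,
    LinearIsometryEquiv.inner_map_map]
  congr 1
  rw [Complex.inner]
  simp [cross]
  ring

lemma isInflection_iff (hv : derivWithin γ I t = toPlane v)
    (ha : derivWithin (derivWithin γ I) I t = toPlane a) (h0 : v ≠ 0) :
    IsInflection γ I t ↔ cross v a = 0 := by
  rw [IsInflection, geodesicCurvature_eq hv ha]
  have := norm_pos_iff.2 h0
  simp [h0]

lemma principalNormal_eq (hv : derivWithin γ I t = toPlane v)
    (ha : derivWithin (derivWithin γ I) I t = toPlane a) (h0 : v ≠ 0) {s : ℝ}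
    (hs : s = 1 ∨ s = -1) (hsc : 0 < s * cross v a) :
    principalNormal γ I t = toPlane ((s * ‖v‖⁻¹ : ℝ) * (Complex.I * v)) := by
  have hn := norm_pos_iff.2 h0
  have hsign : Real.sign (cross v a * ‖v‖⁻¹ / ‖v‖ ^ 2) = s := by
    rcases hs with rfl | rfl
    · rw [one_mul] at hsc
      exact Real.sign_of_pos (by positivity)
    · have h1 : 0 < -cross v a * ‖v‖⁻¹ / ‖v‖ ^ 2 := by
        have : 0 < -cross v a := by linarith
        positivity
      exact Real.sign_of_neg (by rw [neg_mul, neg_div] at h1; linarith)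
  rw [principalNormal, geodesicCurvature_eq hv ha, hsign, leftNormal_eq hv, ← map_smul,
    Complex.real_smul]
  congr 1
  push_cast; ring

end curvature

/-- The plane as the complex plane with origin at `o`. -/
noncomputable def chart (o : Plane) : ℂ ≃ₜ Plane :=
  toPlane.toHomeomorph.trans (Homeomorph.addLeft o)

lemma chart_apply (o : Plane) (z : ℂ) : chart o z = o + toPlane z := rfl

lemma chart_zero (o : Plane) : chart o 0 = o := by
  rw [chart_apply, LinearIsometryEquiv.map_zero, add_zero]

lemma chart_combo (o : Plane) {a b : ℝ} (h : a + b = 1) (x y : ℂ) :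
    chart o (a • x + b • y) = a • chart o x + b • chart o y := by
  simp only [chart_apply, map_add, map_smul, smul_add]
  rw [add_add_add_comm, ← add_smul, h, one_smul]

/-- The arm describes the curve `γ` in the chart at `o`. -/
structure Arm.Models {R : ℝ} (A : Arm R) (γ : ℝ → Plane) (o : Plane) : Prop where
  eq : ∀ t ∈ Icc (0 : ℝ) 1, γ t = chart o (A.g t)
  deriv : ∀ t ∈ Ioc (0 : ℝ) 1, derivWithin γ (Ioc 0 1) t = toPlane (A.v t)
  deriv₂ : ∀ t ∈ Ioc (0 : ℝ) 1,
    derivWithin (derivWithin γ (Ioc 0 1)) (Ioc 0 1) t = toPlane (A.a t)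

/-- A spiral as an arm in the complex plane. -/
lemma IsSpiral.exists_arm {γ : ℝ → Plane} {o : Plane} {R : ℝ} (h : IsSpiral γ o R) :
    ∃ A : Arm R, A.Models γ o := by
  obtain ⟨g, g1, g2, hg, e0, e1, e2⟩ := exists_extension h.regular.contDiffOn
  set L : Plane →L[ℝ] ℂ := toPlane.symm.toContinuousLinearEquiv.toContinuousLinearMap with hL
  have hLs : ∀ x, L x = toPlane.symm x := fun _ => rfl
  set G : ℝ → ℂ := fun t => -L o + L (g t) with hG
  have hC : ∀ t > 0, C2At G (fun t => L (g1 t)) (fun t => L (g2 t)) t := fun t ht =>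
    (hg t ht).clm_comp L (-L o)
  have hGe : ∀ t ∈ Icc (0 : ℝ) 1, γ t = o + toPlane (G t) := fun t ht => by
    simp only [hG, hLs, map_add, map_neg, LinearIsometryEquiv.apply_symm_apply, e0 t ht.2]
    abel
  have hnorm : ∀ t ∈ Icc (0 : ℝ) 1, ‖G t‖ = dist (γ t) o := fun t ht => by
    rw [hGe t ht, dist_self_add_left, LinearIsometryEquiv.norm_map]
  have hd : ∀ t ∈ Ioc (0 : ℝ) 1, derivWithin γ (Ioc 0 1) t = toPlane (L (g1 t)) ∧
      derivWithin (derivWithin γ (Ioc 0 1)) (Ioc 0 1) t = toPlane (L (g2 t)) := fun t ht => by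
    rw [← e1 t ht.2, ← e2 t ht.2, hLs, hLs, LinearIsometryEquiv.apply_symm_apply,
      LinearIsometryEquiv.apply_symm_apply]
    exact ⟨rfl, rfl⟩
  have hne : ∀ t ∈ Ioc (0 : ℝ) 1, cross (L (g1 t)) (L (g2 t)) ≠ 0 := fun t ht h0 => by
    obtain ⟨h1, h2⟩ := hd t ht
    refine h.no_inflection t ht ((isInflection_iff h1 h2 fun h3 => ?_).2 h0)
    rw [h3] at h1
    exact h.regular.deriv_ne_zero t ht (h1.trans (LinearIsometryEquiv.map_zero _))
  have hcr : ∀ t > 0, ContinuousAt (fun t => cross (L (g1 t)) (L (g2 t))) t := fun t ht =>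
    (hC t ht).hasDerivAt'.continuousAt.cross (hC t ht).cont
  -- The curvature term is continuous and has no zero on (0, 1], so its sign is constant there.
  obtain ⟨s, hs, hsc⟩ : ∃ s : ℝ, (s = 1 ∨ s = -1) ∧
      ∀ t ∈ Ioc (0 : ℝ) 1, 0 < s * cross (L (g1 t)) (L (g2 t)) := by
    have hc : ContinuousOn (fun t => cross (L (g1 t)) (L (g2 t))) (Ioc 0 1) := fun t ht =>
      (hcr t ht.1).continuousWithinAt
    have m1 : (1 : ℝ) ∈ Ioc (0 : ℝ) 1 := ⟨one_pos, le_rfl⟩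
    rcases (hne 1 m1).lt_or_gt with h1 | h1
    · refine ⟨-1, Or.inr rfl, fun t ht => ?_⟩
      by_contra hcon
      obtain ⟨x, hx, hx0⟩ := isPreconnected_Ioc.intermediate_value m1 ht hc
        (⟨h1.le, by linarith⟩ : (0 : ℝ) ∈ Icc _ _)
      exact hne x hx hx0
    · refine ⟨1, Or.inl rfl, fun t ht => ?_⟩
      by_contra hcon
      obtain ⟨x, hx, hx0⟩ := isPreconnected_Ioc.intermediate_value ht m1 hc
        (⟨by linarith, h1.le⟩ : (0 : ℝ) ∈ Icc _ _)
      exact hne x hx hx0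
  -- By continuity the sign of the curvature persists a little beyond 1 for the extended curve.
  obtain ⟨b, hb, hbs⟩ : ∃ b > 1, ∀ t ∈ Ioo (0 : ℝ) b, 0 < s * cross (L (g1 t)) (L (g2 t)) := by
    have hev := ((hcr 1 one_pos).const_mul s).eventually
      (lt_mem_nhds (hsc 1 ⟨one_pos, le_rfl⟩))
    obtain ⟨ε, hε, hb⟩ := Metric.eventually_nhds_iff.1 hev
    refine ⟨1 + ε, by linarith, fun t ht => ?_⟩
    rcases le_or_gt t 1 with h1 | h1
    · exact hsc t ⟨ht.1, h1⟩
    · exact hb (by rw [Real.dist_eq, abs_of_pos (by linarith)]; linarith [ht.2])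
  refine ⟨{
    g := G
    v := fun t => L (g1 t)
    a := fun t => L (g2 t)
    s := s
    b := b
    one_lt := hb
    hasDerivAt := fun t ht => (hC t ht.1).hasDerivAt
    hasDerivAt_v := fun t ht => (hC t ht.1).hasDerivAt'
    cont_a := fun t ht => (hC t ht.1).cont.continuousWithinAt
    cont := ?_
    zero := ?_
    inj := fun t ht t' ht' htt' => ?_
    sign := hs
    curv := hbs
    norm_lt := fun t ht => ?_
    norm_one := ?_ }, hGe, fun t ht => (hd t ht).1, fun t ht => (hd t ht).2⟩
  · refine ContinuousOn.congr (f := fun t => -L o + L (γ t))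
      (continuousOn_const.add (L.continuous.comp_continuousOn h.continuousOn)) fun t ht => ?_
    simp only [hG, e0 t ht.2]
  · simp only [hG, e0 0 zero_le_one, h.map_zero, neg_add_cancel]
  · exact h.injOn ht ht' (by rw [hGe t ht, hGe t' ht', htt'])
  · have ht' : t ∈ Icc (0 : ℝ) 1 := ⟨ht.1, ht.2.le⟩
    have h1 := h.mem_ball t ht'
    rw [hnorm t ht']
    exact lt_of_le_of_ne (Metric.mem_closedBall.1 h1) fun h2 =>
      ht.2.ne ((h.mem_sphere_iff t ht').1 (Metric.mem_sphere.2 h2))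
  · rw [hnorm 1 ⟨zero_le_one, le_rfl⟩]
    exact Metric.mem_sphere.1 ((h.mem_sphere_iff 1 ⟨zero_le_one, le_rfl⟩).2 rfl)

namespace Arm
variable {R : ℝ} {A : Arm R} {γ : ℝ → Plane} {o : Plane}

lemma Models.image (h : A.Models γ o) : γ '' Icc 0 1 = chart o '' (A.g '' Icc 0 1) := by
  rw [image_image]
  exact image_congr h.eq

lemma Models.add_normal (h : A.Models γ o) {t : ℝ} (ht : t ∈ Ioo (0 : ℝ) 1) (r : ℝ) :
    γ t + r • principalNormal γ (Ioc 0 1) t =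
      chart o (A.g t + r * ((A.s * ‖A.v t‖⁻¹ : ℝ) * (Complex.I * A.v t))) := by
  have ht' := Ioo_subset_Ioc_self ht
  rw [principalNormal_eq (h.deriv t ht') (h.deriv₂ t ht') (A.v_ne_zero (A.mem_of_Ioo ht)) A.sign
    (A.curv t (A.mem_of_Ioo ht)), h.eq t (Ioo_subset_Icc_self ht), chart_apply, chart_apply,
    map_add, ← Complex.real_smul, ← Complex.real_smul, map_smul, map_smul, map_smul,
    add_assoc]

lemma Models.normals_iff (h : A.Models γ o) {B : Arm R} (hAB : Apart A B) {W : Set ℂ}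
    (hW : IsComp (region A B) W) :
    (∀ t ∈ Ioo (0 : ℝ) 1, ∀ᶠ r : ℝ in 𝓝[>] 0,
      γ t + r • principalNormal γ (Ioc 0 1) t ∈ chart o '' closure W) ↔ A.HasSide A.s W := by
  constructor
  · intro hn
    refine hasSide_of_normal hAB hW fun t ht => ?_
    filter_upwards [hn t ht] with r hr
    rwa [h.add_normal ht, (chart o).injective.mem_set_image] at hr
  · intro hs t ht
    filter_upwards [(hs t ht).eventually_mem (A.normal_pos ht)] with r hr
    rw [h.add_normal ht]
    exact mem_image_of_mem _ (subset_closure hr)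

end Arm

lemma image_chart_closedBall (o : Plane) (R : ℝ) :
    chart o '' Metric.closedBall 0 R = Metric.closedBall o R := by
  ext x
  rw [← (chart o).apply_symm_apply x, (chart o).injective.mem_set_image,
    mem_closedBall_zero_iff, Metric.mem_closedBall, chart_apply, dist_self_add_left,
    LinearIsometryEquiv.norm_map]

namespace DoubleSpiral
open Arm
variable {Γ : DoubleSpiral} {A B : Arm Γ.radius}

lemma carrier_eq (h₁ : A.Models Γ.arm₁ Γ.vortex) (h₂ : B.Models Γ.arm₂ Γ.vortex) :
    Γ.carrier = chart Γ.vortex '' (A.g '' Icc 0 1 ∪ B.g '' Icc 0 1) := by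
  rw [carrier, h₁.image, h₂.image, image_union]

lemma apart (h₁ : A.Models Γ.arm₁ Γ.vortex) (h₂ : B.Models Γ.arm₂ Γ.vortex) : Apart A B := by
  have := Γ.inter_arms
  rw [h₁.image, h₂.image, ← image_inter (chart _).injective] at this
  rw [Apart, ← ((chart Γ.vortex).injective.image_injective).eq_iff, this, image_singleton,
    chart_zero]

lemma isSide_iff (h₁ : A.Models Γ.arm₁ Γ.vortex) (h₂ : B.Models Γ.arm₂ Γ.vortex)
    {S : Set Plane} :
    Γ.IsSide S ↔ ∃ U, IsComp (region A B) U ∧ S = chart Γ.vortex '' closure U := by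
  have hr : Γ.ball \ Γ.carrier = chart Γ.vortex '' region A B := by
    rw [carrier_eq h₁ h₂, ball, ← image_chart_closedBall, region,
      image_sdiff (chart _).injective]
  have hc : ∀ z ∈ region A B, chart Γ.vortex '' closure (connectedComponentIn (region A B) z) =
      closure (connectedComponentIn (Γ.ball \ Γ.carrier) (chart Γ.vortex z)) := fun z hz => by
    rw [hr, ← Homeomorph.image_connectedComponentIn _ hz, Homeomorph.image_closure]
  constructor
  · rintro ⟨x, hx, rfl⟩
    obtain ⟨z, hz, rfl⟩ := hr ▸ hx
    exact ⟨_, isComp_connectedComponentIn hz, (hc z hz).symm⟩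
  · rintro ⟨U, hU, rfl⟩
    obtain ⟨z, hz⟩ := hU.nonempty
    have hzΩ := hU.sub hz
    refine ⟨chart Γ.vortex z, hr ▸ mem_image_of_mem _ hzΩ, ?_⟩
    rw [← hc z hzΩ, hU.eq (isComp_connectedComponentIn hzΩ)
      ⟨z, hz, mem_connectedComponentIn hzΩ⟩]

lemma proper_of_isProperSide {U : Set ℂ}
    (h : Γ.IsProperSide (chart Γ.vortex '' closure U)) : Proper U := by
  rintro ⟨x, y, hxy, ⟨a, b, ha, hb, hab, h0⟩, hseg⟩
  refine h.2 ⟨chart Γ.vortex x, chart Γ.vortex y, (chart _).injective.ne hxy, ⟨a, b, ha, hb, hab, ?_⟩, ?_⟩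
  · rw [← chart_combo _ hab, h0, chart_zero]
  · rintro _ ⟨a, b, ha, hb, hab, rfl⟩
    rw [← chart_combo _ hab]
    exact mem_image_of_mem _ (hseg ⟨a, b, ha, hb, hab, rfl⟩)

lemma normalsPointInto_iff (h₁ : A.Models Γ.arm₁ Γ.vortex) (h₂ : B.Models Γ.arm₂ Γ.vortex)
    {W : Set ℂ} (hW : IsComp (region A B) W) :
    Γ.NormalsPointInto (chart Γ.vortex '' closure W) ↔ A.HasSide A.s W ∧ B.HasSide B.s W :=
  and_congr (h₁.normals_iff (apart h₁ h₂) hW)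
    (h₂.normals_iff (apart h₁ h₂).symm (region_comm A B ▸ hW))

end DoubleSpiral

namespace Arm.Arc
variable {R : ℝ} {A B : Arm R} {U : Set ℂ}

/-- The arc in the plane, parametrized by the unit interval. -/
noncomputable def curve (C : Arc A B U) (o : Plane) (t : ℝ) : Plane :=
  chart o (C.c (C.α + (C.β - C.α) * t))

lemma mapsTo_param (C : Arc A B U) :
    MapsTo (fun t => C.α + (C.β - C.α) * t) (Icc 0 1) (Icc C.α C.β) := fun t ht => by
  have := C.αβ
  constructor <;> nlinarith [ht.1, ht.2]

lemma image_param (C : Arc A B U) :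
    (fun t => C.α + (C.β - C.α) * t) '' Icc 0 1 = Icc C.α C.β := by
  have h := sub_pos.2 C.αβ
  refine C.mapsTo_param.image_subset.antisymm fun x hx => ?_
  refine ⟨(x - C.α) / (C.β - C.α), ⟨div_nonneg (by linarith [hx.1]) h.le, ?_⟩, ?_⟩
  · rw [div_le_one h]; linarith [hx.2]
  · simp only
    rw [mul_div_cancel₀ _ h.ne']; ring

lemma image_curve (C : Arc A B U) (o : Plane) :
    C.curve o '' Icc 0 1 = chart o '' (C.c '' Icc C.α C.β) := by
  rw [← C.image_param, image_image, image_image]; rfl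

lemma curve_zero (C : Arc A B U) (o : Plane) : C.curve o 0 = chart o (A.g 1) := by
  rw [curve, mul_zero, add_zero, C.map_α]

lemma curve_one (C : Arc A B U) (o : Plane) : C.curve o 1 = chart o (B.g 1) := by
  rw [curve, mul_one, add_sub_cancel, C.map_β]

lemma curve_deriv (C : Arc A B U) (o : Plane) : ContDiffOn ℝ 2 (C.curve o) (Icc 0 1) ∧
    (∀ t ∈ Icc (0 : ℝ) 1, derivWithin (C.curve o) (Icc 0 1) t =
      toPlane ((C.β - C.α) • C.c1 (C.α + (C.β - C.α) * t))) ∧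
    ∀ t ∈ Icc (0 : ℝ) 1, derivWithin (derivWithin (C.curve o) (Icc 0 1)) (Icc 0 1) t =
      toPlane (((C.β - C.α) * (C.β - C.α)) • C.c2 (C.α + (C.β - C.α) * t)) :=
  C2At.contDiffOn uniqueDiffOn_Icc_zero_one fun _ ht =>
    (C.c2At _ (C.mapsTo_param ht)).comp_affine.clm_comp
      toPlane.toContinuousLinearEquiv.toContinuousLinearMap o

lemma injOn_curve (C : Arc A B U) (o : Plane) : InjOn (C.curve o) (Icc 0 1) := by
  intro t ht t' ht' h
  have h1 := C.inj (C.mapsTo_param ht) (C.mapsTo_param ht') ((chart o).injective h)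
  exact mul_left_cancel₀ (sub_pos.2 C.αβ).ne' (add_left_cancel h1)

lemma curve_vel_ne_zero (C : Arc A B U) {t : ℝ} (ht : t ∈ Icc (0 : ℝ) 1) :
    (C.β - C.α) • C.c1 (C.α + (C.β - C.α) * t) ≠ 0 :=
  smul_ne_zero (sub_pos.2 C.αβ).ne' (C.regular _ (C.mapsTo_param ht))

lemma isSimpleC2RegularArc_curve (C : Arc A B U) (o : Plane) :
    IsSimpleC2RegularArc (C.curve o) where
  injOn := C.injOn_curve o
  regular := ⟨(C.curve_deriv o).1, fun t ht h => C.curve_vel_ne_zero ht <| by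
    rwa [(C.curve_deriv o).2.1 t ht, LinearIsometryEquiv.map_eq_zero_iff] at h⟩

/-- Rescaling the parameter multiplies the cross product of velocity and acceleration by a nonzero
constant, and since the arc is simple, inflections as points correspond to inflections as
parameters. -/
lemma encard_inflections (C : Arc A B U) (o : Plane) :
    (inflections (C.curve o) (Icc 0 1)).encard = C.infl.encard := by
  have h : inflections (C.curve o) (Icc 0 1) = (fun x => chart o (C.c x)) '' C.infl := by
    have hi : ∀ t ∈ Icc (0 : ℝ) 1, (IsInflection (C.curve o) (Icc 0 1) t ↔
        C.α + (C.β - C.α) * t ∈ C.infl) := fun t ht => by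
      have h0 := (sub_pos.2 C.αβ).ne'
      rw [isInflection_iff ((C.curve_deriv o).2.1 t ht) ((C.curve_deriv o).2.2 t ht)
        (C.curve_vel_ne_zero ht), Complex.real_smul, Complex.real_smul, cross_real_mul_right,
        cross_real_mul_left]
      simp [infl, h0, C.mapsTo_param ht, -mem_Icc]
    ext x
    constructor
    · rintro ⟨t, ⟨ht, h⟩, rfl⟩
      exact ⟨_, (hi t ht).1 h, rfl⟩
    · rintro ⟨y, hy, rfl⟩
      obtain ⟨t, ht, rfl⟩ := C.image_param.symm ▸ hy.1
      exact ⟨t, ⟨ht, (hi t ht).2 hy⟩, rfl⟩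
  rw [h]
  exact InjOn.encard_image fun x hx y hy hxy => C.inj hx.1 hy.1 ((chart o).injective hxy)

end Arm.Arc

lemma Homeomorph.eventually_mem_image_iff {X Y : Type*} [TopologicalSpace X] [TopologicalSpace Y]
    (φ : X ≃ₜ Y) {s t : Set X} {x : X} (h : ∀ᶠ z in 𝓝 x, (z ∈ s ↔ z ∈ t)) :
    ∀ᶠ y in 𝓝 (φ x), (y ∈ φ '' s ↔ y ∈ φ '' t) := by
  rw [← φ.map_nhds_eq, eventually_map]
  simpa only [φ.injective.mem_set_image] using h

theorem proposition5p3 (Γ : DoubleSpiral) (S : Set Plane) (hS : Γ.IsProperSide S) :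
    ∃ γ : ℝ → Plane,
      IsSimpleC2RegularArc γ ∧
      γ '' Icc 0 1 ⊆ S \ {Γ.vortex} ∧
      γ 0 = Γ.arm₁ 1 ∧ γ 1 = Γ.arm₂ 1 ∧
      (∀ᶠ x in 𝓝 (Γ.arm₁ 1), x ∈ γ '' Icc 0 1 ↔ x ∈ Γ.carrier) ∧
      (∀ᶠ x in 𝓝 (Γ.arm₂ 1), x ∈ γ '' Icc 0 1 ↔ x ∈ Γ.carrier) ∧
      (inflections γ (Icc 0 1)).encard ≤ 2 ∧
      (Γ.IsSemiconvex → (inflections γ (Icc 0 1)).encard = 1) ∧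
      (Γ.IsConvex → (inflections γ (Icc 0 1)).encard = 0) := by
  obtain ⟨A, h₁⟩ := Γ.spiral₁.exists_arm
  obtain ⟨B, h₂⟩ := Γ.spiral₂.exists_arm
  have hAB := DoubleSpiral.apart h₁ h₂
  obtain ⟨U, hU, rfl⟩ := (DoubleSpiral.isSide_iff h₁ h₂).1 hS.1
  have hP := DoubleSpiral.proper_of_isProperSide hS
  obtain ⟨σ, hch⟩ := Arm.exists_chord hAB hU hP
  obtain ⟨C, hC⟩ := Arm.exists_arc hAB hU hch
  obtain ⟨hs, hc⟩ := hch.count hAB hU hP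
  have m1 : (1 : ℝ) ∈ Icc (0 : ℝ) 1 := ⟨zero_le_one, le_rfl⟩
  refine ⟨C.curve Γ.vortex, C.isSimpleC2RegularArc_curve _, ?_, ?_, ?_, ?_, ?_, ?_, ?_, ?_⟩
  · rw [C.image_curve]
    rintro _ ⟨_, ⟨x, hx, rfl⟩, rfl⟩
    obtain ⟨h, h0⟩ := C.mem_closure hU hch.sign hch.side₁ hch.side₂ hx
    refine ⟨mem_image_of_mem _ h, fun he => h0 ((chart Γ.vortex).injective ?_)⟩
    rw [mem_singleton_iff.1 he, chart_zero]
  · rw [C.curve_zero, h₁.eq 1 m1]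
  · rw [C.curve_one, h₂.eq 1 m1]
  · rw [C.image_curve, h₁.eq 1 m1, DoubleSpiral.carrier_eq h₁ h₂]
    exact (chart Γ.vortex).eventually_mem_image_iff (C.near₁ hAB)
  · rw [C.image_curve, h₂.eq 1 m1, DoubleSpiral.carrier_eq h₁ h₂]
    exact (chart Γ.vortex).eventually_mem_image_iff (C.near₂ hAB)
  · rw [C.encard_inflections, hC]
    split_ifs <;> norm_num
  · intro hsc
    have := hs fun ⟨W, hW, hWA, hWB⟩ => hsc ⟨_, (DoubleSpiral.isSide_iff h₁ h₂).2 ⟨W, hW, rfl⟩,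
      (DoubleSpiral.normalsPointInto_iff h₁ h₂ hW).2 ⟨hWA, hWB⟩⟩
    rw [C.encard_inflections, hC]
    -- Without a common side for the normals exactly one of the two arms curves away from U, so
    -- exactly one summand is 1.
    by_cases h : A.s = σ
    · rw [if_pos h, if_neg (this.1 h), zero_add]
    · rw [if_neg h, if_pos (not_not.1 fun h' => h (this.2 h')), add_zero]
  · rintro ⟨T, hT, hn, hTP⟩
    obtain ⟨W, hW, rfl⟩ := (DoubleSpiral.isSide_iff h₁ h₂).1 hT
    obtain ⟨hA, hB⟩ := hc ⟨W, hW, DoubleSpiral.proper_of_isProperSide hTP,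
      (DoubleSpiral.normalsPointInto_iff h₁ h₂ hW).1 hn⟩
    rw [C.encard_inflections, hC, if_pos hA, if_pos hB, add_zero]
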